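/- Let $p$ be a prime. A $\mathbb{Q}$-module with an action of the $p$-adic integers $\mathbb{Z}_p$ is \emph{discrete} if each of its elements is fixed by $p^n\mathbb{Z}_p$ for some $n$; the \emph{discrete part} of a rational $\mathbb{Z}_p$-module consists of all elements with this property. \textbf{The algebraic model $\mathcal{A}$.} An object $M$ consists of $\mathbb{Q}[\mathbb{Z}/p^k]$-modules $M_k$ ($k\ge 0$), a discrete rational $\mathbb{Z}_p$-module $M_\infty$, and a map of $\mathbb{Q}[\mathbb{Z}_p]$-modules $\sigma_M\colon M_\infty\to \operatorname{tails}(M):=\operatorname{colim}_n\prod_{k\ge n}M_k$. A map consists of equivariant linear maps $M_k\to N_k$ and $M_\infty\to N_\infty$ which commute with the maps $\sigma$. The tensor product is levelwise: $(M\otimes N)_k=M_k\otimes_{\mathbb{Q}}N_k$ and $(M\otimes N)_\infty=M_\infty\otimes_{\mathbb{Q}}N_\infty$, with diagonal actions and structure map $M_\infty\otimes N_\infty\to\operatorname{tails}(M)\otimes\operatorname{tails}(N)\to\operatorname{colim}_n\prod_{k\ge n}(M_k\otimes N_k)$, where the second map is $[x]\otimes[y]\mapsto[(x_k\otimes y_k)_k]$.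 \textbf{The sheaf category $\mathcal{B}$.} Let $X=\mathbb{N}\cup\{\infty\}$ be the one-point compactification of the discrete space $\mathbb{N}$; this is the space of closed subgroups of $\mathbb{Z}_p$, where $k$ corresponds to $p^k\mathbb{Z}_p$ and $\infty$ to the trivial group. Put $S_n=\{k\ge n\}\cup\{\infty\}$. Let $\mathcal{B}$ be the category of sheaves of discrete rational $\mathbb{Z}_p$-modules on $X$. For $M,N\in\mathcal{B}$ let $\hom(M,N)\in\mathcal{B}$ be the sheaf whose value at an open set $V$ is the discrete part, for the conjugation action of $\mathbb{Z}_p$, of the space of all ($\mathbb{Q}$-linear, not necessarily equivariant) maps $M|_V\to N|_V$. For $A\in\mathcal{A}$ let $UA\in\mathcal{B}$ be the sheaf with $UA(\{k\})=A_k$, with $UA(S_n)$ the module of pairs $(s,(x_k)_{k\ge n})$, $s\in A_\infty$, $x_k\in A_k$, such that $\sigma_A(s)$ is the class of $(x_k)$, and with truncations as restrictions. For $M\in\mathcal{B}$ with stalk $M_\infty=\operatorname{colim}_nM(S_n)$ at $\infty$, let $RM\in\mathcal{A}$ be the object with $(RM)_k=M(\{k\})^{p^k\mathbb{Z}_p}$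 and with $(RM)_\infty$ the pullback of $M_\infty\to\operatorname{colim}_n\prod_{k\ge n}M(\{k\})\leftarrow\operatorname{colim}_n\prod_{k\ge n}M(\{k\})^{p^k\mathbb{Z}_p}$, with structure map the projection to the last module. Put $\hom_{\mathcal{A}}(A,B)=R\hom(UA,UB)$. \textbf{Statement.} Let $dg\mathcal{A}$ be the category of $\mathbb{Z}$-graded chain complexes in $\mathcal{A}$, with the usual tensor product of complexes: $(K\otimes L)_n=\bigoplus_{i+j=n}K_i\otimes L_j$, with differential $d\otimes 1+(-1)^i\,1\otimes d$ on $K_i\otimes L_j$. The category $dg\mathcal{A}$ has all small limits and colimits, and it is a model category in which a map is a fibration if and only if it is surjective at each $k\ge 0$ and at $\infty$, and a weak equivalence if and only if it is a homology isomorphism at each $k\ge 0$ and at $\infty$. With this model structure $dg\mathcal{A}$ is a monoidal model category which satisfies the monoid axiom. In detail: \begin{enumerate} \item $dg\mathcal{A}$ is a closed symmetric monoidal category. Its symmetry is $x\otimes y\mapsto(-1)^{ij}y\otimes x$ on $K_i\otimes L_j$. For each $A\in\mathcal{A}$ the functor $A\otimes-$ on $\mathcal{A}$ is left adjoint to $\hom_{\mathcal{A}}(A,-)$,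 and the internal hom of $dg\mathcal{A}$ is $\hom(K,L)_n=\prod_{i\in\mathbb{Z}}\hom_{\mathcal{A}}(K_i,L_{i+n})$, the projections being adjoint to the components $K_i\otimes\hom(K,L)_n\to L_{i+n}$ of the evaluation $K\otimes\hom(K,L)\to L$. \item (Pushout-product axiom) If $i\colon A\to B$ and $j\colon X\to Y$ are cofibrations, then $(A\otimes Y)\amalg_{A\otimes X}(B\otimes X)\to B\otimes Y$ is a cofibration, and it is a weak equivalence if $i$ or $j$ is one. \item (Unit axiom) If $q\colon Q\to\mathbb{1}$ is a weak equivalence from a cofibrant object to the monoidal unit, then $q\otimes X$ and $X\otimes q$ are weak equivalences for every cofibrant $X$. \item (Monoid axiom) Every transfinite composition of pushouts of maps of the form $j\otimes Z$, with $j$ a trivial cofibration and $Z$ any object, is a weak equivalence. \end{enumerate} -/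

import Mathlib

open CategoryTheory Limits MonoidalCategory HomotopicalAlgebra

noncomputable section

namespace CommaMonoidal

universe v₁ v₂ v₃ u₁ u₂ u₃

variable {D : Type u₁} [Category.{v₁} D] [MonoidalCategory D]
  {S : Type u₂} [Category.{v₂} S] [MonoidalCategory S]
  {T : Type u₃} [Category.{v₃} T] [MonoidalCategory T]
  (L : D ⥤ T) [L.OplaxMonoidal] (R : S ⥤ T) [R.LaxMonoidal]

open Functor.LaxMonoidal Functor.OplaxMonoidal

theorem w_tensor {X Y X' Y' : Comma L R} (f : X ⟶ Y) (g : X' ⟶ Y') :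
    L.map (f.left ⊗ₘ g.left) ≫ δ L _ _ ≫ (Y.hom ⊗ₘ Y'.hom) ≫ μ R _ _ =
      (δ L _ _ ≫ (X.hom ⊗ₘ X'.hom) ≫ μ R _ _) ≫ R.map (f.right ⊗ₘ g.right) := by
  rw [Category.assoc, Category.assoc, ← μ_natural, tensorHom_comp_tensorHom_assoc, ← f.w, ← g.w,
    ← tensorHom_comp_tensorHom_assoc, δ_natural_assoc]

theorem w_assoc (X Y Z : Comma L R) :
    L.map (α_ X.left Y.left Z.left).hom ≫ δ L _ _ ≫
        (X.hom ⊗ₘ (δ L _ _ ≫ (Y.hom ⊗ₘ Z.hom) ≫ μ R _ _)) ≫ μ R _ _ =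
      (δ L _ _ ≫ ((δ L _ _ ≫ (X.hom ⊗ₘ Y.hom) ≫ μ R _ _) ⊗ₘ Z.hom) ≫ μ R _ _) ≫
        R.map (α_ X.right Y.right Z.right).hom := by
  have h1 : (X.hom ⊗ₘ (δ L _ _ ≫ (Y.hom ⊗ₘ Z.hom) ≫ μ R _ _)) =
      (L.obj X.left ◁ δ L Y.left Z.left) ≫ (X.hom ⊗ₘ Y.hom ⊗ₘ Z.hom) ≫
        (R.obj X.right ◁ μ R Y.right Z.right) := by
    simp [← id_tensorHom, tensorHom_comp_tensorHom]
  have h2 : ((δ L _ _ ≫ (X.hom ⊗ₘ Y.hom) ≫ μ R _ _) ⊗ₘ Z.hom) =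
      (δ L X.left Y.left ▷ L.obj Z.left) ≫ ((X.hom ⊗ₘ Y.hom) ⊗ₘ Z.hom) ≫
        (μ R X.right Y.right ▷ R.obj Z.right) := by
    simp only [← tensorHom_id, tensorHom_comp_tensorHom, Category.id_comp, Category.comp_id]
  rw [h1, h2]
  simp only [Category.assoc]
  rw [Functor.LaxMonoidal.associativity, associator_naturality_assoc,
    ← Functor.OplaxMonoidal.associativity_assoc]

theorem w_left (X : Comma L R) :
    L.map (λ_ X.left).hom ≫ X.hom =
      (δ L _ _ ≫ ((η L ≫ ε R) ⊗ₘ X.hom) ≫ μ R _ _) ≫ R.map (λ_ X.right).hom := by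
  have h : ((η L ≫ ε R) ⊗ₘ X.hom) =
      η L ▷ L.obj X.left ≫ 𝟙_ T ◁ X.hom ≫ ε R ▷ R.obj X.right := by
    simp [← id_tensorHom, ← tensorHom_id, tensorHom_comp_tensorHom]
  rw [h]
  simp only [Category.assoc]
  rw [← Functor.LaxMonoidal.left_unitality, leftUnitor_naturality, left_unitality_hom_assoc]

theorem w_right (X : Comma L R) :
    L.map (ρ_ X.left).hom ≫ X.hom =
      (δ L _ _ ≫ (X.hom ⊗ₘ (η L ≫ ε R)) ≫ μ R _ _) ≫ R.map (ρ_ X.right).hom := by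
  have h : (X.hom ⊗ₘ (η L ≫ ε R)) =
      L.obj X.left ◁ η L ≫ X.hom ▷ 𝟙_ T ≫ R.obj X.right ◁ ε R := by
    simp [← id_tensorHom, ← tensorHom_id, tensorHom_comp_tensorHom]
  rw [h]
  simp only [Category.assoc]
  rw [← Functor.LaxMonoidal.right_unitality, rightUnitor_naturality, right_unitality_hom_assoc]

/-- If `L` is oplax monoidal and `R` is lax monoidal, the comma category `Comma L R` has a
componentwise tensor product: the structure map of `X ⊗ Y` is
`L (X.left ⊗ Y.left) ⟶ L X.left ⊗ L Y.left ⟶ R X.right ⊗ R Y.right ⟶ R (X.right ⊗ Y.right)`. -/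
instance struct : MonoidalCategoryStruct (Comma L R) where
  tensorObj X Y :=
    { left := X.left ⊗ Y.left
      right := X.right ⊗ Y.right
      hom := δ L _ _ ≫ (X.hom ⊗ₘ Y.hom) ≫ μ R _ _ }
  tensorUnit :=
    { left := 𝟙_ D
      right := 𝟙_ S
      hom := η L ≫ ε R }
  tensorHom f g := { left := f.left ⊗ₘ g.left, right := f.right ⊗ₘ g.right, w := w_tensor L R f g }
  whiskerLeft X _ _ f :=
    { left := X.left ◁ f.left
      right := X.right ◁ f.right
      w := by simpa using w_tensor L R (𝟙 X) f }
  whiskerRight f Y :=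
    { left := f.left ▷ Y.left
      right := f.right ▷ Y.right
      w := by simpa using w_tensor L R f (𝟙 Y) }
  associator X Y Z := Comma.isoMk (α_ _ _ _) (α_ _ _ _) (w_assoc L R X Y Z)
  leftUnitor X := Comma.isoMk (λ_ _) (λ_ _) (w_left L R X)
  rightUnitor X := Comma.isoMk (ρ_ _) (ρ_ _) (w_right L R X)

instance : MonoidalCategory (Comma L R) where
  tensorHom_def f g := by
    apply CommaMorphism.ext
    · exact tensorHom_def f.left g.left
    · exact tensorHom_def f.right g.right
  id_tensorHom_id X Y := by
    apply CommaMorphism.ext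
    · exact id_tensorHom_id X.left Y.left
    · exact id_tensorHom_id X.right Y.right
  tensorHom_comp_tensorHom f g f' g' := by
    apply CommaMorphism.ext
    · exact tensorHom_comp_tensorHom f.left g.left f'.left g'.left
    · exact tensorHom_comp_tensorHom f.right g.right f'.right g'.right
  whiskerLeft_id X Y := by
    apply CommaMorphism.ext
    · exact whiskerLeft_id X.left Y.left
    · exact whiskerLeft_id X.right Y.right
  id_whiskerRight X Y := by
    apply CommaMorphism.ext
    · exact id_whiskerRight X.left Y.left
    · exact id_whiskerRight X.right Y.right
  associator_naturality f g h := by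
    apply CommaMorphism.ext
    · exact associator_naturality f.left g.left h.left
    · exact associator_naturality f.right g.right h.right
  leftUnitor_naturality f := by
    apply CommaMorphism.ext
    · exact leftUnitor_naturality f.left
    · exact leftUnitor_naturality f.right
  rightUnitor_naturality f := by
    apply CommaMorphism.ext
    · exact rightUnitor_naturality f.left
    · exact rightUnitor_naturality f.right
  pentagon W X Y Z := by
    apply CommaMorphism.ext
    · exact pentagon W.left X.left Y.left Z.left
    · exact pentagon W.right X.right Y.right Z.right
  triangle X Y := by
    apply CommaMorphism.ext
    · exact triangle X.left Y.left
    · exact triangle X.right Y.right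

theorem preservesTensorLeft (J : Type) [SmallCategory J] [HasColimitsOfShape J D]
    [HasColimitsOfShape J S] [PreservesColimitsOfShape J L] (X : Comma L R)
    [PreservesColimitsOfShape J (tensorLeft X.left)]
    [PreservesColimitsOfShape J (tensorLeft X.right)] :
    PreservesColimitsOfShape J (tensorLeft X) := by
  have h1 : PreservesColimitsOfShape J (tensorLeft X ⋙ Comma.fst L R) :=
    preservesColimitsOfShape_of_natIso (F := Comma.fst L R ⋙ tensorLeft X.left)
      (NatIso.ofComponents (fun _ => Iso.refl _) (by
        intro _ _ f
        exact (Category.comp_id _).trans (Category.id_comp _).symm))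
  have h2 : PreservesColimitsOfShape J (tensorLeft X ⋙ Comma.snd L R) :=
    preservesColimitsOfShape_of_natIso (F := Comma.snd L R ⋙ tensorLeft X.right)
      (NatIso.ofComponents (fun _ => Iso.refl _) (by
        intro _ _ f
        exact (Category.comp_id _).trans (Category.id_comp _).symm))
  exact ⟨fun {F} => ⟨fun {c} hc => ⟨Comma.fstSndJointlyReflectColimit
    (isColimitOfPreserves (tensorLeft X ⋙ Comma.fst L R) hc)
    (isColimitOfPreserves (tensorLeft X ⋙ Comma.snd L R) hc)⟩⟩⟩

end CommaMonoidal

namespace CommaMonoidal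
universe v₁ v₂ v₃ u₁ u₂ u₃
variable {D : Type u₁} [Category.{v₁} D] [MonoidalCategory D] [SymmetricCategory D]
  {S : Type u₂} [Category.{v₂} S] [MonoidalCategory S] [SymmetricCategory S]
  {T : Type u₃} [Category.{v₃} T] [MonoidalCategory T] [SymmetricCategory T]
  (L : D ⥤ T) [L.Braided] (R : S ⥤ T) [R.LaxBraided]
open Functor.LaxMonoidal Functor.OplaxMonoidal

theorem w_braid (X Y : Comma L R) :
    L.map (β_ X.left Y.left).hom ≫ δ L _ _ ≫ (Y.hom ⊗ₘ X.hom) ≫ μ R _ _ =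
      (δ L _ _ ≫ (X.hom ⊗ₘ Y.hom) ≫ μ R _ _) ≫ R.map (β_ X.right Y.right).hom := by
  simp only [Category.assoc]
  rw [Functor.LaxBraided.braided, BraidedCategory.braiding_naturality_assoc]
  simp [Functor.map_braiding]

/-- The componentwise symmetry. -/
instance : SymmetricCategory (Comma L R) where
  braiding X Y := Comma.isoMk (β_ _ _) (β_ _ _) (w_braid L R X Y)
  braiding_naturality_right X _ _ f := by
    apply CommaMorphism.ext
    · exact BraidedCategory.braiding_naturality_right X.left f.left
    · exact BraidedCategory.braiding_naturality_right X.right f.right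
  braiding_naturality_left f X := by
    apply CommaMorphism.ext
    · exact BraidedCategory.braiding_naturality_left f.left X.left
    · exact BraidedCategory.braiding_naturality_left f.right X.right
  hexagon_forward X Y Z := by
    apply CommaMorphism.ext
    · exact BraidedCategory.hexagon_forward X.left Y.left Z.left
    · exact BraidedCategory.hexagon_forward X.right Y.right Z.right
  hexagon_reverse X Y Z := by
    apply CommaMorphism.ext
    · exact BraidedCategory.hexagon_reverse X.left Y.left Z.left
    · exact BraidedCategory.hexagon_reverse X.right Y.right Z.right
  symmetry X Y := by
    apply CommaMorphism.ext
    · exact SymmetricCategory.symmetry X.left Y.left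
    · exact SymmetricCategory.symmetry X.right Y.right
end CommaMonoidal

namespace ZpModel

/-- The group of `p`-adic integers, written multiplicatively. -/
abbrev Gp (p : ℕ) [Fact p.Prime] : Type := Multiplicative ℤ_[p]

/-- The cyclic group `ℤ/p^k`, written multiplicatively. -/
abbrev Gk (p k : ℕ) : Type := Multiplicative (ZMod (p ^ k))

/-- The projection `ℤ_p → ℤ/p^k`; its kernel is the open subgroup `p^k ℤ_p`. -/
def proj (p : ℕ) [Fact p.Prime] (k : ℕ) : Gp p →* Gk p k :=
  AddMonoidHom.toMultiplicative (PadicInt.toZModPow k : ℤ_[p] →+* ZMod (p ^ k)).toAddMonoidHom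

/-- `g ∈ p^n ℤ_p`. -/
abbrev InLevel {p : ℕ} [Fact p.Prime] (n : ℕ) (g : Gp p) : Prop := proj p n g = 1

theorem InLevel.mono {p : ℕ} [Fact p.Prime] {m n : ℕ} (h : m ≤ n) {g : Gp p}
    (hg : InLevel n g) : InLevel m g := by
  have h0 : (PadicInt.toZModPow n (Multiplicative.toAdd g) : ZMod (p ^ n)) = 0 := hg
  have h1 := PadicInt.zmod_cast_comp_toZModPow (p := p) m n h
  have h2 : (PadicInt.toZModPow m (Multiplicative.toAdd g) : ZMod (p ^ m)) = 0 := by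
    rw [← h1, RingHom.comp_apply, h0, map_zero]
  exact h2

theorem preservesTensorLeft_fam (p : ℕ) (J : Type) [SmallCategory J]
    (X : ∀ k : ℕ, Rep.{0} ℚ (Gk p k)) : PreservesColimitsOfShape J (tensorLeft X) :=
  inferInstance

variable (p : ℕ) [Fact p.Prime]

/-- A rational representation of `ℤ_p` is discrete if the action on each element factors through
some finite quotient `ℤ/p^n`. -/
def IsDiscrete : ObjectProperty (Rep.{0} ℚ (Gp p)) :=
  fun M => ∀ m : M, ∃ n : ℕ, ∀ g : Gp p, InLevel n g → M.ρ g m = m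

instance : (IsDiscrete p).IsMonoidal where
  prop_unit := fun m => ⟨0, fun g _ => rfl⟩
  prop_tensor M N hM hN := by
    intro t
    induction t using TensorProduct.induction_on with
    | zero => exact ⟨0, fun g _ => map_zero _⟩
    | tmul x y =>
      obtain ⟨a, ha⟩ := hM x
      obtain ⟨b, hb⟩ := hN y
      refine ⟨max a b, fun g hg => ?_⟩
      change TensorProduct.map (M.ρ g) (N.ρ g) _ = _
      rw [TensorProduct.map_tmul, ha g (hg.mono (le_max_left _ _)),
        hb g (hg.mono (le_max_right _ _))]
    | add x y hx hy =>
      obtain ⟨a, ha⟩ := hx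
      obtain ⟨b, hb⟩ := hy
      refine ⟨max a b, fun g hg => ?_⟩
      rw [map_add, ha g (hg.mono (le_max_left _ _)), hb g (hg.mono (le_max_right _ _))]

/-- The elements of a representation of `ℤ_p` which are fixed by some `p^n ℤ_p`. -/
def discretePart {p : ℕ} [Fact p.Prime] {V : Type} [AddCommGroup V] [Module ℚ V]
    (ρ : Representation ℚ (Gp p) V) : Submodule ℚ V where
  carrier := {v | ∃ n : ℕ, ∀ g : Gp p, InLevel n g → ρ g v = v}
  zero_mem' := ⟨0, fun _ _ => map_zero _⟩
  add_mem' := by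
    rintro x y ⟨a, ha⟩ ⟨b, hb⟩
    refine ⟨max a b, fun g hg => ?_⟩
    rw [map_add, ha g (hg.mono (le_max_left _ _)), hb g (hg.mono (le_max_right _ _))]
  smul_mem' := by
    rintro c x ⟨a, ha⟩
    exact ⟨a, fun g hg => by rw [map_smul, ha g hg]⟩

theorem discretePart_stable {p : ℕ} [Fact p.Prime] {V : Type} [AddCommGroup V] [Module ℚ V]
    (ρ : Representation ℚ (Gp p) V) (g : Gp p) :
    discretePart ρ ≤ (discretePart ρ).comap (ρ g) := by
  rintro x ⟨a, ha⟩
  refine ⟨a, fun h hh => ?_⟩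
  have := congrArg (ρ g) (ha h hh)
  rw [← Module.End.mul_apply, ← map_mul] at this ⊢
  rwa [mul_comm h g]

/-- The action on the discrete part. -/
def discreteRep {p : ℕ} [Fact p.Prime] {V : Type} [AddCommGroup V] [Module ℚ V]
    (ρ : Representation ℚ (Gp p) V) : Representation ℚ (Gp p) (discretePart ρ) where
  toFun g := (ρ g).restrict (discretePart_stable ρ g)
  map_one' := by ext; simp
  map_mul' a b := by ext; simp

/-- Discrete rational `ℤ_p`-modules. -/
abbrev DiscMod : Type 1 := (IsDiscrete p).FullSubcategory

/-- The discrete part of a representation, as a discrete module. -/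
def discrete {p : ℕ} [Fact p.Prime] {V : Type} [AddCommGroup V] [Module ℚ V]
    (ρ : Representation ℚ (Gp p) V) : DiscMod p where
  obj := Rep.of (discreteRep ρ)
  property := fun ⟨_, n, hn⟩ => ⟨n, fun g hg => Subtype.ext (hn g hg)⟩

instance (J : Type) [SmallCategory J] : (IsDiscrete p).IsClosedUnderColimitsOfShape J where
  colimitsOfShape_le := by
    rintro X ⟨h⟩
    let c := Cocone.mk X h.ι
    let D : Rep ℚ (Gp p) := (discrete X.ρ).obj
    let i : D ⟶ X := Rep.ofHom ⟨(discretePart X.ρ).subtype, fun g => rfl⟩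
    let d : Cocone h.diag :=
      { pt := D
        ι :=
          { app := fun j => Rep.ofHom
              ⟨LinearMap.codRestrict (discretePart X.ρ) (h.ι.app j).hom.toLinearMap (fun v => by
                obtain ⟨n, hn⟩ := h.prop_diag_obj j v
                refine ⟨n, fun g hg => ?_⟩
                have := Rep.hom_comm_apply (h.ι.app j) g v
                rw [hn g hg] at this
                exact this.symm), fun g => by
                ext v
                exact Rep.hom_comm_apply (h.ι.app j) g v⟩
            naturality := fun a b f => by
              ext v
              apply Subtype.ext
              exact congrArg (fun φ : _ ⟶ X => φ.hom v) (h.ι.naturality f) } }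
    have key : h.isColimit.desc d ≫ i = 𝟙 X := by
      apply h.isColimit.hom_ext
      intro j
      rw [h.isColimit.fac_assoc]
      ext v
      rfl
    intro v
    have hv : v = ((h.isColimit.desc d).hom v : D).1 :=
      (congrArg (fun φ : X ⟶ X => φ.hom v) key).symm
    rw [hv]
    exact ((h.isColimit.desc d).hom v : D).2

instance : HasColimits (DiscMod p) := ⟨fun _ _ => inferInstance⟩

/-- Families `(M_k)` of `ℚ[ℤ/p^k]`-modules, `k ≥ 0`. -/
abbrev Fam : Type 1 := ∀ k : ℕ, Rep.{0} ℚ (Gk p k)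

instance : Preadditive (Fam p) where
  homGroup M N := inferInstanceAs (AddCommGroup (∀ k, (M k ⟶ N k)))
  add_comp _ _ _ f f' g := funext fun k => Preadditive.add_comp _ _ _ (f k) (f' k) (g k)
  comp_add _ _ _ f g g' := funext fun k => Preadditive.comp_add _ _ _ (f k) (g k) (g' k)

instance : HasColimits (Fam p) :=
  ⟨fun _ _ => ⟨fun _ => pi.hasColimit_of_hasColimit_comp_eval⟩⟩

section Tails

variable {p}

/-- Sequences `(x_k)` with `x_k = 0` for all large `k`. -/
def eventuallyZero (V : ℕ → Type) [∀ k, AddCommGroup (V k)] [∀ k, Module ℚ (V k)] :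
    Submodule ℚ (∀ k, V k) where
  carrier := {x | ∃ n, ∀ k, n ≤ k → x k = 0}
  zero_mem' := ⟨0, fun _ _ => rfl⟩
  add_mem' := by
    rintro x y ⟨a, ha⟩ ⟨b, hb⟩
    refine ⟨max a b, fun k hk => ?_⟩
    rw [Pi.add_apply, ha k (le_trans (le_max_left _ _) hk), hb k (le_trans (le_max_right _ _) hk),
      add_zero]
  smul_mem' := by
    rintro c x ⟨a, ha⟩
    exact ⟨a, fun k hk => by rw [Pi.smul_apply, ha k hk, smul_zero]⟩

/-- `colim_n ∏_{k ≥ n} V_k`: the transition maps of this sequential colimit are the surjective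
truncations, so it is the quotient of `∏_k V_k` by the sequences which become zero after
truncation. -/
abbrev TailsMod (V : ℕ → Type) [∀ k, AddCommGroup (V k)] [∀ k, Module ℚ (V k)] : Type :=
  (∀ k, V k) ⧸ eventuallyZero V

/-- The class of a sequence in `colim_n ∏_{k ≥ n} V_k`. -/
def tailsMk (V : ℕ → Type) [∀ k, AddCommGroup (V k)] [∀ k, Module ℚ (V k)] :
    (∀ k, V k) →ₗ[ℚ] TailsMod V := (eventuallyZero V).mkQ

section maps

variable {V W : ℕ → Type} [∀ k, AddCommGroup (V k)] [∀ k, Module ℚ (V k)]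
  [∀ k, AddCommGroup (W k)] [∀ k, Module ℚ (W k)]

theorem tailsMk_eq_iff {x y : ∀ k, V k} :
    tailsMk V x = tailsMk V y ↔ ∃ n, ∀ k, n ≤ k → x k = y k := by
  change Submodule.Quotient.mk x = Submodule.Quotient.mk y ↔ _
  rw [Submodule.Quotient.eq]
  simp [eventuallyZero, sub_eq_zero]

/-- The map on tails induced by a sequence of linear maps. -/
def tailsMap (f : ∀ k, V k →ₗ[ℚ] W k) : TailsMod V →ₗ[ℚ] TailsMod W :=
  Submodule.mapQ _ _ (LinearMap.pi fun k => f k ∘ₗ LinearMap.proj k) (by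
    rintro x ⟨n, hn⟩
    exact ⟨n, fun k hk => by simp [hn k hk]⟩)

@[simp]
theorem tailsMap_mk (f : ∀ k, V k →ₗ[ℚ] W k) (x : ∀ k, V k) :
    tailsMap f (tailsMk V x) = tailsMk W (fun k => f k (x k)) := rfl

theorem tailsMk_surjective : Function.Surjective (tailsMk V) := Submodule.mkQ_surjective _

@[ext high]
theorem tails_hom_ext {X : Type} [AddCommGroup X] [Module ℚ X] {f g : TailsMod V →ₗ[ℚ] X}
    (h : ∀ x, f (tailsMk V x) = g (tailsMk V x)) : f = g := by
  ext x
  exact h x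

open TensorProduct in
/-- The canonical map `tails V ⊗ tails W → tails (V ⊗ W)`, `[x] ⊗ [y] ↦ [x_k ⊗ y_k]`. -/
def tailsTensor : TailsMod V ⊗[ℚ] TailsMod W →ₗ[ℚ] TailsMod (fun k => V k ⊗[ℚ] W k) :=
  TensorProduct.lift <|
    Submodule.liftQ _
      (LinearMap.mk₂ ℚ (fun x w => tailsMap (fun k => TensorProduct.mk ℚ (V k) (W k) (x k)) w)
        (fun x x' w => by
          obtain ⟨y, rfl⟩ := tailsMk_surjective w
          simp only [tailsMap_mk, ← map_add]
          congr 1; ext k; simp)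
        (fun c x w => by
          obtain ⟨y, rfl⟩ := tailsMk_surjective w
          simp only [tailsMap_mk, ← map_smul]
          congr 1)
        (fun x w w' => map_add _ _ _) (fun c x w => map_smul _ _ _)) (by
      rintro x ⟨n, hn⟩
      rw [LinearMap.mem_ker]
      ext y
      change tailsMk _ _ = tailsMk _ (0 : ∀ k, V k ⊗[ℚ] W k)
      rw [tailsMk_eq_iff]
      exact ⟨n, fun k hk => by simp [hn k hk]⟩)

@[simp]
theorem tailsTensor_mk (x : ∀ k, V k) (y : ∀ k, W k) :
    tailsTensor (tailsMk V x ⊗ₜ tailsMk W y) =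
      tailsMk (fun k => TensorProduct ℚ (V k) (W k)) (fun k => x k ⊗ₜ y k) := rfl

end maps

variable (p)

/-- `ℤ_p` acts on `colim_n ∏_{k ≥ n} M_k`, through `ℤ/p^k` on `M_k`. -/
def tailsRep (M : Fam p) : Representation ℚ (Gp p) (TailsMod fun k => (M k).V) where
  toFun g := tailsMap fun k => (M k).ρ (proj p k g)
  map_one' := by ext x; simp
  map_mul' a b := by ext x; simp

/-- `M ↦ colim_n ∏_{k ≥ n} M_k`, as a functor to all rational representations of `ℤ_p`. -/
def tails : Fam p ⥤ Rep.{0} ℚ (Gp p) where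
  obj M := Rep.of (tailsRep p M)
  map {M N} f := Rep.ofHom ⟨tailsMap fun k => (f k).hom.toLinearMap, fun g => by
    apply tails_hom_ext
    intro x
    change tailsMk (fun k => (N k).V) _ = tailsMk (fun k => (N k).V) _
    congr 1
    funext k
    exact Rep.hom_comm_apply (f k) _ _⟩
  map_id M := by
    apply Rep.hom_ext
    apply Representation.IntertwiningMap.ext
    apply tails_hom_ext
    intro x
    rfl
  map_comp f g := by
    apply Rep.hom_ext
    apply Representation.IntertwiningMap.ext
    apply tails_hom_ext
    intro x
    rfl

instance : (tails p).Additive where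
  map_add {M N f g} := by
    apply Rep.hom_ext
    apply Representation.IntertwiningMap.ext
    apply tails_hom_ext
    intro x
    rfl

theorem tails_tensor_ext {V W : ℕ → Type} [∀ k, AddCommGroup (V k)] [∀ k, Module ℚ (V k)]
    [∀ k, AddCommGroup (W k)] [∀ k, Module ℚ (W k)] {X : Type} [AddCommGroup X] [Module ℚ X]
    {f g : TensorProduct ℚ (TailsMod V) (TailsMod W) →ₗ[ℚ] X}
    (h : ∀ x y, f (tailsMk V x ⊗ₜ tailsMk W y) = g (tailsMk V x ⊗ₜ tailsMk W y)) : f = g := by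
  apply TensorProduct.ext'
  intro x y
  obtain ⟨x, rfl⟩ := tailsMk_surjective x
  obtain ⟨y, rfl⟩ := tailsMk_surjective y
  exact h x y

/-- The canonical map `tails M ⊗ tails N → tails (M ⊗ N)`. -/
def tailsμ (M N : Fam p) : (tails p).obj M ⊗ (tails p).obj N ⟶ (tails p).obj (M ⊗ N) :=
  Rep.ofHom ⟨tailsTensor (V := fun k => (M k).V) (W := fun k => (N k).V), fun g => by
    apply tails_tensor_ext
    intro x y
    rfl⟩

/-- The diagonal `ℚ → tails (ℚ)`, `q ↦ [(q, q, …)]`. -/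
def tailsε : 𝟙_ (Rep.{0} ℚ (Gp p)) ⟶ (tails p).obj (𝟙_ (Fam p)) :=
  Rep.ofHom ⟨tailsMk (fun _ => ℚ) ∘ₗ LinearMap.pi fun _ => LinearMap.id, fun g => by
    ext
    rfl⟩

instance : (tails p).LaxBraided where
  ε := tailsε p
  μ := tailsμ p
  μ_natural_left f X := by
    apply Rep.hom_ext
    apply Representation.IntertwiningMap.ext
    apply tails_tensor_ext
    intro x y
    rfl
  μ_natural_right X f := by
    apply Rep.hom_ext
    apply Representation.IntertwiningMap.ext
    apply tails_tensor_ext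
    intro x y
    rfl
  associativity X Y Z := by
    apply Rep.hom_ext
    apply Representation.IntertwiningMap.ext
    apply TensorProduct.ext_threefold
    intro x y z
    obtain ⟨x, rfl⟩ := tailsMk_surjective x
    obtain ⟨y, rfl⟩ := tailsMk_surjective y
    obtain ⟨z, rfl⟩ := tailsMk_surjective z
    rfl
  left_unitality X := by
    apply Rep.hom_ext
    apply Representation.IntertwiningMap.ext
    apply TensorProduct.ext'
    intro q x
    obtain ⟨x, rfl⟩ := tailsMk_surjective x
    rfl
  right_unitality X := by
    apply Rep.hom_ext
    apply Representation.IntertwiningMap.ext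
    apply TensorProduct.ext'
    intro x q
    obtain ⟨x, rfl⟩ := tailsMk_surjective x
    rfl
  braided X Y := by
    apply Rep.hom_ext
    apply Representation.IntertwiningMap.ext
    apply tails_tensor_ext
    intro x y
    rfl

end Tails

/-- The algebraic model: an object consists of a discrete module `M.left = M_∞`, a family
`M.right k = M_k` of `ℚ[ℤ/p^k]`-modules, and the structure map
`M.hom : M_∞ → colim_n ∏_{k ≥ n} M_k`, a map of `ℤ_p`-modules. -/
abbrev AlgModel : Type 1 := Comma (IsDiscrete p).ι (tails p)

instance : HasColimits (AlgModel p) := ⟨fun _ _ => Comma.hasColimitsOfShape⟩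

instance : MonoidalPreadditive (AlgModel p) where
  whiskerLeft_zero {X Y Z} := by
    apply CommaMorphism.ext
    · exact MonoidalPreadditive.whiskerLeft_zero (C := DiscMod p)
    · funext k; exact MonoidalPreadditive.whiskerLeft_zero (C := Rep.{0} ℚ (Gk p k))
  zero_whiskerRight {X Y Z} := by
    apply CommaMorphism.ext
    · exact MonoidalPreadditive.zero_whiskerRight (C := DiscMod p)
    · funext k; exact MonoidalPreadditive.zero_whiskerRight (C := Rep.{0} ℚ (Gk p k))
  whiskerLeft_add f g := by
    apply CommaMorphism.ext
    · exact MonoidalPreadditive.whiskerLeft_add f.left g.left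
    · funext k; exact MonoidalPreadditive.whiskerLeft_add (f.right k) (g.right k)
  add_whiskerRight f g := by
    apply CommaMorphism.ext
    · exact MonoidalPreadditive.add_whiskerRight f.left g.left
    · funext k; exact MonoidalPreadditive.add_whiskerRight (f.right k) (g.right k)

theorem preservesTensorLeft_disc (J : Type) [SmallCategory J] (X : DiscMod p) :
    PreservesColimitsOfShape J (tensorLeft X) := by
  have h0 : PreservesColimitsOfShape J (IsDiscrete p).ι := inferInstance
  have h1 : PreservesColimitsOfShape J (tensorLeft ((IsDiscrete p).ι.obj X)) := inferInstance
  have h2 : PreservesColimitsOfShape J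
      ((IsDiscrete p).ι ⋙ tensorLeft ((IsDiscrete p).ι.obj X)) := inferInstance
  have : PreservesColimitsOfShape J (tensorLeft X ⋙ (IsDiscrete p).ι) :=
    preservesColimitsOfShape_of_natIso (Functor.Monoidal.commTensorLeft (IsDiscrete p).ι X)
  exact preservesColimitsOfShape_of_reflects_of_preserves _ (IsDiscrete p).ι

instance preservesTensorLeft (J : Type) [SmallCategory J] (X : AlgModel p) :
    PreservesColimitsOfShape J (tensorLeft X) := by
  have h1 := preservesTensorLeft_disc p J X.left
  have h2 := preservesTensorLeft_fam p J X.right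
  exact CommaMonoidal.preservesTensorLeft (IsDiscrete p).ι (tails p) J X

instance preservesTensorRight (J : Type) [SmallCategory J] (X : AlgModel p) :
    PreservesColimitsOfShape J (tensorRight X) :=
  preservesColimitsOfShape_of_natIso (BraidedCategory.tensorLeftIsoTensorRight X)

instance (J : Type) [SmallCategory J] (X : AlgModel p) :
    PreservesColimitsOfShape J ((curriedTensor (AlgModel p)).obj X) :=
  preservesTensorLeft p J X

instance (J : Type) [SmallCategory J] (X : AlgModel p) :
    PreservesColimitsOfShape J ((curriedTensor (AlgModel p)).flip.obj X) :=
  preservesTensorRight p J X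

instance : HasZeroObject (AlgModel p) :=
  hasZeroObject_of_hasInitial_object

/-- The usual sign `(-1)^i` in the differential of a tensor product of `ℤ`-graded chain complexes. -/
instance : (ComplexShape.down ℤ).TensorSigns where
  ε' := MonoidHom.mk' Int.negOnePow Int.negOnePow_add
  rel_add p q r (hpq : q + 1 = p) := by change q + r + 1 = p + r; lia
  add_rel p q r (hpq : q + 1 = p) := by change r + q + 1 = r + p; lia
  ε'_succ := by
    rintro _ q rfl
    change Int.negOnePow q = - Int.negOnePow (q + 1)
    rw [Int.negOnePow_succ, neg_neg]

/-- The category `dg 𝒜` of `ℤ`-graded chain complexes in the algebraic model. -/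
abbrev DG : Type 1 := ChainComplex (AlgModel p) ℤ

instance : HasFiniteCoproducts (AlgModel p) := inferInstance

instance : HasColimits (DG p) := ⟨fun _ _ => inferInstance⟩

/-- The tensor product of complexes: `(K ⊗ L)_n` is the direct sum of the `K_i ⊗ L_j` with
`i + j = n`, with differential `d ⊗ 1 + (-1)^i 1 ⊗ d` on `K_i ⊗ L_j`. -/
instance : MonoidalCategory (DG p) := inferInstance

end ZpModel

namespace ZpModel
section Sub
open Opposite TopologicalSpace
variable {p : ℕ} [Fact p.Prime]
variable {V W : Type} [AddCommGroup V] [Module ℚ V] [AddCommGroup W] [Module ℚ W]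

/-- The action on the discrete part of a `ℤ_p`-stable subspace `S`. -/
def subRep (ρ : Representation ℚ (Gp p) V) (S : Submodule ℚ V)
    (hS : ∀ g v, v ∈ S → ρ g v ∈ S) :
    Representation ℚ (Gp p) ↥(S ⊓ discretePart ρ) where
  toFun g := (ρ g).restrict (fun v hv => ⟨hS g v hv.1, discretePart_stable ρ g hv.2⟩)
  map_one' := by ext; simp
  map_mul' a b := by
    ext x
    exact congrArg (fun f => f x.1) (map_mul ρ a b)

/-- The discrete part of a `ℤ_p`-stable subspace `S` of a representation, as a discrete module. -/
def discreteSub (ρ : Representation ℚ (Gp p) V) (S : Submodule ℚ V)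
    (hS : ∀ g v, v ∈ S → ρ g v ∈ S) : DiscMod p where
  obj := Rep.of (subRep ρ S hS)
  property := fun ⟨_, _, n, hn⟩ => ⟨n, fun g hg => Subtype.ext (hn g hg)⟩

/-- The underlying linear map of a map of discrete modules. -/
abbrev lin {X Y : DiscMod p} (f : X ⟶ Y) : X.obj.V →ₗ[ℚ] Y.obj.V := f.hom.hom.toLinearMap

theorem lin_comm {X Y : DiscMod p} (f : X ⟶ Y) (g : Gp p) (x : X.obj.V) :
    lin f (X.obj.ρ g x) = Y.obj.ρ g (lin f x) := Rep.hom_comm_apply f.hom g x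

theorem lin_ext {X Y : DiscMod p} {f g : X ⟶ Y} (h : ∀ x, lin f x = lin g x) : f = g := by
  apply ObjectProperty.hom_ext
  apply Rep.hom_ext
  apply Representation.IntertwiningMap.ext
  exact LinearMap.ext h

/-- A `ℤ_p`-equivariant linear map, as a map of discrete modules. -/
def mkHom {X Y : DiscMod p} (f : X.obj.V →ₗ[ℚ] Y.obj.V)
    (h : ∀ g x, f (X.obj.ρ g x) = Y.obj.ρ g (f x)) : X ⟶ Y :=
  ObjectProperty.homMk (Rep.ofHom ⟨f, fun g => LinearMap.ext (h g)⟩)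

@[simp]
theorem lin_mkHom {X Y : DiscMod p} (f : X.obj.V →ₗ[ℚ] Y.obj.V)
    (h : ∀ g x, f (X.obj.ρ g x) = Y.obj.ρ g (f x)) : lin (mkHom f h) = f := rfl

@[simp]
theorem lin_comp {X Y Z : DiscMod p} (f : X ⟶ Y) (g : Y ⟶ Z) (x : X.obj.V) :
    lin (f ≫ g) x = lin g (lin f x) := rfl

@[simp]
theorem lin_id (X : DiscMod p) (x : X.obj.V) : lin (𝟙 X) x = x := rfl

/-- The map of discrete modules induced by an equivariant map carrying `S` into `S'`. -/
def discreteSubMap {ρ : Representation ℚ (Gp p) V} {S : Submodule ℚ V}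
    {hS : ∀ g v, v ∈ S → ρ g v ∈ S} {ρ' : Representation ℚ (Gp p) W} {S' : Submodule ℚ W}
    {hS' : ∀ g v, v ∈ S' → ρ' g v ∈ S'} (f : V →ₗ[ℚ] W) (hf : ∀ g v, f (ρ g v) = ρ' g (f v))
    (hfS : ∀ v ∈ S, f v ∈ S') : discreteSub ρ S hS ⟶ discreteSub ρ' S' hS' :=
  mkHom (X := discreteSub ρ S hS) (Y := discreteSub ρ' S' hS')
    (f.restrict (p := S ⊓ discretePart ρ) (q := S' ⊓ discretePart ρ') (by
      rintro v ⟨hv, n, hn⟩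
      exact ⟨hfS v hv, n, fun g hg => by rw [← hf, hn g hg]⟩))
    (fun g v => Subtype.ext (hf g v.1))

end Sub

section Space
open Opposite TopologicalSpace

/-- The space `𝒮ℤ_p` of closed subgroups of `ℤ_p`: the point `k : ℕ` is the subgroup `p^k ℤ_p`, and
the limit point `∞` is the trivial subgroup. -/
abbrev Sp : TopCat.{0} := TopCat.of (OnePoint ℕ)

theorem mem_of_infty_mem (V : Opens Sp) (h : (OnePoint.infty : OnePoint ℕ) ∈ V) :
    ∃ n : ℕ, ∀ k : ℕ, n ≤ k → ((k : OnePoint ℕ) ∈ V) := by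
  have h1 := (OnePoint.isOpen_iff_of_mem (s := (V : Set (OnePoint ℕ))) h).1 V.isOpen
  have h2 := h1.2.finite_of_discrete
  obtain ⟨n, hn⟩ := h2.bddAbove
  refine ⟨n + 1, fun k hk => ?_⟩
  by_contra hc
  have := hn (show k ∈ _ from hc)
  omega

/-- The open set `S_n`, consisting of `∞` and the points `k ≥ n`. -/
def openS (n : ℕ) : Opens Sp where
  carrier := {x : OnePoint ℕ | ∀ k : ℕ, x = (k : OnePoint ℕ) → n ≤ k}
  is_open' := by
    rw [OnePoint.isOpen_iff_of_mem (by intro k hk; exact absurd hk (OnePoint.infty_ne_coe k))]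
    refine ⟨isClosed_discrete _, Set.Finite.isCompact ((Set.finite_lt_nat n).subset ?_)⟩
    intro k hk
    by_contra hc
    apply hk
    intro l hl
    have : k = l := OnePoint.coe_injective hl
    simp at hc
    omega

theorem infty_mem_openS (n : ℕ) : (OnePoint.infty : OnePoint ℕ) ∈ openS n :=
  fun k hk => absurd hk (OnePoint.infty_ne_coe k)

theorem coe_mem_openS {n k : ℕ} : (k : OnePoint ℕ) ∈ openS n ↔ n ≤ k :=
  ⟨fun h => h k rfl, fun h l hl => by rwa [← OnePoint.coe_injective hl]⟩

theorem openS_anti {m n : ℕ} (h : m ≤ n) : openS n ≤ openS m := fun _ hx k hk => h.trans (hx k hk)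

/-- The open set `{k}`. -/
def openPt (k : ℕ) : Opens Sp where
  carrier := {(k : OnePoint ℕ)}
  is_open' := by
    have := OnePoint.isOpenEmbedding_coe (X := ℕ) |>.isOpenMap {k} (isOpen_discrete _)
    simpa using this

theorem openPt_le {k : ℕ} {V : Opens Sp} : openPt k ≤ V ↔ (k : OnePoint ℕ) ∈ V :=
  ⟨fun h => h rfl, fun h _ hx => by rw [show _ = (k : OnePoint ℕ) from hx]; exact h⟩

end Space

section Sheaf
open Opposite TopologicalSpace
variable {p : ℕ} [Fact p.Prime]

/-- The sections of a presheaf of discrete modules. -/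
abbrev Sec (F : TopCat.Presheaf (DiscMod p) Sp) (V : Opens Sp) : Type := (F.obj (op V)).obj.V

/-- The action of `ℤ_p` on sections. -/
abbrev act (F : TopCat.Presheaf (DiscMod p) Sp) (V : Opens Sp) :
    Representation ℚ (Gp p) (Sec F V) := (F.obj (op V)).obj.ρ

/-- Restriction of sections. -/
abbrev res (F : TopCat.Presheaf (DiscMod p) Sp) {V W : Opens Sp} (h : W ≤ V) :
    Sec F V →ₗ[ℚ] Sec F W := lin (F.map (homOfLE h).op)

variable (F : TopCat.Presheaf (DiscMod p) Sp)

theorem res_refl {V : Opens Sp} (h : V ≤ V) (x : Sec F V) : res F h x = x := by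
  change lin (F.map (𝟙 _)) x = x
  rw [F.map_id, lin_id]

theorem res_res {U V W : Opens Sp} (h : V ≤ U) (h' : W ≤ V) (x : Sec F U) :
    res F h' (res F h x) = res F (h'.trans h) x := by
  rw [← lin_comp, ← F.map_comp]
  rfl

theorem res_act {V W : Opens Sp} (h : W ≤ V) (g : Gp p) (x : Sec F V) :
    res F h (act F V g x) = act F W g (res F h x) := lin_comm _ g x

theorem sec_discrete {V : Opens Sp} (x : Sec F V) :
    ∃ n : ℕ, ∀ g : Gp p, InLevel n g → act F V g x = x := (F.obj (op V)).property x

/-- Separatedness and gluing of uniformly discrete families, in terms of elements. -/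
theorem isSheaf_of
    (sep : ∀ (ι : Type) (U : ι → Opens Sp) (s : Sec F (iSup U)),
      (∀ i, res F (le_iSup U i) s = 0) → s = 0)
    (glue : ∀ (ι : Type) (U : ι → Opens Sp) (x : ∀ i, Sec F (U i)),
      (∀ i j, res F (inf_le_left : U i ⊓ U j ≤ U i) (x i) =
        res F (inf_le_right : U i ⊓ U j ≤ U j) (x j)) →
      (∃ n, ∀ g : Gp p, InLevel n g → ∀ i, act F (U i) g (x i) = x i) →
      ∃ s, ∀ i, res F (le_iSup U i) s = x i) : F.IsSheaf := by
  have sep' : ∀ (ι : Type) (U : ι → Opens Sp) (s t : Sec F (iSup U)),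
      (∀ i, res F (le_iSup U i) s = res F (le_iSup U i) t) → s = t := fun ι U s t h =>
    sub_eq_zero.1 (sep ι U (s - t) fun i => by rw [map_sub, h i, sub_self])
  intro E
  rw [← isSheaf_iff_isSheaf_of_type]
  apply TopCat.Presheaf.isSheaf_of_isSheafUniqueGluing_types
  intro ι U f hf
  change ∀ i, (E ⟶ F.obj (op (U i))) at f
  have hf' : ∀ i j, f i ≫ F.map (homOfLE (inf_le_left : U i ⊓ U j ≤ U i)).op =
      f j ≫ F.map (homOfLE (inf_le_right : U i ⊓ U j ≤ U j)).op := hf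
  have key : ∀ e : E.obj.V, ∃ s, ∀ i, res F (le_iSup U i) s = lin (f i) e := by
    intro e
    apply glue
    · intro i j
      exact congrArg (fun φ => lin φ e) (hf' i j)
    · obtain ⟨n, hn⟩ := E.property e
      exact ⟨n, fun g hg i => by rw [← lin_comm, hn g hg]⟩
  choose s hs using key
  refine ⟨mkHom (X := E) (Y := F.obj (op (iSup U)))
    { toFun := s
      map_add' := fun a b => sep' _ U _ _ fun i => by simp only [hs, map_add]
      map_smul' := fun c a => sep' _ U _ _ fun i => by
        simp only [hs, map_smul, RingHom.id_apply] } ?_, ?_, ?_⟩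
  · intro g x
    apply sep'
    intro i
    rw [res_act]
    exact (hs _ i).trans ((lin_comm _ _ _).trans (by rw [← hs x i]; rfl))
  · intro i
    apply lin_ext
    intro x
    exact hs x i
  · intro t ht
    apply lin_ext
    intro x
    apply sep'
    intro i
    exact (congrArg (fun φ => lin φ x) (ht i)).trans (hs x i).symm

theorem sheaf_hom (hF : F.IsSheaf) (E : DiscMod p) {ι : Type} (U : ι → Opens Sp)
    (f : ∀ i, E ⟶ F.obj (op (U i)))
    (hf : ∀ i j, f i ≫ F.map (homOfLE (inf_le_left : U i ⊓ U j ≤ U i)).op =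
      f j ≫ F.map (homOfLE (inf_le_right : U i ⊓ U j ≤ U j)).op) :
    ∃! t : E ⟶ F.obj (op (iSup U)), ∀ i, t ≫ F.map (homOfLE (le_iSup U i)).op = f i :=
  TopCat.Presheaf.IsSheaf.isSheafUniqueGluing_types (F := F ⋙ coyoneda.obj (op E))
    ((isSheaf_iff_isSheaf_of_type _ _).2 (hF E)) (U := U) f hf

theorem sheaf_sep (hF : F.IsSheaf) {ι : Type} (U : ι → Opens Sp) (s : Sec F (iSup U))
    (h : ∀ i, res F (le_iSup U i) s = 0) : s = 0 := by
  let S : Submodule ℚ (Sec F (iSup U)) := ⨅ i, LinearMap.ker (res F (le_iSup U i))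
  have hS : ∀ g v, v ∈ S → act F (iSup U) g v ∈ S := by
    intro g v hv
    simp only [S, Submodule.mem_iInf, LinearMap.mem_ker] at hv ⊢
    intro i
    rw [res_act, hv i, map_zero]
  let E := discreteSub (act F (iSup U)) S hS
  let a : E ⟶ F.obj (op (iSup U)) :=
    mkHom (X := E) (Submodule.subtype _) (fun g x => rfl)
  let b : E ⟶ F.obj (op (iSup U)) := mkHom (X := E) 0 (fun g x => (map_zero _).symm)
  obtain ⟨t, -, ht⟩ := sheaf_hom F hF E U (fun i => b ≫ F.map (homOfLE (le_iSup U i)).op)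
    (fun i j => by
      rw [Category.assoc, Category.assoc, ← F.map_comp, ← F.map_comp]
      rfl)
  have hab : a = b := (ht a (fun i => lin_ext fun (x : ↥(S ⊓ discretePart _)) => by
    have hx : x.1 ∈ S := x.2.1
    simp only [S, Submodule.mem_iInf, LinearMap.mem_ker] at hx
    exact (hx i).trans (map_zero (res F (le_iSup U i))).symm)).trans
    (ht b (fun i => rfl)).symm
  have hs : s ∈ S ⊓ discretePart (act F (iSup U)) :=
    ⟨by simpa [S, Submodule.mem_iInf] using h, sec_discrete F s⟩
  let e : E.obj.V := (⟨s, hs⟩ : ↥(S ⊓ discretePart (act F (iSup U))))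
  exact congrArg (fun φ => lin φ e) hab

theorem sheaf_glue (hF : F.IsSheaf) {ι : Type} (U : ι → Opens Sp) (x : ∀ i, Sec F (U i))
    (hx : ∀ i j, res F (inf_le_left : U i ⊓ U j ≤ U i) (x i) =
        res F (inf_le_right : U i ⊓ U j ≤ U j) (x j))
    (hn : ∃ n, ∀ g : Gp p, InLevel n g → ∀ i, act F (U i) g (x i) = x i) :
    ∃ s, ∀ i, res F (le_iSup U i) s = x i := by
  let ρ : Representation ℚ (Gp p) (∀ i, Sec F (U i)) :=
    { toFun := fun g => LinearMap.pi fun i => act F (U i) g ∘ₗ LinearMap.proj i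
      map_one' := by ext; simp
      map_mul' := fun a b => by ext; simp }
  let S : Submodule ℚ (∀ i, Sec F (U i)) :=
    ⨅ (i) (j), LinearMap.eqLocus
      (res F (inf_le_left : U i ⊓ U j ≤ U i) ∘ₗ LinearMap.proj i)
      (res F (inf_le_right : U i ⊓ U j ≤ U j) ∘ₗ LinearMap.proj j)
  have mem_S : ∀ v, v ∈ S ↔ ∀ i j, res F (inf_le_left : U i ⊓ U j ≤ U i) (v i) =
        res F (inf_le_right : U i ⊓ U j ≤ U j) (v j) := by
    intro v
    simp only [S, Submodule.mem_iInf, LinearMap.mem_eqLocus]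
    rfl
  have hS : ∀ g v, v ∈ S → ρ g v ∈ S := by
    intro g v hv
    rw [mem_S] at hv ⊢
    intro i j
    exact (res_act F _ g (v i)).trans ((congrArg _ (hv i j)).trans (res_act F _ g (v j)).symm)
  let E := discreteSub ρ S hS
  let f : ∀ i, E ⟶ F.obj (op (U i)) := fun i => mkHom (X := E) (Y := F.obj (op (U i)))
      (LinearMap.proj (φ := fun i => Sec F (U i)) i ∘ₗ Submodule.subtype _) (fun g x => rfl)
  obtain ⟨t, ht, -⟩ := sheaf_hom F hF E U f (fun i j => by
      apply lin_ext
      rintro (v : ↥(S ⊓ discretePart ρ))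
      exact (mem_S v.1).1 v.2.1 i j)
  obtain ⟨n, hn⟩ := hn
  have hx' : x ∈ S ⊓ discretePart ρ := ⟨(mem_S x).2 hx, n, fun g hg => funext (hn g hg)⟩
  let e : E.obj.V := (⟨x, hx'⟩ : ↥(S ⊓ discretePart ρ))
  exact ⟨lin t e, fun i => congrArg (fun φ => lin φ e) (ht i)⟩

end Sheaf
end ZpModel

namespace ZpModel

section U
open Opposite TopologicalSpace
open scoped Classical
variable {p : ℕ} [Fact p.Prime]

variable (p) in
/-- The sheaf model: sheaves of discrete `ℤ_p`-modules on the space of closed subgroups. -/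
abbrev SheafModel : Type 1 := TopCat.Sheaf (DiscMod p) Sp

/-- The structure map of an object of the algebraic model, as a linear map. -/
abbrev str (A : AlgModel p) : A.left.obj.V →ₗ[ℚ] TailsMod fun k => (A.right k).V :=
  A.hom.hom.toLinearMap

theorem str_act (A : AlgModel p) (g : Gp p) (s : A.left.obj.V) :
    str A (A.left.obj.ρ g s) = tailsRep p A.right g (str A s) := Rep.hom_comm_apply A.hom g s

/-- Pairs consisting of a sequence `(x_k)` with `x_k ∈ A_k` and an element of `A_∞`. -/
abbrev USeq (A : AlgModel p) : Type := (∀ k, (A.right k).V) × A.left.obj.V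

/-- `ℤ_p` acts componentwise on `USeq A`. -/
def URep (A : AlgModel p) : Representation ℚ (Gp p) (USeq A) where
  toFun g := (LinearMap.pi fun k => (A.right k).ρ (proj p k g) ∘ₗ LinearMap.proj k).prodMap
    (A.left.obj.ρ g)
  map_one' := by ext <;> simp
  map_mul' a b := by ext <;> simp

theorem URep_fst (A : AlgModel p) (g : Gp p) (y : USeq A) (k : ℕ) :
    (URep A g y).1 k = (A.right k).ρ (proj p k g) (y.1 k) := rfl

theorem URep_snd (A : AlgModel p) (g : Gp p) (y : USeq A) :
    (URep A g y).2 = A.left.obj.ρ g y.2 := rfl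

/-- The sections of `UA` over `V`: an element of `A_k` for each `k ∈ V` and, if `∞ ∈ V`, an element
`s` of `A_∞` such that the sequence of the `x_k` eventually agrees with the image of `s` in
`colim_n ∏_{k ≥ n} A_k`. They are written as pairs which vanish outside `V`. -/
def USub (A : AlgModel p) (V : Opens Sp) : Submodule ℚ (USeq A) where
  carrier := {y | (∀ k : ℕ, (k : OnePoint ℕ) ∉ V → y.1 k = 0) ∧
    ((OnePoint.infty : OnePoint ℕ) ∉ V → y.2 = 0) ∧
    ((OnePoint.infty : OnePoint ℕ) ∈ V → str A y.2 = tailsMk (fun k => (A.right k).V) y.1)}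
  zero_mem' := ⟨fun _ _ => rfl, fun _ => rfl, fun _ => by
    rw [Prod.snd_zero, Prod.fst_zero, map_zero, map_zero]⟩
  add_mem' := by
    rintro x y ⟨hx, hx', hx''⟩ ⟨hy, hy', hy''⟩
    refine ⟨fun k hk => ?_, fun h => ?_, fun h => ?_⟩
    · rw [Prod.fst_add, Pi.add_apply, hx k hk, hy k hk, add_zero]
    · rw [Prod.snd_add, hx' h, hy' h, add_zero]
    · rw [Prod.snd_add, Prod.fst_add, map_add, map_add, hx'' h, hy'' h]
  smul_mem' := by
    rintro c x ⟨hx, hx', hx''⟩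
    refine ⟨fun k hk => ?_, fun h => ?_, fun h => ?_⟩
    · rw [Prod.smul_fst, Pi.smul_apply, hx k hk, smul_zero]
    · rw [Prod.smul_snd, hx' h, smul_zero]
    · rw [Prod.smul_snd, Prod.smul_fst, map_smul, map_smul, hx'' h]

theorem USub_stable (A : AlgModel p) (V : Opens Sp) (g : Gp p) (y : USeq A) (hy : y ∈ USub A V) :
    URep A g y ∈ USub A V := by
  obtain ⟨h1, h2, h3⟩ := hy
  refine ⟨fun k hk => ?_, fun h => ?_, fun h => ?_⟩
  · rw [URep_fst, h1 k hk, map_zero]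
  · rw [URep_snd, h2 h, map_zero]
  · rw [URep_snd, str_act, h3 h]
    rfl

/-- Restriction of sections of `UA` to `W`: replace the components outside `W` by zero. -/
def trunc (A : AlgModel p) (W : Opens Sp) : USeq A →ₗ[ℚ] USeq A where
  toFun y := (fun k => if (k : OnePoint ℕ) ∈ W then y.1 k else 0,
    if (OnePoint.infty : OnePoint ℕ) ∈ W then y.2 else 0)
  map_add' x y := by
    ext
    · dsimp; split_ifs <;> simp
    · dsimp; split_ifs <;> simp
  map_smul' c x := by
    ext
    · dsimp; split_ifs <;> simp
    · dsimp; split_ifs <;> simp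

theorem trunc_fst (A : AlgModel p) (W : Opens Sp) (y : USeq A) (k : ℕ) :
    (trunc A W y).1 k = if (k : OnePoint ℕ) ∈ W then y.1 k else 0 := rfl

theorem trunc_snd (A : AlgModel p) (W : Opens Sp) (y : USeq A) :
    (trunc A W y).2 = if (OnePoint.infty : OnePoint ℕ) ∈ W then y.2 else 0 := rfl

theorem trunc_act (A : AlgModel p) (W : Opens Sp) (g : Gp p) (y : USeq A) :
    trunc A W (URep A g y) = URep A g (trunc A W y) := by
  ext k
  · rw [trunc_fst, URep_fst, URep_fst, trunc_fst]
    split_ifs <;> simp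
  · rw [trunc_snd, URep_snd, URep_snd, trunc_snd]
    split_ifs <;> simp

theorem trunc_mem (A : AlgModel p) {V W : Opens Sp} (h : W ≤ V) (y : USeq A) (hy : y ∈ USub A V) :
    trunc A W y ∈ USub A W := by
  refine ⟨fun k hk => by rw [trunc_fst, if_neg hk], fun h' => by rw [trunc_snd, if_neg h'],
    fun h' => ?_⟩
  rw [trunc_snd, if_pos h', hy.2.2 (h h'), tailsMk_eq_iff]
  obtain ⟨n, hn⟩ := mem_of_infty_mem W h'
  exact ⟨n, fun k hk => by rw [trunc_fst, if_pos (hn k hk)]⟩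

/-- The presheaf `UA`. -/
def UPre (A : AlgModel p) : TopCat.Presheaf (DiscMod p) Sp where
  obj V := discreteSub (URep A) (USub A V.unop) (USub_stable A V.unop)
  map {V W} i := discreteSubMap (trunc A W.unop) (trunc_act A W.unop) (trunc_mem A (leOfHom i.unop))
  map_id V := by
    apply lin_ext
    rintro (x : ↥(USub A V.unop ⊓ discretePart (URep A)))
    apply Subtype.ext
    change trunc A V.unop x.1 = x.1
    ext k
    · rw [trunc_fst]
      split_ifs with h
      · rfl
      · exact (x.2.1.1 k h).symm
    · rw [trunc_snd]
      split_ifs with h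
      · rfl
      · exact (x.2.1.2.1 h).symm
  map_comp {V W X} i j := by
    apply lin_ext
    rintro (x : ↥(USub A V.unop ⊓ discretePart (URep A)))
    apply Subtype.ext
    change trunc A X.unop x.1 = trunc A X.unop (trunc A W.unop x.1)
    have hj := leOfHom j.unop
    ext k
    · rw [trunc_fst, trunc_fst, trunc_fst]
      split_ifs with h h'
      · rfl
      · exact absurd (hj h) h'
      · rfl
    · rw [trunc_snd, trunc_snd, trunc_snd]
      split_ifs with h h'
      · rfl
      · exact absurd (hj h) h'
      · rfl

/-- A section of `UA`, as a pair. -/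
abbrev pair {A : AlgModel p} {V : Opens Sp} (x : Sec (UPre A) V) : USeq A :=
  (show ↥(USub A V ⊓ discretePart (URep A)) from x).1

theorem pair_mem {A : AlgModel p} {V : Opens Sp} (x : Sec (UPre A) V) : pair x ∈ USub A V :=
  (show ↥(USub A V ⊓ discretePart (URep A)) from x).2.1

theorem pair_ext {A : AlgModel p} {V : Opens Sp} {x y : Sec (UPre A) V} (h : pair x = pair y) :
    x = y := Subtype.ext h

theorem pair_res {A : AlgModel p} {V W : Opens Sp} (h : W ≤ V) (x : Sec (UPre A) V) :
    pair (res (UPre A) h x) = trunc A W (pair x) := rfl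

theorem UPre_isSheaf (A : AlgModel p) : (UPre A).IsSheaf := by
  apply isSheaf_of
  · intro ι U s hs
    apply pair_ext
    change pair s = 0
    have hs' : ∀ i, trunc A (U i) (pair s) = 0 := fun i => congrArg pair (hs i)
    ext k
    · by_cases hk : (k : OnePoint ℕ) ∈ iSup U
      · obtain ⟨i, hi⟩ := Opens.mem_iSup.1 hk
        have := congrFun (congrArg Prod.fst (hs' i)) k
        rwa [trunc_fst, if_pos hi] at this
      · exact (pair_mem s).1 k hk
    · by_cases hk : (OnePoint.infty : OnePoint ℕ) ∈ iSup U
      · obtain ⟨i, hi⟩ := Opens.mem_iSup.1 hk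
        have := congrArg Prod.snd (hs' i)
        rwa [trunc_snd, if_pos hi] at this
      · exact (pair_mem s).2.1 hk
  · rintro ι U x hx ⟨n, hn⟩
    have hx' : ∀ i j, trunc A (U i ⊓ U j) (pair (x i)) = trunc A (U i ⊓ U j) (pair (x j)) :=
      fun i j => congrArg pair (hx i j)
    have c1 : ∀ i j (k : ℕ), (k : OnePoint ℕ) ∈ U i → (k : OnePoint ℕ) ∈ U j →
        (pair (x i)).1 k = (pair (x j)).1 k := by
      intro i j k hi hj
      have := congrFun (congrArg Prod.fst (hx' i j)) k
      rwa [trunc_fst, trunc_fst, if_pos ⟨hi, hj⟩, if_pos ⟨hi, hj⟩] at this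
    have c2 : ∀ i j, (OnePoint.infty : OnePoint ℕ) ∈ U i → (OnePoint.infty : OnePoint ℕ) ∈ U j →
        (pair (x i)).2 = (pair (x j)).2 := by
      intro i j hi hj
      have := congrArg Prod.snd (hx' i j)
      rwa [trunc_snd, trunc_snd, if_pos ⟨hi, hj⟩, if_pos ⟨hi, hj⟩] at this
    let s : USeq A := (fun k => if h : ∃ i, (k : OnePoint ℕ) ∈ U i then (pair (x h.choose)).1 k
      else 0, if h : ∃ i, (OnePoint.infty : OnePoint ℕ) ∈ U i then (pair (x h.choose)).2 else 0)
    have s1 : ∀ i (k : ℕ), (k : OnePoint ℕ) ∈ U i → s.1 k = (pair (x i)).1 k := by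
      intro i k hi
      have h : ∃ i, (k : OnePoint ℕ) ∈ U i := ⟨i, hi⟩
      exact (dif_pos h).trans (c1 _ _ k h.choose_spec hi)
    have s1' : ∀ k : ℕ, (k : OnePoint ℕ) ∉ iSup U → s.1 k = 0 := fun k hk =>
      dif_neg fun h => hk (Opens.mem_iSup.2 h)
    have s2 : ∀ i, (OnePoint.infty : OnePoint ℕ) ∈ U i → s.2 = (pair (x i)).2 := by
      intro i hi
      have h : ∃ i, (OnePoint.infty : OnePoint ℕ) ∈ U i := ⟨i, hi⟩
      exact (dif_pos h).trans (c2 _ _ h.choose_spec hi)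
    have s2' : (OnePoint.infty : OnePoint ℕ) ∉ iSup U → s.2 = 0 := fun hk =>
      dif_neg fun h => hk (Opens.mem_iSup.2 h)
    have hn' : ∀ g : Gp p, InLevel n g → ∀ i, URep A g (pair (x i)) = pair (x i) :=
      fun g hg i => congrArg pair (hn g hg i)
    have hs : s ∈ USub A (iSup U) ⊓ discretePart (URep A) := by
      refine ⟨⟨s1', s2', fun h => ?_⟩, n, fun g hg => ?_⟩
      · obtain ⟨i, hi⟩ := Opens.mem_iSup.1 h
        rw [s2 i hi, (pair_mem (x i)).2.2 hi, tailsMk_eq_iff]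
        obtain ⟨n, hn⟩ := mem_of_infty_mem _ hi
        exact ⟨n, fun k hk => (s1 i k (hn k hk)).symm⟩
      · ext k
        · by_cases hk : (k : OnePoint ℕ) ∈ iSup U
          · obtain ⟨i, hi⟩ := Opens.mem_iSup.1 hk
            rw [URep_fst, s1 i k hi]
            exact congrFun (congrArg Prod.fst (hn' g hg i)) k
          · rw [URep_fst, s1' k hk, map_zero]
        · by_cases hk : (OnePoint.infty : OnePoint ℕ) ∈ iSup U
          · obtain ⟨i, hi⟩ := Opens.mem_iSup.1 hk
            rw [URep_snd, s2 i hi]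
            exact congrArg Prod.snd (hn' g hg i)
          · rw [URep_snd, s2' hk, map_zero]
    refine ⟨(⟨s, hs⟩ : ↥(USub A (iSup U) ⊓ discretePart (URep A))), fun i => ?_⟩
    apply pair_ext
    change trunc A (U i) s = pair (x i)
    ext k
    · rw [trunc_fst]
      split_ifs with h
      · exact s1 i k h
      · exact ((pair_mem (x i)).1 k h).symm
    · rw [trunc_snd]
      split_ifs with h
      · exact s2 i h
      · exact ((pair_mem (x i)).2.1 h).symm

/-- The map `UA → UB` induced by a map `A → B`, on pairs. -/
def USeqMap {A B : AlgModel p} (f : A ⟶ B) : USeq A →ₗ[ℚ] USeq B :=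
  (LinearMap.pi fun k => (f.right k).hom.toLinearMap ∘ₗ LinearMap.proj k).prodMap (lin f.left)

theorem USeqMap_act {A B : AlgModel p} (f : A ⟶ B) (g : Gp p) (y : USeq A) :
    USeqMap f (URep A g y) = URep B g (USeqMap f y) := by
  ext k
  · exact Rep.hom_comm_apply (f.right k) _ _
  · exact lin_comm f.left g y.2

theorem USeqMap_mem {A B : AlgModel p} (f : A ⟶ B) (V : Opens Sp) (y : USeq A)
    (hy : y ∈ USub A V) : USeqMap f y ∈ USub B V := by
  obtain ⟨h1, h2, h3⟩ := hy
  refine ⟨fun k hk => ?_, fun h => ?_, fun h => ?_⟩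
  · exact (congrArg (f.right k).hom (h1 k hk)).trans (map_zero (f.right k).hom.toLinearMap)
  · exact (congrArg (lin f.left) (h2 h)).trans (map_zero _)
  · have hw := congrArg (fun φ => φ.hom y.2) f.w
    refine (show str B (lin f.left y.2) = _ from hw).trans ?_
    change ((tails p).map f.right).hom (str A y.2) = _
    rw [h3 h]
    rfl

theorem USeqMap_trunc {A B : AlgModel p} (f : A ⟶ B) (W : Opens Sp) (y : USeq A) :
    USeqMap f (trunc A W y) = trunc B W (USeqMap f y) := by
  ext k
  · change (f.right k).hom.toLinearMap (if _ then _ else _) = if _ then _ else _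
    split_ifs
    · rfl
    · exact map_zero _
  · change lin f.left (if _ then _ else _) = if _ then _ else _
    split_ifs
    · rfl
    · exact map_zero _

variable (p) in
/-- The functor from the algebraic model to the sheaf model. -/
def U : AlgModel p ⥤ SheafModel p where
  obj A := ⟨UPre A, UPre_isSheaf A⟩
  map {_ _} f := ⟨
    { app := fun V => discreteSubMap (USeqMap f) (USeqMap_act f) (USeqMap_mem f V.unop)
      naturality := fun _ W _ => lin_ext fun _ => Subtype.ext (USeqMap_trunc f W.unop _) }⟩
  map_id _ := rfl
  map_comp _ _ := rfl

end U
end ZpModel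

namespace ZpModel

section SheafHom
open Opposite TopologicalSpace
variable {p : ℕ} [Fact p.Prime]

theorem sheaf_sep' {F : TopCat.Presheaf (DiscMod p) Sp} (hF : F.IsSheaf) {ι : Type}
    {W : Opens Sp} (U : ι → Opens Sp) (h1 : ∀ i, U i ≤ W) (h2 : W ≤ iSup U) {s t : Sec F W}
    (h : ∀ i, res F (h1 i) s = res F (h1 i) t) : s = t := by
  obtain rfl : W = iSup U := le_antisymm h2 (iSup_le h1)
  exact sub_eq_zero.1 (sheaf_sep F hF U (s - t) fun i => by rw [map_sub, h i, sub_self])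

theorem sheaf_glue' {F : TopCat.Presheaf (DiscMod p) Sp} (hF : F.IsSheaf) {ι : Type}
    {W : Opens Sp} (U : ι → Opens Sp) (h1 : ∀ i, U i ≤ W) (h2 : W ≤ iSup U) (x : ∀ i, Sec F (U i))
    (hx : ∀ i j, res F (inf_le_left : U i ⊓ U j ≤ U i) (x i) =
        res F (inf_le_right : U i ⊓ U j ≤ U j) (x j))
    (hn : ∃ n, ∀ g : Gp p, InLevel n g → ∀ i, act F (U i) g (x i) = x i) :
    ∃ s, ∀ i, res F (h1 i) s = x i := by
  obtain rfl : W = iSup U := le_antisymm h2 (iSup_le h1)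
  exact sheaf_glue F hF U x hx hn

theorem cover_aux {ι : Type} {W : Opens Sp} {U : ι → Opens Sp} (h : W ≤ iSup U) :
    W ≤ ⨆ i, W ⊓ U i := by
  rw [← inf_iSup_eq]
  exact le_inf le_rfl h

variable (M N : TopCat.Presheaf (DiscMod p) Sp)

/-- Families of linear maps `M(W) → N(W)`, for the open sets `W ⊆ V`. -/
abbrev HomFam (V : Opens Sp) : Type := ∀ W : {W : Opens Sp // W ≤ V}, Sec M W.1 →ₗ[ℚ] Sec N W.1

/-- `ℤ_p` acts on families of linear maps by conjugation. -/
def homRep (V : Opens Sp) : Representation ℚ (Gp p) (HomFam M N V) where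
  toFun g := LinearMap.pi fun W =>
    (act M W.1).linHom (act N W.1) g ∘ₗ LinearMap.proj W
  map_one' := by ext; simp
  map_mul' a b := by ext; simp

theorem homRep_apply (V : Opens Sp) (g : Gp p) (φ : HomFam M N V) (W : {W : Opens Sp // W ≤ V})
    (x : Sec M W.1) : homRep M N V g φ W x = act N W.1 g (φ W (act M W.1 g⁻¹ x)) := rfl

/-- The families of linear maps which commute with restrictions, that is, the maps from `M`
restricted to `V` to `N` restricted to `V`, as sheaves of rational vector spaces. -/
def homNat (V : Opens Sp) : Submodule ℚ (HomFam M N V) where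
  carrier := {φ | ∀ (W W' : Opens Sp) (h : W ≤ V) (h' : W' ≤ W) (x : Sec M W),
    res N h' (φ ⟨W, h⟩ x) = φ ⟨W', h'.trans h⟩ (res M h' x)}
  zero_mem' := fun _ _ _ _ _ => map_zero _
  add_mem' := by
    intro a b ha hb W W' h h' x
    simp only [Pi.add_apply, LinearMap.add_apply, map_add, ha W W' h h' x, hb W W' h h' x]
  smul_mem' := by
    intro c a ha W W' h h' x
    simp only [Pi.smul_apply, LinearMap.smul_apply, map_smul, ha W W' h h' x]

theorem homNat_stable (V : Opens Sp) (g : Gp p) (φ : HomFam M N V) (hφ : φ ∈ homNat M N V) :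
    homRep M N V g φ ∈ homNat M N V := by
  intro W W' h h' x
  rw [homRep_apply, homRep_apply, res_act, hφ W W' h h', res_act]

/-- Restriction of families from `V` to `V'`. -/
def homRes {V V' : Opens Sp} (h : V' ≤ V) : HomFam M N V →ₗ[ℚ] HomFam M N V' :=
  LinearMap.pi fun W => LinearMap.proj (⟨W.1, W.2.trans h⟩ : {W : Opens Sp // W ≤ V})

/-- The presheaf `hom(M, N)`: its value at `V` is the discrete part of the space of maps of
sheaves of rational vector spaces from `M` restricted to `V` to `N` restricted to `V`. -/
def homPre : TopCat.Presheaf (DiscMod p) Sp where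
  obj V := discreteSub (homRep M N V.unop) (homNat M N V.unop) (homNat_stable M N V.unop)
  map {_ _} i := discreteSubMap (homRes M N (leOfHom i.unop)) (fun _ _ => rfl)
    (fun _ hφ W W' h h' x => hφ W W' (h.trans (leOfHom i.unop)) h' x)
  map_id _ := rfl
  map_comp _ _ := rfl

variable {M N}

/-- A section of `hom(M, N)`, as a family of linear maps. -/
abbrev fam {V : Opens Sp} (x : Sec (homPre M N) V) : HomFam M N V :=
  (show ↥(homNat M N V ⊓ discretePart (homRep M N V)) from x).1

theorem fam_nat {V : Opens Sp} (φ : Sec (homPre M N) V) : fam φ ∈ homNat M N V :=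
  (show ↥(homNat M N V ⊓ discretePart (homRep M N V)) from φ).2.1

theorem fam_ext {V : Opens Sp} {x y : Sec (homPre M N) V} (h : fam x = fam y) :
    x = y := Subtype.ext h

theorem homPre_isSheaf (hN : N.IsSheaf) : (homPre M N).IsSheaf := by
  apply isSheaf_of
  · intro ι U φ hφ
    apply fam_ext
    funext W
    apply LinearMap.ext
    intro x
    apply sheaf_sep' hN (fun i => W.1 ⊓ U i) (fun i => inf_le_left) (cover_aux W.2)
    intro i
    rw [fam_nat φ W.1 (W.1 ⊓ U i) W.2 inf_le_left x]
    have := congrFun (congrArg fam (hφ i)) ⟨W.1 ⊓ U i, inf_le_right⟩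
    exact (congrArg (fun f => f (res M inf_le_left x)) this).trans (map_zero (res N _)).symm
  · rintro ι U φ hφ ⟨n, hn⟩
    have c : ∀ i j (W : Opens Sp) (hi : W ≤ U i) (hj : W ≤ U j) (x : Sec M W),
        fam (φ i) ⟨W, hi⟩ x = fam (φ j) ⟨W, hj⟩ x := fun i j W hi hj x =>
      congrArg (fun f => f x) (congrFun (congrArg fam (hφ i j)) ⟨W, le_inf hi hj⟩)
    have hn' : ∀ g : Gp p, InLevel n g → ∀ i (W : Opens Sp) (hi : W ≤ U i) (x : Sec M W),
        act N W g (fam (φ i) ⟨W, hi⟩ (act M W g⁻¹ x)) = fam (φ i) ⟨W, hi⟩ x :=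
      fun g hg i W hi x =>
        congrArg (fun f => f x) (congrFun (congrArg fam (hn g hg i)) ⟨W, hi⟩)
    have key : ∀ (W : {W : Opens Sp // W ≤ iSup U}) (x : Sec M W.1), ∃ y : Sec N W.1, ∀ i,
        res N inf_le_left y =
          fam (φ i) ⟨W.1 ⊓ U i, inf_le_right⟩ (res M inf_le_left x) := by
      intro W x
      apply sheaf_glue' hN (fun i => W.1 ⊓ U i) (fun i => inf_le_left) (cover_aux W.2)
      · intro i j
        rw [fam_nat (φ i) _ _ inf_le_right inf_le_left, fam_nat (φ j) _ _ inf_le_right inf_le_right,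
          res_res, res_res]
        exact c i j _ _ _ _
      · obtain ⟨m, hm⟩ := sec_discrete M x
        refine ⟨max m n, fun g hg i => ?_⟩
        have h2 := hn' g (hg.mono (le_max_right _ _)) i (W.1 ⊓ U i) inf_le_right
          (act M _ g (res M inf_le_left x))
        rw [← Module.End.mul_apply, ← map_mul, inv_mul_cancel, map_one, Module.End.one_apply,
          ← res_act, hm g (hg.mono (le_max_left _ _))] at h2
        exact h2
    choose ψ hψ using key
    have sep : ∀ (W : {W : Opens Sp // W ≤ iSup U}) (s t : Sec N W.1),
        (∀ i, res N (inf_le_left : W.1 ⊓ U i ≤ W.1) s = res N inf_le_left t) → s = t :=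
      fun W s t h => sheaf_sep' hN (fun i => W.1 ⊓ U i) (fun i => inf_le_left) (cover_aux W.2) h
    let Φ : HomFam M N (iSup U) := fun W =>
      { toFun := ψ W
        map_add' := fun a b => sep W _ _ fun i => by simp only [hψ, map_add]
        map_smul' := fun r a => sep W _ _ fun i => by
          simp only [hψ, map_smul, RingHom.id_apply] }
    have hΦ : ∀ W x i, res N inf_le_left (Φ W x) =
        fam (φ i) ⟨W.1 ⊓ U i, inf_le_right⟩ (res M inf_le_left x) := hψ
    have mem : Φ ∈ homNat M N (iSup U) ⊓ discretePart (homRep M N (iSup U)) := by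
      refine ⟨fun W W' h h' x => ?_, n, fun g hg => ?_⟩
      · apply sep ⟨W', h'.trans h⟩
        intro i
        rw [hΦ, res_res, res_res]
        have h3 := congrArg (res N (inf_le_inf_right (U i) h')) (hΦ ⟨W, h⟩ x i)
        rw [fam_nat (φ i) _ _ inf_le_right (inf_le_inf_right (U i) h'), res_res, res_res] at h3
        exact h3
      · funext W
        apply LinearMap.ext
        intro x
        apply sep W
        intro i
        rw [homRep_apply, res_act, hΦ, hΦ, res_act]
        exact hn' g hg i _ _ _
    refine ⟨(⟨Φ, mem⟩ : ↥(homNat M N (iSup U) ⊓ discretePart (homRep M N (iSup U)))), fun i => ?_⟩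
    apply fam_ext
    funext W
    apply LinearMap.ext
    intro x
    apply sep ⟨W.1, W.2.trans (le_iSup U i)⟩
    intro j
    refine (hΦ _ _ _).trans ?_
    rw [fam_nat (φ i) _ _ W.2 inf_le_left]
    exact c j i _ _ _ _

/-- Postcomposition with a map of presheaves. -/
def homPost (M : TopCat.Presheaf (DiscMod p) Sp) {N N' : TopCat.Presheaf (DiscMod p) Sp}
    (f : N ⟶ N') (V : Opens Sp) : HomFam M N V →ₗ[ℚ] HomFam M N' V :=
  LinearMap.pi fun W => (lin (f.app (op W.1))).compRight ℚ ∘ₗ LinearMap.proj W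

theorem homPost_apply {N' : TopCat.Presheaf (DiscMod p) Sp} (f : N ⟶ N') {V : Opens Sp}
    (φ : HomFam M N V) (W : {W : Opens Sp // W ≤ V}) (x : Sec M W.1) :
    homPost M f V φ W x = lin (f.app (op W.1)) (φ W x) := rfl

theorem homPost_mem {N' : TopCat.Presheaf (DiscMod p) Sp} (f : N ⟶ N') (V : Opens Sp)
    (φ : HomFam M N V) (hφ : φ ∈ homNat M N V) : homPost M f V φ ∈ homNat M N' V := by
  intro W W' h h' x
  rw [homPost_apply, homPost_apply, ← hφ W W' h h' x]
  exact congrArg (fun a => lin a (φ ⟨W, h⟩ x)) (f.naturality (homOfLE h').op).symm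

theorem homPost_act {N' : TopCat.Presheaf (DiscMod p) Sp} (f : N ⟶ N') (V : Opens Sp) (g : Gp p)
    (φ : HomFam M N V) : homPost M f V (homRep M N V g φ) = homRep M N' V g (homPost M f V φ) := by
  funext W
  apply LinearMap.ext
  intro x
  exact lin_comm (f.app (op W.1)) g _

/-- The internal hom functor `N ↦ hom(M, N)` of the sheaf model. -/
def sheafHom (M : SheafModel p) : SheafModel p ⥤ SheafModel p where
  obj N := ⟨homPre M.obj N.obj, homPre_isSheaf N.property⟩
  map {_ _} f := ⟨
    { app := fun V => discreteSubMap (homPost M.obj f.hom V.unop) (homPost_act f.hom V.unop)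
        (homPost_mem f.hom V.unop)
      naturality := fun _ _ _ => rfl }⟩
  map_id _ := rfl
  map_comp _ _ := rfl

end SheafHom
end ZpModel

namespace ZpModel

section Fixed
variable {p : ℕ} [Fact p.Prime]

/-- A lift of an element of `ℤ/p^k` to `ℤ_p`. -/
def liftGk {p : ℕ} [Fact p.Prime] (k : ℕ) (a : Gk p k) : Gp p :=
  Multiplicative.ofAdd (((Multiplicative.toAdd a).val : ℕ) : ℤ_[p])

theorem proj_liftGk (k : ℕ) (a : Gk p k) : proj p k (liftGk k a) = a := by
  have hp : p ^ k ≠ 0 := pow_ne_zero _ (Fact.out : p.Prime).ne_zero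
  have : NeZero (p ^ k) := ⟨hp⟩
  change Multiplicative.ofAdd (PadicInt.toZModPow k (((Multiplicative.toAdd a).val : ℕ) : ℤ_[p])) = a
  rw [map_natCast, ZMod.natCast_zmod_val]
  rfl

variable {V W : Type} [AddCommGroup V] [Module ℚ V] [AddCommGroup W] [Module ℚ W]

/-- The elements fixed by `p^k ℤ_p`. -/
def fixedSub (ρ : Representation ℚ (Gp p) V) (k : ℕ) : Submodule ℚ V where
  carrier := {v | ∀ g : Gp p, InLevel k g → ρ g v = v}
  zero_mem' := fun _ _ => map_zero _
  add_mem' := fun ha hb g hg => by rw [map_add, ha g hg, hb g hg]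
  smul_mem' := fun c _ ha g hg => by rw [map_smul, ha g hg]

theorem fixedSub_stable (ρ : Representation ℚ (Gp p) V) (k : ℕ) (g : Gp p) (v : V)
    (hv : v ∈ fixedSub ρ k) : ρ g v ∈ fixedSub ρ k := by
  intro h hh
  have := congrArg (ρ g) (hv h hh)
  rw [← Module.End.mul_apply, ← map_mul] at this ⊢
  rwa [mul_comm h g]

theorem fixed_eq (ρ : Representation ℚ (Gp p) V) (k : ℕ) {g h : Gp p} (hgh : proj p k g = proj p k h)
    {v : V} (hv : v ∈ fixedSub ρ k) : ρ g v = ρ h v := by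
  have h1 : InLevel k (h⁻¹ * g) := by
    change proj p k (h⁻¹ * g) = 1
    rw [map_mul, map_inv, hgh, inv_mul_cancel]
  have h2 := congrArg (ρ h) (hv _ h1)
  rwa [← Module.End.mul_apply, ← map_mul, mul_inv_cancel_left] at h2

/-- The action of `ℤ/p^k` on the elements fixed by `p^k ℤ_p`. -/
def fixedRep (ρ : Representation ℚ (Gp p) V) (k : ℕ) :
    Representation ℚ (Gk p k) (fixedSub ρ k) where
  toFun a := (ρ (liftGk k a)).restrict (fixedSub_stable ρ k (liftGk k a))
  map_one' := by
    ext v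
    exact (fixed_eq ρ k (by rw [proj_liftGk, map_one]) v.2).trans
      (congrArg (fun f => f v.1) (map_one ρ))
  map_mul' a b := by
    ext v
    exact (fixed_eq ρ k (by rw [map_mul, proj_liftGk, proj_liftGk, proj_liftGk]) v.2).trans
      (congrArg (fun f => f v.1) (map_mul ρ (liftGk k a) (liftGk k b)))

theorem fixedRep_proj (ρ : Representation ℚ (Gp p) V) (k : ℕ) (g : Gp p) (v : fixedSub ρ k) :
    (fixedRep ρ k (proj p k g) v : V) = ρ g v :=
  fixed_eq ρ k (proj_liftGk _ _) v.2

end Fixed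

section R
open Opposite TopologicalSpace
open scoped Classical
variable {p : ℕ} [Fact p.Prime]
variable (M N : TopCat.Presheaf (DiscMod p) Sp)

/-- The stalk at the trivial subgroup, as the colimit of the sections over the open sets `S_n`. -/
abbrev Stalk : Type :=
  Module.DirectLimit (R := ℚ) (fun n : ℕ => Sec M (openS n))
    (fun _ _ h => res M (openS_anti h))

/-- The action on the stalk. -/
def stalkRep : Representation ℚ (Gp p) (Stalk M) where
  toFun g := Module.DirectLimit.map (fun n => act M (openS n) g)
    (fun _ _ h => LinearMap.ext fun x => (res_act M (openS_anti h) g x).symm)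
  map_one' := by
    apply Module.DirectLimit.hom_ext
    intro n
    ext x
    simp
  map_mul' a b := by
    apply Module.DirectLimit.hom_ext
    intro n
    ext x
    simp

/-- The family `(M({k})^{p^k ℤ_p})` of representations of `ℤ/p^k`. -/
def RFam : Fam p := fun k => Rep.of (fixedRep (act M (openPt k)) k)

/-- The sequence of restrictions to `{k}`, for `k ≥ n`, of a section over `S_n`. -/
def seqOf (n : ℕ) : Sec M (openS n) →ₗ[ℚ] ∀ k, Sec M (openPt k) :=
  LinearMap.pi fun k => if h : n ≤ k then res M (openPt_le.2 (coe_mem_openS.2 h)) else 0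

theorem seqOf_apply {n k : ℕ} (h : n ≤ k) (x : Sec M (openS n)) :
    seqOf M n x k = res M (openPt_le.2 (coe_mem_openS.2 h)) x := by
  change (if h : n ≤ k then res M (openPt_le.2 (coe_mem_openS.2 h)) else 0 :
    Sec M (openS n) →ₗ[ℚ] Sec M (openPt k)) x = _
  rw [dif_pos h]

/-- The map `M_e → colim_n ∏_{k ≥ n} M({k})`. -/
def stalkToTails : Stalk M →ₗ[ℚ] TailsMod fun k => Sec M (openPt k) :=
  Module.DirectLimit.lift ℚ ℕ (fun n : ℕ => Sec M (openS n)) (fun _ _ h => res M (openS_anti h))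
    (fun n => tailsMk (fun k => Sec M (openPt k)) ∘ₗ seqOf M n) (by
      intro i j h x
      change tailsMk _ _ = tailsMk _ _
      rw [tailsMk_eq_iff]
      refine ⟨j, fun k hk => ?_⟩
      rw [seqOf_apply M hk, seqOf_apply M (h.trans hk), res_res])

/-- The map `colim_n ∏_{k ≥ n} M({k})^{p^k ℤ_p} → colim_n ∏_{k ≥ n} M({k})`. -/
def inclTails : (TailsMod fun k => (RFam M k).V) →ₗ[ℚ] TailsMod fun k => Sec M (openPt k) :=
  tailsMap fun k => (fixedSub (act M (openPt k)) k).subtype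

/-- `ℤ_p` acts componentwise on pairs. -/
def RRep : Representation ℚ (Gp p) (Stalk M × TailsMod fun k => (RFam M k).V) where
  toFun g := (stalkRep M g).prodMap (tailsRep p (RFam M) g)
  map_one' := by rw [map_one, map_one]; rfl
  map_mul' a b := by rw [map_mul, map_mul]; rfl

/-- The pullback of `M_e → colim_n ∏_{k ≥ n} M({k}) ← colim_n ∏_{k ≥ n} M({k})^{p^k ℤ_p}`. -/
def RSub : Submodule ℚ (Stalk M × TailsMod fun k => (RFam M k).V) :=
  LinearMap.eqLocus (stalkToTails M ∘ₗ LinearMap.fst ℚ _ _) (inclTails M ∘ₗ LinearMap.snd ℚ _ _)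

theorem mem_RSub (y : Stalk M × TailsMod fun k => (RFam M k).V) :
    y ∈ RSub M ↔ stalkToTails M y.1 = inclTails M y.2 := Iff.rfl

/-- The action on `colim_n ∏_{k ≥ n} M({k})`. -/
def tailsAct (g : Gp p) :
    (TailsMod fun k => Sec M (openPt k)) →ₗ[ℚ] TailsMod fun k => Sec M (openPt k) :=
  tailsMap fun k => act M (openPt k) g

theorem stalkToTails_act (g : Gp p) (s : Stalk M) :
    stalkToTails M (stalkRep M g s) = tailsAct M g (stalkToTails M s) := by
  induction s using Module.DirectLimit.induction_on with
  | ih n x =>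
    simp only [stalkRep, MonoidHom.coe_mk, OneHom.coe_mk, Module.DirectLimit.map_apply_of,
      stalkToTails, Module.DirectLimit.lift_of]
    change tailsMk _ _ = tailsMk _ _
    rw [tailsMk_eq_iff]
    refine ⟨n, fun k hk => ?_⟩
    rw [seqOf_apply M hk]
    change _ = act M (openPt k) g (seqOf M n x k)
    rw [seqOf_apply M hk, res_act]

theorem inclTails_act (g : Gp p) (t : TailsMod fun k => (RFam M k).V) :
    inclTails M (tailsRep p (RFam M) g t) = tailsAct M g (inclTails M t) := by
  obtain ⟨x, rfl⟩ := tailsMk_surjective t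
  change tailsMk _ _ = tailsMk _ _
  congr 1
  funext k
  exact fixedRep_proj (act M (openPt k)) k g (x k)

theorem RSub_stable (g : Gp p) (y : Stalk M × TailsMod fun k => (RFam M k).V) (hy : y ∈ RSub M) :
    RRep M g y ∈ RSub M := by
  rw [mem_RSub] at hy ⊢
  exact (stalkToTails_act M g y.1).trans
    ((congrArg (tailsAct M g) hy).trans (inclTails_act M g y.2).symm)

/-- The object `RM`: `(RM)_k = M({k})^{p^k ℤ_p}`, and `(RM)_∞` is the pullback above, with the
projection as structure map. -/
def RObj : AlgModel p where
  left := discreteSub (RRep M) (RSub M) (RSub_stable M)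
  right := RFam M
  hom := Rep.ofHom ⟨LinearMap.snd ℚ _ _ ∘ₗ Submodule.subtype _, fun _ => rfl⟩

variable {M N}

/-- The map induced on stalks. -/
def stalkMap (f : M ⟶ N) : Stalk M →ₗ[ℚ] Stalk N :=
  Module.DirectLimit.map (fun n => lin (f.app (op (openS n))))
    (fun _ _ h => LinearMap.ext fun x =>
      congrArg (fun a => lin a x) (f.naturality (homOfLE (openS_anti h)).op))

/-- The map induced on fixed points. -/
def fixedMap (f : M ⟶ N) (k : ℕ) : RFam M k ⟶ RFam N k :=
  Rep.ofHom ⟨(lin (f.app (op (openPt k)))).restrict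
    (p := fixedSub (act M (openPt k)) k) (q := fixedSub (act N (openPt k)) k)
    (fun v hv g hg => by rw [← lin_comm, hv g hg]), fun a => by
      ext v
      exact lin_comm (f.app (op (openPt k))) _ _⟩

/-- The map induced on pairs. -/
def RPairMap (f : M ⟶ N) : (Stalk M × TailsMod fun k => (RFam M k).V) →ₗ[ℚ]
    (Stalk N × TailsMod fun k => (RFam N k).V) :=
  (stalkMap f).prodMap (tailsMap fun k => (fixedMap f k).hom.toLinearMap)

theorem RPairMap_act (f : M ⟶ N) (g : Gp p) (y : Stalk M × TailsMod fun k => (RFam M k).V) :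
    RPairMap f (RRep M g y) = RRep N g (RPairMap f y) := by
  obtain ⟨s, t⟩ := y
  apply Prod.ext
  · change stalkMap f (stalkRep M g s) = stalkRep N g (stalkMap f s)
    induction s using Module.DirectLimit.induction_on with
    | ih n x =>
      simp only [stalkMap, stalkRep, MonoidHom.coe_mk, OneHom.coe_mk,
        Module.DirectLimit.map_apply_of]
      congr 1
      exact lin_comm (f.app (op (openS n))) g x
  · obtain ⟨x, rfl⟩ := tailsMk_surjective t
    change tailsMk _ _ = tailsMk _ _
    congr 1
    funext k
    exact Rep.hom_comm_apply (fixedMap f k) _ _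

theorem RPairMap_mem (f : M ⟶ N) (y : Stalk M × TailsMod fun k => (RFam M k).V)
    (hy : y ∈ RSub M) : RPairMap f y ∈ RSub N := by
  obtain ⟨s, t⟩ := y
  rw [mem_RSub] at hy ⊢
  let T : (TailsMod fun k => Sec M (openPt k)) →ₗ[ℚ] TailsMod fun k => Sec N (openPt k) :=
    tailsMap fun k => lin (f.app (op (openPt k)))
  have h1 : stalkToTails N (stalkMap f s) = T (stalkToTails M s) := by
    induction s using Module.DirectLimit.induction_on with
    | ih n x =>
      simp only [stalkToTails, stalkMap, Module.DirectLimit.map_apply_of,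
        Module.DirectLimit.lift_of]
      change tailsMk _ _ = tailsMk _ _
      rw [tailsMk_eq_iff]
      refine ⟨n, fun k hk => ?_⟩
      rw [seqOf_apply N hk]
      change _ = lin (f.app (op (openPt k))) (seqOf M n x k)
      rw [seqOf_apply M hk]
      exact congrArg (fun a => lin a x)
        (f.naturality (homOfLE (openPt_le.2 (coe_mem_openS.2 hk))).op).symm
  have h2 : inclTails N (tailsMap (fun k => (fixedMap f k).hom.toLinearMap) t) =
      T (inclTails M t) := by
    obtain ⟨x, rfl⟩ := tailsMk_surjective t
    rfl
  exact h1.trans ((congrArg T hy).trans h2.symm)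

variable (p) in
/-- The functor from the sheaf model to the algebraic model. -/
def R : SheafModel p ⥤ AlgModel p where
  obj M := RObj M.obj
  map {_ _} f :=
    { left := discreteSubMap (RPairMap f.hom) (RPairMap_act f.hom) (RPairMap_mem f.hom)
      right := fun k => fixedMap f.hom k
      w := rfl }
  map_id M := by
    apply CommaMorphism.ext
    · apply lin_ext
      rintro (x : ↥(RSub M.obj ⊓ discretePart (RRep M.obj)))
      apply Subtype.ext
      apply Prod.ext
      · exact congrArg (fun a => a x.1.1) (Module.DirectLimit.map_id)
      · obtain ⟨y, hy⟩ := tailsMk_surjective x.1.2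
        change tailsMap _ x.1.2 = x.1.2
        rw [← hy]
        rfl
    · rfl
  map_comp {M N K} f g := by
    apply CommaMorphism.ext
    · apply lin_ext
      rintro (x : ↥(RSub M.obj ⊓ discretePart (RRep M.obj)))
      apply Subtype.ext
      apply Prod.ext
      · change stalkMap (f.hom ≫ g.hom) x.1.1 = stalkMap g.hom (stalkMap f.hom x.1.1)
        induction x.1.1 using Module.DirectLimit.induction_on with
        | ih n x =>
          simp only [stalkMap, Module.DirectLimit.map_apply_of]
          rfl
      · obtain ⟨y, hy⟩ := tailsMk_surjective x.1.2
        change tailsMap _ x.1.2 = tailsMap _ (tailsMap _ x.1.2)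
        rw [← hy]
        rfl
    · rfl

/-- The internal hom functor `C ↦ R hom(UB, UC)` of the algebraic model. -/
def ihomA (B : AlgModel p) : AlgModel p ⥤ AlgModel p :=
  U p ⋙ sheafHom ((U p).obj B) ⋙ R p

end R
end ZpModel

namespace ZpModel

section Model
variable (p : ℕ) [Fact p.Prime]

/-- The underlying `ℚ`-module of `A_∞`. -/
def evalInfty : AlgModel p ⥤ ModuleCat.{0} ℚ :=
  Comma.fst _ _ ⋙ (IsDiscrete p).ι ⋙ forget₂ (Rep.{0} ℚ (Gp p)) (ModuleCat.{0} ℚ)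

/-- The underlying `ℚ`-module of `A_k`. -/
def evalAt (k : ℕ) : AlgModel p ⥤ ModuleCat.{0} ℚ :=
  Comma.snd _ _ ⋙ Pi.eval _ k ⋙ forget₂ (Rep.{0} ℚ (Gk p k)) (ModuleCat.{0} ℚ)

instance : (evalInfty p).Additive where
  map_add {_ _ _ _} := rfl

instance (k : ℕ) : (evalAt p k).Additive where
  map_add {_ _ _ _} := rfl

/-- The maps of complexes which are surjective at each `k` and at `∞` (in every degree). -/
def dgFibrations : MorphismProperty (DG p) := fun _ _ f => ∀ i : ℤ,
  (∀ k : ℕ, Function.Surjective ((evalAt p k).map (f.f i))) ∧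
    Function.Surjective ((evalInfty p).map (f.f i))

/-- The maps of complexes which are homology isomorphisms at each `k` and at `∞`. -/
def dgWeakEquivalences : MorphismProperty (DG p) := fun _ _ f =>
  (∀ k : ℕ, QuasiIso (((evalAt p k).mapHomologicalComplex (ComplexShape.down ℤ)).map f)) ∧
    QuasiIso (((evalInfty p).mapHomologicalComplex (ComplexShape.down ℤ)).map f)

end Model
end ZpModel

namespace MonoidalModel

universe v u
variable (C : Type u) [Category.{v} C] [MonoidalCategory C] [ModelCategory C]

/-- The pushout-product axiom: for cofibrations `i : A ⟶ B` and `j : X ⟶ Y`, the map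
`(A ⊗ Y) ⨿_{A ⊗ X} (B ⊗ X) ⟶ B ⊗ Y` is a cofibration, and it is a weak equivalence if `i` or `j` is
one. -/
def PushoutProductAxiom : Prop :=
  ∀ (A B X Y : C) (i : A ⟶ B) (j : X ⟶ Y), cofibrations C i → cofibrations C j →
    cofibrations C ((Arrow.pushoutProduct.obj (Arrow.mk i)).obj (Arrow.mk j)).hom ∧
    (weakEquivalences C i ∨ weakEquivalences C j →
      weakEquivalences C ((Arrow.pushoutProduct.obj (Arrow.mk i)).obj (Arrow.mk j)).hom)

/-- The unit axiom: if `q : Q ⟶ 𝟙` is a weak equivalence with `Q` cofibrant, then `q ⊗ X` and `X ⊗ q`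
are weak equivalences for every cofibrant `X`. -/
def UnitAxiom : Prop :=
  ∀ (Q X : C) (q : Q ⟶ 𝟙_ C), IsCofibrant Q → weakEquivalences C q → IsCofibrant X →
    weakEquivalences C (q ▷ X) ∧ weakEquivalences C (X ◁ q)

/-- The maps `j ⊗ Z`, where `j` is a trivial cofibration and `Z` is any object. -/
inductive trivialCofibrationsTensor : MorphismProperty C
  | mk (A B Z : C) (j : A ⟶ B) (hj : trivialCofibrations C j) : trivialCofibrationsTensor (j ▷ Z)

/-- The monoid axiom: transfinite compositions of pushouts of maps `j ⊗ Z`, with `j` a trivial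
cofibration and `Z` any object, are weak equivalences. -/
def MonoidAxiom : Prop :=
  MorphismProperty.transfiniteCompositions.{v} (trivialCofibrationsTensor C).pushouts ≤
    weakEquivalences C

end MonoidalModel

namespace ZpModel

section Closed
variable {p : ℕ} [Fact p.Prime]

/-- The component `hom(K, L)_n ⟶ R hom(U K_i, U L_{i + n})` of the internal hom of complexes: it
corresponds under the adjunction to the restriction of the evaluation `K ⊗ hom(K, L) ⟶ L` to
the summand `K_i ⊗ hom(K, L)_n`. -/
def ihomComponent [MonoidalClosed (DG p)] (adj : ∀ X : AlgModel p, tensorLeft X ⊣ ihomA X)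
    (K L : DG p) (n i : ℤ) :
    ((ihom K).obj L).X n ⟶ (ihomA (K.X i)).obj (L.X (i + n)) :=
  (adj (K.X i)).homEquiv _ _
    (HomologicalComplex.ιTensorObj K ((ihom K).obj L) i n (i + n) rfl ≫
      ((ihom.ev K).app L).f (i + n))

end Closed
end ZpModel

end

set_option linter.unusedSectionVars false

/-! The model structure is the projective one for a family of generators. For N ≥ 0 let Q_N =
`regObj p N` be the object with ℚ[ℤ/p^N] at ∞ and ℚ[ℤ/p^min(k,N)] at k. Maps out of Q_N reach every
element of M_∞ fixed by p^N ℤ_p and every element of M_N (`exists_hom_infty`, `exists_hom_at`). What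
makes them work is `Good`: they are finite-dimensional at each point, and the structure map comes
from equivariant maps Q_∞ → Q_k which are bijective for large k. The unit is good, and good objects
are closed under ⊗. Any map Q_∞ → M_∞ out of a good Q extends to the points k, and it determines the
components at all large k (`Good.exists_compat`, `Good.eventually_eq`). The reason is that ℤ_p has a
single topological generator, so that on a finite-dimensional space equivariance at all large k at
once amounts to finitely many conditions. Together with averaging over finite quotients this shows
that good objects are projective for pointwise surjections (`Good.exists_lift`) and compact
(`Good.isCompactObj`).

Hence the spheres and disks on the Q_N are suitable generators. The right lifting classes `trivFibs`
and `fibs` are the surjective homology isomorphisms and the pointwise surjections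
(`trivFibs_regObj`, `fibs_regObj`), and the small object argument gives the factorizations.
Acyclicity of the left class of `fibs` comes from homotopy theory alone: every degreewise split
epimorphism is a fibration, and a map lifts against all degreewise split epimorphisms exactly when
it is a deformation retract (`IsDeformationRetract.llp`, `isDeformationRetract_of_llp`). So trivial
cofibrations are homotopy equivalences.

The monoid axiom follows from the same fact: tensoring with any complex preserves deformation
retracts, and being a left lifting class they are closed under pushouts and transfinite
compositions. For the unit axiom, a trivial fibration from a cofibrant complex onto the unit has a
section because the unit is good, and is then a homotopy equivalence.

For the pushout-product axiom one passes by adjunction to the map hom(Y, E) → hom(X, E) ×_{hom(X,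
B)} hom(Y, B). A lifting problem for it with a test object P is a problem of extending a homotopy
with values in [P, E], that is, a lifting problem of X → Y against a map of shifted path complexes
made from [P, E] → [P, B] (`exists_homotopyLift`, `trivFibs_pullback`). That map is again a
(trivial) fibration, because tensor products of generators are good.

For the closed structure on 𝒜, the stalk of UA at ∞ is A_∞ (`stalkEquiv`), which gives A → RUA
(`unitRU`). A map A ⊗ B → C gives UB → hom(UA, UC) and so B → R hom(UA, UC). In the other direction,
germs of sections of hom(UA, UC) are evaluated on A_∞ and sections over {k} on A_k (`evA`). Internal
homs of complexes are products of these with the usual differential. Limits exist in 𝒜 because the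
inclusion of discrete modules has a right adjoint. -/

noncomputable section

/-! ### The tensor product of complexes on its summands -/

namespace DGTensor
universe v u

section UnitsSmul

variable {A : Type u} [Category.{v} A] [Preadditive A] [MonoidalCategory A] [MonoidalPreadditive A]

theorem units_smul_whiskerRight {X Y : A} (u : ℤˣ) (f : X ⟶ Y) (Z : A) :
    (u • f) ▷ Z = u • (f ▷ Z) :=
  ((tensorRight Z).map_units_smul u f)

theorem whiskerLeft_units_smul (Z : A) {X Y : A} (u : ℤˣ) (f : X ⟶ Y) :
    Z ◁ (u • f) = u • (Z ◁ f) :=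
  ((tensorLeft Z).map_units_smul u f)

end UnitsSmul

section Tensor

variable {A : Type u} [Category.{v} A] [Preadditive A] [MonoidalCategory A] [MonoidalPreadditive A]
  [HasZeroObject A] [HasColimitsOfSize.{0, 0} A]
  [∀ X : A, PreservesColimitsOfSize.{0, 0} ((curriedTensor A).obj X)]
  [∀ X : A, PreservesColimitsOfSize.{0, 0} ((curriedTensor A).flip.obj X)]

/-- The inclusion of the summand `K_i ⊗ L_j` in `(K ⊗ L)_n`, for `i + j = n`. -/
def tι (K L : ChainComplex A ℤ) (i j n : ℤ) (h : i + j = n) :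
    K.X i ⊗ L.X j ⟶ (K ⊗ L).X n :=
  HomologicalComplex.ιTensorObj K L i j n h

theorem tι_hom_ext {K L : ChainComplex A ℤ} {n : ℤ} {Z : A} {f g : (K ⊗ L).X n ⟶ Z}
    (w : ∀ (i j : ℤ) (h : i + j = n), tι K L i j n h ≫ f = tι K L i j n h ≫ g) : f = g :=
  HomologicalComplex.mapBifunctor.hom_ext w

/-- The map out of `(K ⊗ L)_n` with given restrictions to the summands. -/
def tDesc {K L : ChainComplex A ℤ} {n : ℤ} {Z : A}
    (f : ∀ (i j : ℤ) (_ : i + j = n), K.X i ⊗ L.X j ⟶ Z) : (K ⊗ L).X n ⟶ Z :=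
  HomologicalComplex.mapBifunctorDesc (K₁ := K) (K₂ := L) (F := curriedTensor A) f

@[simp]
theorem tι_desc {K L : ChainComplex A ℤ} {n : ℤ} {Z : A}
    (f : ∀ (i j : ℤ) (_ : i + j = n), K.X i ⊗ L.X j ⟶ Z) (i j : ℤ) (h : i + j = n) :
    tι K L i j n h ≫ tDesc f = f i j h :=
  HomologicalComplex.ι_mapBifunctorDesc (K₁ := K) (K₂ := L) (F := curriedTensor A)
    (c := .down ℤ) f i j h

/-- The target indices are free up to equations, so that no transport between equal degrees appears
when the formula is applied. -/
theorem tι_d (K L : ChainComplex A ℤ) (i j n i' j' n' : ℤ) (h : i + j = n) (hi : i' + 1 = i)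
    (hj : j' + 1 = j) (hn : n' + 1 = n) :
    tι K L i j n h ≫ (K ⊗ L).d n n' =
      K.d i i' ▷ L.X j ≫ tι K L i' j n' (by lia) +
        i.negOnePow • (K.X i ◁ L.d j j' ≫ tι K L i j' n' (by lia)) := by
  refine (congrArg (tι K L i j n h ≫ ·)
    (HomologicalComplex.mapBifunctor.d_eq K L (curriedTensor A) (.down ℤ) n n')).trans ?_
  refine (Preadditive.comp_add _ _ _ _ _ _).trans ?_
  refine congrArg₂ (· + ·) ?_ ?_
  · refine (HomologicalComplex.mapBifunctor.ι_D₁ K L (curriedTensor A) (.down ℤ) n n' i j h).trans ?_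
    refine (HomologicalComplex.mapBifunctor.d₁_eq K L (curriedTensor A) (.down ℤ) (i₁ := i)
      (i₁' := i') hi j n' (show i' + j = n' by lia)).trans ?_
    exact one_smul _ _
  · refine (HomologicalComplex.mapBifunctor.ι_D₂ K L (curriedTensor A) (.down ℤ) n n' i j h).trans ?_
    exact HomologicalComplex.mapBifunctor.d₂_eq K L (curriedTensor A) (.down ℤ) i (i₂ := j)
      (i₂' := j') hj n' (show i + j' = n' by lia)

@[simp]
theorem tι_whiskerRight {K K' : ChainComplex A ℤ} (f : K ⟶ K') (L : ChainComplex A ℤ)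
    (i j n : ℤ) (h : i + j = n) :
    tι K L i j n h ≫ (f ▷ L).f n = f.f i ▷ L.X j ≫ tι K' L i j n h := by
  refine (HomologicalComplex.ι_mapBifunctorMap f (𝟙 L) (curriedTensor A) (.down ℤ) i j n h).trans ?_
  change f.f i ▷ L.X j ≫ (K'.X i ◁ 𝟙 (L.X j)) ≫ _ = _
  rw [whiskerLeft_id, Category.id_comp]
  rfl

@[simp]
theorem tι_whiskerLeft (K : ChainComplex A ℤ) {L L' : ChainComplex A ℤ} (f : L ⟶ L')
    (i j n : ℤ) (h : i + j = n) :
    tι K L i j n h ≫ (K ◁ f).f n = K.X i ◁ f.f j ≫ tι K L' i j n h := by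
  refine (HomologicalComplex.ι_mapBifunctorMap (𝟙 K) f (curriedTensor A) (.down ℤ) i j n h).trans ?_
  change (𝟙 (K.X i)) ▷ L.X j ≫ _ = _
  rw [id_whiskerRight, Category.id_comp]
  rfl

theorem tι_associator (K L M : ChainComplex A ℤ) (i j k a b n : ℤ) (ha : i + j = a)
    (hb : j + k = b) (h : a + k = n) (h' : i + b = n) :
    tι K L i j a ha ▷ M.X k ≫ tι (K ⊗ L) M a k n h ≫ (α_ K L M).hom.f n =
      (α_ (K.X i) (L.X j) (M.X k)).hom ≫ K.X i ◁ tι L M j k b hb ≫ tι K (L ⊗ M) i b n h' := by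
  subst ha hb
  have := HomologicalComplex.ι_mapBifunctorAssociatorX_hom (curriedAssociatorNatIso A) K L M
    (.down ℤ) (.down ℤ) (.down ℤ) i j k n h
  rw [HomologicalComplex.mapBifunctor₁₂.ι_eq _ _ _ _ _ _ _ _ _ _ _ _ rfl h,
    HomologicalComplex.mapBifunctor₂₃.ι_eq _ _ _ _ _ _ _ _ _ _ _ _ _ rfl h', Category.assoc] at this
  exact this

theorem tι_hom_ext₃ {K L M : ChainComplex A ℤ} {n : ℤ} {Z : A} {f g : ((K ⊗ L) ⊗ M).X n ⟶ Z}
    (w : ∀ (i j k a : ℤ) (ha : i + j = a) (h : a + k = n),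
      tι K L i j a ha ▷ M.X k ≫ tι (K ⊗ L) M a k n h ≫ f =
        tι K L i j a ha ▷ M.X k ≫ tι (K ⊗ L) M a k n h ≫ g) : f = g := by
  refine HomologicalComplex.mapBifunctor₁₂.hom_ext (F₁₂ := curriedTensor A) (G := curriedTensor A)
    (K₁ := K) (K₂ := L) (K₃ := M) (c₁₂ := .down ℤ) (c₄ := .down ℤ) fun i j k h => ?_
  rw [HomologicalComplex.mapBifunctor₁₂.ι_eq _ _ _ _ _ _ _ _ _ _ _ _ rfl h, Category.assoc,
    Category.assoc]
  exact w i j k (i + j) rfl h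

end Tensor

/-! ### The symmetry of the tensor product of complexes -/

section Braiding

variable {A : Type u} [Category.{v} A] [Preadditive A] [MonoidalCategory A] [SymmetricCategory A]
  [MonoidalPreadditive A] [HasZeroObject A] [HasColimitsOfSize.{0, 0} A]
  [∀ X : A, PreservesColimitsOfSize.{0, 0} ((curriedTensor A).obj X)]
  [∀ X : A, PreservesColimitsOfSize.{0, 0} ((curriedTensor A).flip.obj X)]

/-- The symmetry `x ⊗ y ↦ (-1)^{ij} y ⊗ x` of the tensor product of complexes. -/
def braidHom (K L : ChainComplex A ℤ) : K ⊗ L ⟶ L ⊗ K where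
  f n := tDesc fun i j h => (i * j).negOnePow • ((β_ (K.X i) (L.X j)).hom ≫
    tι L K j i n (by rw [add_comm, h]))
  comm' n n' hn := by
    change n' + 1 = n at hn
    apply tι_hom_ext
    intro i j h
    have h1 := tι_d K L i j n (i - 1) (j - 1) n' h (by lia) (by lia) hn
    have h2 := tι_d L K j i n (j - 1) (i - 1) n' (by lia) (by lia) (by lia) hn
    rw [reassoc_of% h1, ← Category.assoc, tι_desc, Linear.units_smul_comp, Category.assoc, h2]
    simp only [Preadditive.add_comp, Preadditive.comp_add, Linear.units_smul_comp, Category.assoc,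
      tι_desc, Linear.comp_units_smul, smul_add, smul_smul,
      BraidedCategory.braiding_naturality_right_assoc,
      BraidedCategory.braiding_naturality_left_assoc]
    -- The symmetry exchanges the two summands of the differential. The sign identities left over
    -- are ij + j ≡ (i - 1)j modulo 2 and ij = i + i(j - 1).
    rw [add_comm]
    congr 2
    · rw [← Int.negOnePow_add, Int.negOnePow_eq_iff]
      exact ⟨j, by ring⟩
    · rw [← Int.negOnePow_add, Int.negOnePow_eq_iff]
      exact ⟨0, by ring⟩

@[simp]
theorem tι_braidHom (K L : ChainComplex A ℤ) (i j n : ℤ) (h : i + j = n) :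
    tι K L i j n h ≫ (braidHom K L).f n = (i * j).negOnePow • ((β_ (K.X i) (L.X j)).hom ≫
      tι L K j i n (by rw [add_comm, h])) :=
  tι_desc (fun i j h => (i * j).negOnePow • ((β_ (K.X i) (L.X j)).hom ≫
    tι L K j i n (by rw [add_comm, h]))) i j h

theorem braidHom_braidHom (K L : ChainComplex A ℤ) : braidHom K L ≫ braidHom L K = 𝟙 _ := by
  ext n
  apply tι_hom_ext
  intro i j h
  rw [HomologicalComplex.comp_f, ← Category.assoc, tι_braidHom, Linear.units_smul_comp,
    Category.assoc, tι_braidHom, Linear.comp_units_smul, smul_smul, mul_comm i j,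
    Int.units_mul_self, one_smul, SymmetricCategory.symmetry_assoc, HomologicalComplex.id_f,
    Category.comp_id]

theorem braidHom_naturality_left {K K' : ChainComplex A ℤ} (f : K ⟶ K') (L : ChainComplex A ℤ) :
    f ▷ L ≫ (braidHom K' L) = braidHom K L ≫ L ◁ f := by
  ext n
  apply tι_hom_ext
  intro i j h
  rw [HomologicalComplex.comp_f, HomologicalComplex.comp_f, ← Category.assoc, ← Category.assoc,
    tι_whiskerRight, tι_braidHom, Category.assoc, tι_braidHom, Linear.units_smul_comp,
    Linear.comp_units_smul, Category.assoc, tι_whiskerLeft,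
    BraidedCategory.braiding_naturality_left_assoc]

theorem braidHom_naturality_right (K : ChainComplex A ℤ) {L L' : ChainComplex A ℤ} (f : L ⟶ L') :
    K ◁ f ≫ (braidHom K L') = braidHom K L ≫ f ▷ K := by
  ext n
  apply tι_hom_ext
  intro i j h
  rw [HomologicalComplex.comp_f, HomologicalComplex.comp_f, ← Category.assoc, ← Category.assoc,
    tι_whiskerLeft, tι_braidHom, Category.assoc, tι_braidHom, Linear.units_smul_comp,
    Linear.comp_units_smul, Category.assoc, tι_whiskerRight,
    BraidedCategory.braiding_naturality_right_assoc]

/-- On K_i ⊗ L_j ⊗ M_k one side carries the sign (-1)^{i(j+k)} and the other (-1)^{ij} (-1)^{ik}.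
These agree, and what is left is the hexagon of the base category. -/
theorem hexagon (K L M : ChainComplex A ℤ) :
    (α_ K L M).hom ≫ braidHom K (L ⊗ M) ≫ (α_ L M K).hom =
      braidHom K L ▷ M ≫ (α_ L K M).hom ≫ L ◁ braidHom K M := by
  ext n
  apply tι_hom_ext₃
  intro i j k a ha h
  simp only [HomologicalComplex.comp_f]
  have e1 := tι_associator K L M i j k a (j + k) n ha rfl h (by lia)
  have e2 := tι_associator L M K j k i (j + k) (k + i) n rfl rfl (by lia) (by lia)
  have e3 := tι_associator L K M j i k a (k + i) n (by lia) (by lia) h (by lia)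
  have b1 := tι_braidHom K (L ⊗ M) i (j + k) n (by lia)
  have b2 := tι_braidHom K L i j a ha
  have b3 := tι_braidHom K M i k (k + i) (by lia)
  have w1 := tι_whiskerRight (braidHom K L) M a k n h
  have w2 := tι_whiskerLeft L (braidHom K M) j (k + i) n (by lia)
  have s : (i * (j + k)).negOnePow = (i * j).negOnePow * (i * k).negOnePow := by
    rw [mul_add, Int.negOnePow_add]
  rw [reassoc_of% e1, reassoc_of% b1, reassoc_of% w1, ← comp_whiskerRight_assoc, b2]
  simp only [Linear.units_smul_comp, Linear.comp_units_smul, Category.assoc,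
    units_smul_whiskerRight, comp_whiskerRight,
    BraidedCategory.braiding_naturality_right_assoc, s, mul_smul]
  rw [reassoc_of% e3, w2, e2, ← whiskerLeft_comp_assoc, b3, whiskerLeft_units_smul]
  simp only [Linear.units_smul_comp, Linear.comp_units_smul, Category.assoc,
    MonoidalCategory.whiskerLeft_comp, BraidedCategory.hexagon_forward_assoc]

/-- The symmetry, as an isomorphism. -/
def braidIso (K L : ChainComplex A ℤ) : K ⊗ L ≅ L ⊗ K :=
  ⟨braidHom K L, braidHom L K, braidHom_braidHom K L, braidHom_braidHom L K⟩

instance : SymmetricCategory (ChainComplex A ℤ) where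
  braiding := braidIso
  braiding_naturality_right K _ _ f := braidHom_naturality_right K f
  braiding_naturality_left f L := braidHom_naturality_left f L
  hexagon_forward K L M := hexagon K L M
  hexagon_reverse K L M := by
    -- The symmetry is its own inverse, so the second hexagon is the inverse of the first one for
    -- (M, K, L).
    have h : α_ M K L ≪≫ braidIso M (K ⊗ L) ≪≫ α_ K L M =
        whiskerRightIso (braidIso M K) L ≪≫ α_ K M L ≪≫ whiskerLeftIso K (braidIso M L) :=
      Iso.ext (hexagon M K L)
    have h' := congrArg Iso.inv h
    simp only [Iso.trans_inv, whiskerRightIso_inv, whiskerLeftIso_inv, Category.assoc] at h'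
    exact h'
  symmetry K L := braidHom_braidHom K L

theorem tι_braiding (K L : ChainComplex A ℤ) (i j n : ℤ) (h : i + j = n) :
    tι K L i j n h ≫ (β_ K L).hom.f n = (i * j).negOnePow • ((β_ (K.X i) (L.X j)).hom ≫
      tι L K j i n (by rw [add_comm, h])) :=
  tι_braidHom K L i j n h

end Braiding


end DGTensor

/-! ### The internal hom of complexes -/

namespace DGTensor
universe v u

section Closed

variable {A : Type u} [Category.{v} A] [Preadditive A] [MonoidalCategory A] [MonoidalPreadditive A]
  [HasZeroObject A] [HasColimitsOfSize.{0, 0} A] [HasProductsOfShape ℤ A]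
  [∀ X : A, PreservesColimitsOfSize.{0, 0} ((curriedTensor A).obj X)]
  [∀ X : A, PreservesColimitsOfSize.{0, 0} ((curriedTensor A).flip.obj X)]

section Graded

variable {H : A → A ⥤ A} (adj : ∀ X : A, tensorLeft X ⊣ H X)

/-- The module `∏ i, H (K i) (L (i + n))` of graded maps of degree `n`. -/
def homX (K L : ChainComplex A ℤ) (n : ℤ) : A :=
  ∏ᶜ fun i : ℤ => (H (K.X i)).obj (L.X (i + n))

/-- The component `K_i ⊗ hom(K, L)_n ⟶ L_j` of the evaluation, where `i + n = j`. -/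
def homEv (K L : ChainComplex A ℤ) (i n j : ℤ) (h : i + n = j) :
    K.X i ⊗ homX (H := H) K L n ⟶ L.X j :=
  ((adj (K.X i)).homEquiv _ _).symm (Pi.π _ i) ≫ (L.XIsoOfEq h).hom

/-- The map into `hom(K, L)_n` with given adjoint components. -/
def homLift {K L : ChainComplex A ℤ} {n : ℤ} {T : A}
    (f : ∀ (i j : ℤ) (_ : i + n = j), K.X i ⊗ T ⟶ L.X j) : T ⟶ homX (H := H) K L n :=
  Pi.lift fun i => (adj (K.X i)).homEquiv _ _ (f i (i + n) rfl)

@[simp]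
theorem homLift_homEv {K L : ChainComplex A ℤ} {n : ℤ} {T : A}
    (f : ∀ (i j : ℤ) (_ : i + n = j), K.X i ⊗ T ⟶ L.X j) (i j : ℤ) (h : i + n = j) :
    K.X i ◁ homLift adj f ≫ homEv adj K L i n j h = f i j h := by
  subst h
  have h1 := (adj (K.X i)).homEquiv_naturality_left_symm (homLift adj f)
    (Pi.π (fun i : ℤ => (H (K.X i)).obj (L.X (i + n))) i)
  have h2 : homLift adj f ≫ Pi.π (fun i : ℤ => (H (K.X i)).obj (L.X (i + n))) i =
    (adj (K.X i)).homEquiv _ _ (f i (i + n) rfl) := limit.lift_π _ _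
  rw [h2, Equiv.symm_apply_apply] at h1
  refine Eq.trans ?_ h1.symm
  simp only [homEv, HomologicalComplex.XIsoOfEq_rfl, Iso.refl_hom]
  exact congrArg (_ ≫ ·) (Category.comp_id _)

theorem homX_hom_ext {K L : ChainComplex A ℤ} {n : ℤ} {T : A} {f g : T ⟶ homX (H := H) K L n}
    (w : ∀ (i j : ℤ) (h : i + n = j),
      K.X i ◁ f ≫ homEv adj K L i n j h = K.X i ◁ g ≫ homEv adj K L i n j h) : f = g := by
  refine limit.hom_ext fun ⟨i⟩ => ((adj (K.X i)).homEquiv _ _).symm.injective ?_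
  have := w i (i + n) rfl
  simp only [homEv, HomologicalComplex.XIsoOfEq_rfl, Iso.refl_hom, Category.comp_id] at this
  refine ((adj (K.X i)).homEquiv_naturality_left_symm f _).trans
    (Eq.trans ?_ ((adj (K.X i)).homEquiv_naturality_left_symm g _).symm)
  exact this

/-- The differential of the internal hom, for which evaluation is a map of complexes. -/
def homD (K L : ChainComplex A ℤ) (n n' : ℤ) : homX (H := H) K L n ⟶ homX (H := H) K L n' :=
  -- The sign is forced by the order K ⊗ hom(K, L): evaluation is a map of complexes iff d(f x) =
  -- f(d x) + (-1)^i (d f)(x) for x in K_i.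
  homLift adj fun i j h => i.negOnePow • (homEv adj K L i n (i + n) rfl ≫ L.d (i + n) j -
    K.d i (j - n) ▷ _ ≫ homEv adj K L (j - n) n j (by lia))

theorem homD_homEv (K L : ChainComplex A ℤ) (i' i n' n j' j : ℤ) (hi : i' + 1 = i)
    (hn : n' + 1 = n) (hj : j' + 1 = j) (h : i + n = j) :
    K.X i ◁ homD adj K L n n' ≫ homEv adj K L i n' j' (by lia) =
      i.negOnePow • (homEv adj K L i n j h ≫ L.d j j' -
        K.d i i' ▷ _ ≫ homEv adj K L i' n j' (by lia)) := by
  obtain rfl : i' = j' - n := by lia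
  subst h
  exact homLift_homEv adj _ _ _ _

theorem homD_shape (K L : ChainComplex A ℤ) (n n' : ℤ) (h : n' + 1 ≠ n) :
    homD adj K L n n' = 0 := by
  apply homX_hom_ext adj
  intro i j hj
  rw [homD, homLift_homEv, L.shape _ _ (by change ¬ (j + 1 = i + n); lia),
    K.shape _ _ (by change ¬ (j - n + 1 = i); lia)]
  simp

/-- Since (-1)^{i-1} = -(-1)^i, the two mixed terms, with one differential on each side of f,
cancel. The other terms contain d d. -/
theorem homD_comp_homD (K L : ChainComplex A ℤ) (n n' n'' : ℤ) (h : n' + 1 = n)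
    (h' : n'' + 1 = n') : homD adj K L n n' ≫ homD adj K L n' n'' = 0 := by
  apply homX_hom_ext adj
  intro i j hj
  have e0 := homD_homEv adj K L (i - 1) i n'' n' j (j + 1) (by lia) h' rfl (by lia)
  have e1 := homD_homEv adj K L (i - 1) i n' n (j + 1) (j + 2) (by lia) h (by lia) (by lia)
  have e2 := homD_homEv adj K L (i - 1 - 1) (i - 1) n' n j (j + 1) (by lia) h (by lia) (by lia)
  have s : (i - 1).negOnePow = - i.negOnePow := by rw [Int.negOnePow_sub]; simp
  rw [whiskerLeft_comp_assoc, e0]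
  simp only [Linear.comp_units_smul, Preadditive.comp_sub, reassoc_of% e1, Linear.units_smul_comp,
    whisker_exchange_assoc, e2, s]
  simp only [Preadditive.sub_comp, Category.assoc, HomologicalComplex.d_comp_d, comp_zero,
    zero_sub, ← comp_whiskerRight_assoc, MonoidalPreadditive.zero_whiskerRight, zero_comp,
    MonoidalPreadditive.whiskerLeft_zero]
  simp

/-- The internal hom of complexes. -/
def homComplex (K L : ChainComplex A ℤ) : ChainComplex A ℤ where
  X n := homX (H := H) K L n
  d n n' := homD adj K L n n'
  shape n n' h := homD_shape adj K L n n' h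
  d_comp_d' n n' n'' h h' := homD_comp_homD adj K L n n' n'' h h'

/-- The component `K_i ⊗ hom(K, L)_n ⟶ L_j` of the evaluation, where `i + n = j`. -/
def hev (K L : ChainComplex A ℤ) (i n j : ℤ) (h : i + n = j) :
    K.X i ⊗ (homComplex adj K L).X n ⟶ L.X j :=
  homEv adj K L i n j h

/-- The map into `hom(K, L)_n` with given adjoint components. -/
def hlift {K L : ChainComplex A ℤ} {n : ℤ} {T : A}
    (f : ∀ (i j : ℤ) (_ : i + n = j), K.X i ⊗ T ⟶ L.X j) : T ⟶ (homComplex adj K L).X n :=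
  homLift adj f

@[simp]
theorem hlift_hev {K L : ChainComplex A ℤ} {n : ℤ} {T : A}
    (f : ∀ (i j : ℤ) (_ : i + n = j), K.X i ⊗ T ⟶ L.X j) (i j : ℤ) (h : i + n = j) :
    K.X i ◁ hlift adj f ≫ hev adj K L i n j h = f i j h :=
  homLift_homEv adj f i j h

theorem hev_ext {K L : ChainComplex A ℤ} {n : ℤ} {T : A} {f g : T ⟶ (homComplex adj K L).X n}
    (w : ∀ (i j : ℤ) (h : i + n = j),
      K.X i ◁ f ≫ hev adj K L i n j h = K.X i ◁ g ≫ hev adj K L i n j h) : f = g :=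
  homX_hom_ext adj w

theorem d_hev (K L : ChainComplex A ℤ) (i' i n' n j' j : ℤ) (hi : i' + 1 = i)
    (hn : n' + 1 = n) (hj : j' + 1 = j) (h : i + n = j) :
    K.X i ◁ (homComplex adj K L).d n n' ≫ hev adj K L i n' j' (by lia) =
      i.negOnePow • (hev adj K L i n j h ≫ L.d j j' -
        K.d i i' ▷ _ ≫ hev adj K L i' n j' (by lia)) :=
  homD_homEv adj K L i' i n' n j' j hi hn hj h

/-- The map `T ⟶ hom(K, L)` adjoint to a map `K ⊗ T ⟶ L`. -/
def homCurry {K T L : ChainComplex A ℤ} (φ : K ⊗ T ⟶ L) : T ⟶ homComplex adj K L where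
  f n := hlift adj fun i j h => tι K T i n j h ≫ φ.f j
  comm' n n' hn := by
    change n' + 1 = n at hn
    apply hev_ext adj
    intro i j h
    have e := d_hev adj K L (i - 1) i n' n j (j + 1) (by lia) hn rfl (by lia)
    have t := tι_d K T i n (j + 1) (i - 1) n' j (by lia) (by lia) hn rfl
    rw [whiskerLeft_comp_assoc, whiskerLeft_comp_assoc]
    refine (congrArg (_ ≫ ·) e).trans ?_
    simp only [Linear.comp_units_smul, Preadditive.comp_sub, whisker_exchange_assoc]
    rw [reassoc_of% (hlift_hev adj (fun i j h => tι K T i n j h ≫ φ.f j) i (j + 1)),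
      hlift_hev, hlift_hev, φ.comm, reassoc_of% t]
    simp [smul_smul]

/-- The map `K ⊗ T ⟶ L` adjoint to a map `T ⟶ hom(K, L)`. -/
def homUncurry {K T L : ChainComplex A ℤ} (ψ : T ⟶ homComplex adj K L) : K ⊗ T ⟶ L where
  f m := tDesc fun i n h => K.X i ◁ ψ.f n ≫ hev adj K L i n m h
  comm' m m' hm := by
    change m' + 1 = m at hm
    apply tι_hom_ext
    intro i n h
    have e := d_hev adj K L (i - 1) i (n - 1) n m' m (by lia) (by lia) hm h
    have t := tι_d K T i n m (i - 1) (n - 1) m' h (by lia) (by lia) hm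
    rw [reassoc_of% t, ← Category.assoc, tι_desc]
    simp only [Preadditive.add_comp, Linear.units_smul_comp, Category.assoc, tι_desc]
    rw [← whiskerLeft_comp_assoc, ← ψ.comm, whiskerLeft_comp_assoc]
    refine Eq.trans ?_ (congrArg (fun z => _ + i.negOnePow • (_ ≫ z)) e).symm
    simp only [Linear.comp_units_smul, Preadditive.comp_sub, whisker_exchange_assoc, smul_smul,
      Int.units_mul_self, one_smul]
    simp

/-- Maps `K ⊗ T ⟶ L` correspond to maps `T ⟶ hom(K, L)`. -/
def homEquiv (K T L : ChainComplex A ℤ) : (K ⊗ T ⟶ L) ≃ (T ⟶ homComplex adj K L) where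
  toFun := homCurry adj
  invFun := homUncurry adj
  left_inv φ := by
    ext m
    apply tι_hom_ext
    intro i n h
    exact (tι_desc (fun i n h => K.X i ◁ (homCurry adj φ).f n ≫ hev adj K L i n m h) i n h).trans
      (hlift_hev adj (fun i m h => tι K T i n m h ≫ φ.f m) i m h)
  right_inv ψ := by
    ext n
    apply hev_ext adj
    intro i m h
    exact (hlift_hev adj (fun i m h => tι K T i n m h ≫ (homUncurry adj ψ).f m) i m h).trans
      (tι_desc (fun i n h => K.X i ◁ ψ.f n ≫ hev adj K L i n m h) i n h)

theorem homCurry_naturality {K T T' L : ChainComplex A ℤ} (f : T ⟶ T') (φ : K ⊗ T' ⟶ L) :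
    homCurry adj (K ◁ f ≫ φ) = f ≫ homCurry adj φ := by
  ext n
  apply hev_ext adj
  intro i m h
  refine (hlift_hev adj (fun i m h => tι K T i n m h ≫ (K ◁ f ≫ φ).f m) i m h).trans ?_
  rw [HomologicalComplex.comp_f, HomologicalComplex.comp_f, whiskerLeft_comp_assoc]
  refine Eq.trans ?_ (congrArg (K.X i ◁ f.f n ≫ ·)
    (hlift_hev adj (fun i m h => tι K T' i n m h ≫ φ.f m) i m h).symm)
  rw [← Category.assoc, tι_whiskerLeft, Category.assoc]

/-- The internal hom is right adjoint to the tensor product. -/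
abbrev homAdjunction (K : ChainComplex A ℤ) :
    tensorLeft K ⊣ Adjunction.rightAdjointOfEquiv (F := tensorLeft K)
      (fun T L => (homEquiv adj K T L)) (fun _ _ _ f φ => homCurry_naturality adj f φ) :=
  Adjunction.adjunctionOfEquivRight _ _

/-- The closed structure on complexes. -/
abbrev monoidalClosed : MonoidalClosed (ChainComplex A ℤ) where
  closed K := { rightAdj := _, adj := homAdjunction adj K }

theorem tι_ev (K L : ChainComplex A ℤ) (i n j : ℤ) (h : i + n = j) :
    letI := monoidalClosed adj
    tι K ((ihom K).obj L) i n j h ≫ ((ihom.ev K).app L).f j = hev adj K L i n j h := by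
  refine (tι_desc (fun i n h => K.X i ◁ (𝟙 ((homComplex adj K L).X n)) ≫
    hev adj K L i n j h) i n h).trans ?_
  rw [whiskerLeft_id, Category.id_comp]

/-- The transposed components of the evaluation are equal to the projections of the product by which
the internal hom was defined. -/
theorem isLimit_homComponent (K L : ChainComplex A ℤ) (n : ℤ) :
    letI := monoidalClosed adj
    Nonempty (IsLimit (Fan.mk (((ihom K).obj L).X n) fun i => (adj (K.X i)).homEquiv _ _
      (tι K ((ihom K).obj L) i n (i + n) rfl ≫ ((ihom.ev K).app L).f (i + n)))) := by
  let _ := monoidalClosed adj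
  have h : (fun i => (adj (K.X i)).homEquiv _ _
      (tι K ((ihom K).obj L) i n (i + n) rfl ≫ ((ihom.ev K).app L).f (i + n))) =
      fun i => Pi.π (fun i : ℤ => (H (K.X i)).obj (L.X (i + n))) i := by
    funext i
    rw [tι_ev]
    simp only [hev, homEv, HomologicalComplex.XIsoOfEq_rfl, Iso.refl_hom, Category.comp_id]
    exact Equiv.apply_symm_apply _ _
  rw [h]
  exact ⟨productIsProduct _⟩

end Graded

end Closed
end DGTensor

/-! ### Deformation retracts and degreewise split epimorphisms -/

namespace DGModel
universe v u

variable {A : Type u} [Category.{v} A] [Preadditive A]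

/-- Maps of complexes which are split epimorphisms in each degree. -/
def degreewiseSplitEpi : MorphismProperty (ChainComplex A ℤ) := fun E B p =>
  ∃ s : ∀ n, B.X n ⟶ E.X n, ∀ n, s n ≫ p.f n = 𝟙 _

/-- `f` admits a retraction `r` such that `r ≫ f` is homotopic to the identity. -/
def IsDeformationRetract {K L : ChainComplex A ℤ} (f : K ⟶ L) : Prop :=
  ∃ r : L ⟶ K, f ≫ r = 𝟙 K ∧ Nonempty (Homotopy (r ≫ f) (𝟙 L))

/-- Put e = r ≫ f - 1, which is the boundary of the homotopy h, and let s be a degreewise section of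
p. The lift is r ≫ u plus the boundary of e ≫ h ≫ w ≫ s. It restricts to u because f ≫ e = 0, and it
covers w because e ≫ e = -e. The extra factor e replaces the requirement that h vanish on K. -/
theorem IsDeformationRetract.llp {K L : ChainComplex A ℤ} {f : K ⟶ L}
    (hf : IsDeformationRetract f) : (degreewiseSplitEpi (A := A)).llp f := by
  obtain ⟨r, hr, ⟨h⟩⟩ := hf
  rintro E B p ⟨s, hs⟩
  refine ⟨fun {u w} sq => ?_⟩
  set N : L ⟶ L := Homotopy.nullHomotopicMap h.hom with hN
  have hc : r ≫ f = N + 𝟙 L := by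
    ext i
    exact h.comm i
  set t : ∀ i j, L.X i ⟶ E.X j := fun i j => (r ≫ f - 𝟙 L).f i ≫ h.hom i j ≫ w.f j ≫ s j with ht
  have e1 : Homotopy.nullHomotopicMap t ≫ p = (r ≫ f - 𝟙 L) ≫ N ≫ w := by
    rw [hN, Homotopy.nullHomotopicMap_comp, Homotopy.nullHomotopicMap_comp,
      Homotopy.comp_nullHomotopicMap]
    congr 1
    funext i j
    simp [ht, hs]
  have e2 : f ≫ Homotopy.nullHomotopicMap t = 0 := by
    have e : f ≫ (r ≫ f - 𝟙 L) = 0 := by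
      rw [Preadditive.comp_sub, reassoc_of% hr, Category.comp_id, sub_self]
    have e' : ∀ i, f.f i ≫ (r ≫ f - 𝟙 L).f i = 0 := fun i => by
      rw [← HomologicalComplex.comp_f, e, HomologicalComplex.zero_f]
    rw [Homotopy.comp_nullHomotopicMap]
    have : (fun i j => f.f i ≫ t i j) = fun i j => 0 := by
      funext i j
      simp only [ht]
      rw [reassoc_of% (e' i), zero_comp]
    rw [this]
    ext i
    simp [Homotopy.nullHomotopicMap, dNext, prevD]
  have hNe : N = r ≫ f - 𝟙 L := by rw [hc, add_sub_cancel_right]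
  refine ⟨⟨⟨r ≫ u + Homotopy.nullHomotopicMap t, ?_, ?_⟩⟩⟩
  · rw [Preadditive.comp_add, e2, reassoc_of% hr, add_zero]
  · rw [Preadditive.add_comp, e1, hNe, Category.assoc, sq.w]
    simp [reassoc_of% hr]

/-! ### Shifted path complexes and the lifting of homotopies -/

section Path

variable [HasBinaryBiproducts A]

section

variable {E B : ChainComplex A ℤ} (p : E ⟶ B) (n : ℤ)

/-- The degree `m` part of the shifted mapping path complex of `p`. -/
abbrev pathX (E B : ChainComplex A ℤ) (n m : ℤ) : A := B.X (m + n) ⊞ E.X (m + n - 1)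

variable {n}

/-- The projection to the first component. -/
def pathFst (E B : ChainComplex A ℤ) {n m : ℤ} (k : ℤ) (h : m + n = k) : pathX E B n m ⟶ B.X k :=
  biprod.fst ≫ (B.XIsoOfEq h).hom

/-- The projection to the second component. -/
def pathSnd (E B : ChainComplex A ℤ) {n m : ℤ} (k : ℤ) (h : m + n = k + 1) :
    pathX E B n m ⟶ E.X k :=
  biprod.snd ≫ (E.XIsoOfEq (by lia)).hom

/-- The map with given components. -/
def pathLift {T : A} {m k l : ℤ} (h : m + n = k) (h' : m + n = l + 1) (b : T ⟶ B.X k)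
    (e : T ⟶ E.X l) : T ⟶ pathX E B n m :=
  biprod.lift (b ≫ (B.XIsoOfEq h).inv) (e ≫ (E.XIsoOfEq (by lia)).inv)

@[simp]
theorem pathLift_fst {T : A} {m k l : ℤ} (h : m + n = k) (h' : m + n = l + 1) (b : T ⟶ B.X k)
    (e : T ⟶ E.X l) : pathLift h h' b e ≫ pathFst E B k h = b := by
  simp [pathLift, pathFst]

@[simp]
theorem pathLift_snd {T : A} {m k l : ℤ} (h : m + n = k) (h' : m + n = l + 1) (b : T ⟶ B.X k)
    (e : T ⟶ E.X l) : pathLift h h' b e ≫ pathSnd E B l h' = e := by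
  simp [pathLift, pathSnd]

theorem path_ext {T : A} {m k l : ℤ} (h : m + n = k) (h' : m + n = l + 1)
    {f g : T ⟶ pathX E B n m} (h₁ : f ≫ pathFst E B k h = g ≫ pathFst E B k h)
    (h₂ : f ≫ pathSnd E B l h' = g ≫ pathSnd E B l h') : f = g := by
  apply biprod.hom_ext
  · rw [← cancel_mono (B.XIsoOfEq h).hom]
    simpa [pathFst] using h₁
  · rw [← cancel_mono (E.XIsoOfEq (show m + n - 1 = l by lia)).hom]
    simpa [pathSnd] using h₂

/-- The differential `(b, e) ↦ (d b - p e, - d e)`. -/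
def pathD (m m' : ℤ) : pathX E B n m ⟶ pathX E B n m' :=
  if h : m' + 1 = m then
    pathLift (k := m' + n) (l := m' + n - 1) rfl (by lia)
      (pathFst E B (m + n) rfl ≫ B.d _ _ - pathSnd E B (m' + n) (by lia) ≫ p.f _)
      (- pathSnd E B (m' + n) (by lia) ≫ E.d _ _)
  else 0

theorem pathD_fst {m m' k' k : ℤ} (h : m' + 1 = m) (hk : k' + 1 = k) (h' : m + n = k) :
    pathD p m m' ≫ pathFst E B k' (by lia) =
      pathFst E B k h' ≫ B.d k k' - pathSnd E B k' (by lia) ≫ p.f k' := by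
  obtain rfl : k' = m' + n := by lia
  subst h'
  rw [pathD, dif_pos h, pathLift_fst]

theorem pathD_snd {m m' k' k : ℤ} (h : m' + 1 = m) (hk : k' + 1 = k) (h' : m + n = k + 1) :
    pathD p m m' ≫ pathSnd E B k' (by lia) = - pathSnd E B k h' ≫ E.d k k' := by
  obtain rfl : k = m' + n := by lia
  obtain rfl : k' = m' + n - 1 := by lia
  rw [pathD, dif_pos h, pathLift_snd]

variable (n) in
/-- The shifted mapping path complex of `p`: in degree `m` it consists of the pairs `(b, e)` with
`b ∈ B_{m + n}` and `e ∈ E_{m + n - 1}`, and `d (b, e) = (d b - p e, - d e)`. -/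
def pathComplex : ChainComplex A ℤ where
  X m := pathX E B n m
  d m m' := pathD p m m'
  shape m m' h := dif_neg h
  d_comp_d' m m' m'' h h' := by
    change m' + 1 = m at h
    change m'' + 1 = m' at h'
    apply path_ext (k := m'' + n) (l := m'' + n - 1) rfl (by lia)
    · rw [Category.assoc, pathD_fst p h' (k' := m'' + n) (k := m' + n) (by lia) rfl,
        Preadditive.comp_sub,
        ← Category.assoc, pathD_fst p h (k' := m' + n) (k := m + n) (by lia) rfl, ← Category.assoc,
        pathD_snd p h (k' := m'' + n) (k := m' + n) (by lia) (by lia)]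
      simp
    · rw [Category.assoc, pathD_snd p h' (k' := m'' + n - 1) (k := m'' + n) (by lia) (by lia),
        Preadditive.comp_neg,
        ← Category.assoc, pathD_snd p h (k' := m'' + n) (k := m' + n) (by lia) (by lia)]
      simp

/-- The projection `(b, e) ↦ b`. -/
def pfst {m : ℤ} (k : ℤ) (h : m + n = k) : (pathComplex p n).X m ⟶ B.X k := pathFst E B k h

/-- The projection `(b, e) ↦ e`. -/
def psnd {m : ℤ} (k : ℤ) (h : m + n = k + 1) : (pathComplex p n).X m ⟶ E.X k := pathSnd E B k h

/-- The map with given components. -/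
def plift {T : A} {m k l : ℤ} (h : m + n = k) (h' : m + n = l + 1) (b : T ⟶ B.X k)
    (e : T ⟶ E.X l) : T ⟶ (pathComplex p n).X m := pathLift h h' b e

@[simp]
theorem plift_fst {T : A} {m k l : ℤ} (h : m + n = k) (h' : m + n = l + 1) (b : T ⟶ B.X k)
    (e : T ⟶ E.X l) : plift p h h' b e ≫ pfst p k h = b := pathLift_fst h h' b e

@[simp]
theorem plift_snd {T : A} {m k l : ℤ} (h : m + n = k) (h' : m + n = l + 1) (b : T ⟶ B.X k)
    (e : T ⟶ E.X l) : plift p h h' b e ≫ psnd p l h' = e := pathLift_snd h h' b e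

theorem pcomplex_ext {T : A} {m k l : ℤ} (h : m + n = k) (h' : m + n = l + 1)
    {f g : T ⟶ (pathComplex p n).X m} (h₁ : f ≫ pfst p k h = g ≫ pfst p k h)
    (h₂ : f ≫ psnd p l h' = g ≫ psnd p l h') : f = g := path_ext h h' h₁ h₂

theorem pd_fst {m m' k' k : ℤ} (h : m' + 1 = m) (hk : k' + 1 = k) (h' : m + n = k) :
    (pathComplex p n).d m m' ≫ pfst p k' (by lia) =
      pfst p k h' ≫ B.d k k' - psnd p k' (by lia) ≫ p.f k' := pathD_fst p h hk h'

theorem pd_snd {m m' k' k : ℤ} (h : m' + 1 = m) (hk : k' + 1 = k) (h' : m + n = k + 1) :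
    (pathComplex p n).d m m' ≫ psnd p k' (by lia) = - psnd p k h' ≫ E.d k k' :=
  pathD_snd p h hk h'

/-- The map of complexes `X ⟶ pathComplex p n` with given components. -/
def toPath {X : ChainComplex A ℤ} (b : ∀ m k (_ : m + n = k), X.X m ⟶ B.X k)
    (e : ∀ m l (_ : m + n = l + 1), X.X m ⟶ E.X l)
    (hb : ∀ (m m' k k' : ℤ) (h : m + n = k) (_ : m' + 1 = m) (_ : k' + 1 = k),
      X.d m m' ≫ b m' k' (by lia) = b m k h ≫ B.d k k' - e m k' (by lia) ≫ p.f k')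
    (he : ∀ (m m' k k' : ℤ) (h : m + n = k + 1) (_ : m' + 1 = m) (_ : k' + 1 = k),
      X.d m m' ≫ e m' k' (by lia) = - e m k h ≫ E.d k k') : X ⟶ pathComplex p n where
  f m := plift p (k := m + n) (l := m + n - 1) rfl (by omega) (b m _ rfl) (e m _ (by omega))
  comm' m m' h := by
    change m' + 1 = m at h
    obtain ⟨k, hk⟩ : ∃ k, m + n = k + 1 := ⟨m + n - 1, by omega⟩
    obtain ⟨l, hl⟩ : ∃ l, k = l + 1 := ⟨k - 1, by omega⟩
    have hf : ∀ (m k l : ℤ) (h : m + n = k) (h' : m + n = l + 1),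
        plift p (k := m + n) (l := m + n - 1) rfl (by omega) (b m _ rfl) (e m _ (by omega)) =
          plift p h h' (b m k h) (e m l h') := by
      intro m k l h h'
      subst h
      obtain rfl : l = m + n - 1 := by omega
      rfl
    rw [hf m (k + 1) k (by omega) (by omega), hf m' k l (by omega) (by omega)]
    have h1 := hb m m' (k + 1) k (by omega) h rfl
    have h2 := he m m' k l (by omega) h (by omega)
    have h3 := pd_fst p h (k' := k) (k := k + 1) (by omega) (by omega)
    have h4 := pd_snd p h (k' := l) (k := k) (by omega) (by omega)
    apply pcomplex_ext p (k := k) (l := l) (by omega) (by omega)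
    · rw [Category.assoc, h3, Category.assoc, plift_fst, h1, Preadditive.comp_sub,
        ← Category.assoc, ← Category.assoc, plift_fst, plift_snd]
    · rw [Category.assoc, h4, Category.assoc, plift_snd, h2, Preadditive.comp_neg,
        ← Category.assoc, plift_snd]

theorem toPath_fst {X : ChainComplex A ℤ} {b e hb he} (m k : ℤ) (h : m + n = k) :
    (toPath p (X := X) b e hb he).f m ≫ pfst p k h = b m k h := by
  subst h
  exact plift_fst p rfl (l := m + n - 1) (by omega) _ _

theorem toPath_snd {X : ChainComplex A ℤ} {b e hb he} (m l : ℤ) (h : m + n = l + 1) :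
    (toPath p (X := X) b e hb he).f m ≫ psnd p l h = e m l h := by
  obtain rfl : l = m + n - 1 := by omega
  exact plift_snd ..

/-- The map `(b, e) ↦ (p b, e)`. -/
def pathMap (n : ℤ) : pathComplex (𝟙 E) n ⟶ pathComplex p n :=
  toPath p (fun m k h => pfst (𝟙 E) k h ≫ p.f k) (fun m l h => psnd (𝟙 E) l h)
    (fun m m' k k' h hm hk => by
      rw [← Category.assoc, pd_fst (𝟙 E) hm hk h]
      simp [Preadditive.sub_comp])
    (fun m m' k k' h hm hk => pd_snd (𝟙 E) hm hk h)

theorem pathMap_fst (m k : ℤ) (h : m + n = k) :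
    (pathMap p n).f m ≫ pfst p k h = pfst (𝟙 E) k h ≫ p.f k := toPath_fst ..

theorem pathMap_snd (m l : ℤ) (h : m + n = l + 1) :
    (pathMap p n).f m ≫ psnd p l h = psnd (𝟙 E) l h := toPath_snd ..

theorem degreewiseSplitEpi_pathMap (hp : degreewiseSplitEpi p) :
    degreewiseSplitEpi (pathMap p n) := by
  obtain ⟨s, hs⟩ := hp
  refine ⟨fun m => plift (𝟙 E) (k := m + n) (l := m + n - 1) rfl (by omega)
    (pfst p _ rfl ≫ s _) (psnd p _ (by omega)), fun m => ?_⟩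
  apply pcomplex_ext p (k := m + n) (l := m + n - 1) rfl (by omega)
  · rw [Category.assoc, pathMap_fst, ← Category.assoc, plift_fst, Category.assoc, hs,
      Category.comp_id, Category.id_comp]
  · rw [Category.assoc, pathMap_snd, plift_snd, Category.id_comp]

/-- Lifting against `pathMap p n` solves a lifting problem for homotopies of degree `n`. -/
theorem exists_homotopyLift {X Y : ChainComplex A ℤ} (j : X ⟶ Y)
    (hj : HasLiftingProperty j (pathMap p n))
    (ψ : ∀ m k (_ : m + n = k), X.X m ⟶ E.X k) (φ : ∀ m k (_ : m + n = k), Y.X m ⟶ B.X k)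
    (θ : ∀ m l (_ : m + n = l + 1), Y.X m ⟶ E.X l)
    (hψφ : ∀ m k h, ψ m k h ≫ p.f k = j.f m ≫ φ m k h)
    (hψ : ∀ (m m' k k' : ℤ) (h : m + n = k) (_ : m' + 1 = m) (_ : k' + 1 = k),
      X.d m m' ≫ ψ m' k' (by omega) = ψ m k h ≫ E.d k k' - j.f m ≫ θ m k' (by omega))
    (hφ : ∀ (m m' k k' : ℤ) (h : m + n = k) (_ : m' + 1 = m) (_ : k' + 1 = k),
      Y.d m m' ≫ φ m' k' (by omega) = φ m k h ≫ B.d k k' - θ m k' (by omega) ≫ p.f k')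
    (hθ : ∀ (m m' k k' : ℤ) (h : m + n = k + 1) (_ : m' + 1 = m) (_ : k' + 1 = k),
      Y.d m m' ≫ θ m' k' (by omega) = - θ m k h ≫ E.d k k') :
    ∃ χ : ∀ m k (_ : m + n = k), Y.X m ⟶ E.X k,
      (∀ m k h, j.f m ≫ χ m k h = ψ m k h) ∧ (∀ m k h, χ m k h ≫ p.f k = φ m k h) ∧
      (∀ (m m' k k' : ℤ) (h : m + n = k) (_ : m' + 1 = m) (_ : k' + 1 = k),
        Y.d m m' ≫ χ m' k' (by omega) = χ m k h ≫ E.d k k' - θ m k' (by omega)) := by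
  -- A map of complexes into `pathComplex p n` is a map b of degree n and a map e of degree n - 1
  -- which anticommutes with d, such that b d = d b - p e. So (ψ, θ j) and (φ, θ) form a square from
  -- j to `pathMap p n`, and the first component of a lift is χ.
  let u : X ⟶ pathComplex (𝟙 E) n := toPath (𝟙 E) ψ (fun m l h => j.f m ≫ θ m l h)
    (fun m m' k k' h hm hk => by
      rw [hψ m m' k k' h hm hk, HomologicalComplex.id_f, Category.comp_id])
    (fun m m' k k' h hm hk => by
      rw [← HomologicalComplex.Hom.comm_assoc, hθ m m' k k' h hm hk]
      simp)
  let v : Y ⟶ pathComplex p n := toPath p φ θ hφ hθ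
  have sq : CommSq u j (pathMap p n) v := ⟨by
    ext m
    obtain ⟨l, hl⟩ : ∃ l, m + n = l + 1 := ⟨m + n - 1, by omega⟩
    rw [HomologicalComplex.comp_f, HomologicalComplex.comp_f]
    apply pcomplex_ext p (k := m + n) (l := l) rfl hl
    · rw [Category.assoc, Category.assoc, pathMap_fst, ← Category.assoc, toPath_fst, toPath_fst,
        hψφ]
    · rw [Category.assoc, Category.assoc, pathMap_snd, toPath_snd, toPath_snd]⟩
  have e1 : ∀ m, j.f m ≫ sq.lift.f m = u.f m := fun m => by
    rw [← HomologicalComplex.comp_f, sq.fac_left]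
  have e2 : ∀ m, sq.lift.f m ≫ (pathMap p n).f m = v.f m := fun m => by
    rw [← HomologicalComplex.comp_f, sq.fac_right]
  refine ⟨fun m k h => sq.lift.f m ≫ pfst (𝟙 E) k h, fun m k h => ?_, fun m k h => ?_,
    fun m m' k k' h hm hk => ?_⟩
  · rw [reassoc_of% (e1 m), toPath_fst]
  · rw [Category.assoc, ← pathMap_fst, reassoc_of% (e2 m), toPath_fst]
  · have e3 : sq.lift.f m ≫ psnd (𝟙 E) k' (by omega) = θ m k' (by omega) := by
      rw [← pathMap_snd p, reassoc_of% (e2 m), toPath_snd]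
    rw [← HomologicalComplex.Hom.comm_assoc, pd_fst (𝟙 E) hm hk h, Preadditive.comp_sub,
      HomologicalComplex.id_f, Category.comp_id, e3, Category.assoc]

end

/-- The general form of a lift of a null homotopy along `p`: if `g : Y ⟶ E` vanishes on `X` and
becomes zero in `B`, then it is null homotopic by a homotopy which vanishes on `X` and in `B`. -/
theorem exists_nullHomotopy {E B X Y : ChainComplex A ℤ} (p : E ⟶ B) (j : X ⟶ Y)
    (hj : HasLiftingProperty j (pathMap p 1)) (g : Y ⟶ E) (hg : j ≫ g = 0) (hg' : g ≫ p = 0) :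
    Nonempty (Homotopy g 0) := by
  have hgf : ∀ i, j.f i ≫ g.f i = 0 := fun i => by
    rw [← HomologicalComplex.comp_f, hg, HomologicalComplex.zero_f]
  have hgf' : ∀ i, g.f i ≫ p.f i = 0 := fun i => by
    rw [← HomologicalComplex.comp_f, hg', HomologicalComplex.zero_f]
  -- The identity for χ is a commutator with d, while a null homotopy needs an anticommutator. The
  -- factors (-1)^m in θ, and again in the homotopy built from χ, convert one into the other.
  obtain ⟨χ, -, -, h3⟩ := exists_homotopyLift p (n := 1) j hj (fun _ _ _ => 0) (fun _ _ _ => 0)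
    (fun m l h => m.negOnePow • (g.f m ≫ (E.XIsoOfEq (by omega)).hom))
    (by simp)
    (by
      intro m m' k k' h hm hk
      obtain rfl : k' = m := by omega
      simp [hgf])
    (by
      intro m m' k k' h hm hk
      obtain rfl : k' = m := by omega
      simp [hgf'])
    (by
      intro m m' k k' h hm hk
      obtain rfl : k = m := by omega
      obtain rfl : k' = m' := by omega
      subst hm
      simp [Int.negOnePow_succ])
  refine ⟨Homotopy.mk (fun i i' => if h : i + 1 = i' then i.negOnePow • χ i i' h else 0)
    (fun i i' h => dif_neg h) (fun i => ?_)⟩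
  rw [dNext_eq _ (show (ComplexShape.down ℤ).Rel i (i - 1) from by simp),
    prevD_eq _ (show (ComplexShape.down ℤ).Rel (i + 1) i from by simp)]
  have := h3 i (i - 1) (i + 1) i rfl (by omega) rfl
  simp only [HomologicalComplex.XIsoOfEq_rfl, Iso.refl_hom, Category.comp_id] at this
  rw [dif_pos rfl, dif_pos (by omega), Int.negOnePow_sub]
  simp [this, smul_smul, smul_sub]

-- Lifting against K → 0 produces the retraction r. Lifting against the path map of L → 0 produces a
-- null homotopy of r ≫ f - 1, which vanishes on K. Together with `IsDeformationRetract.llp` this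
-- identifies deformation retracts with a left lifting class, so they are closed under pushouts and
-- transfinite compositions.
open ZeroObject in
theorem isDeformationRetract_of_llp {K L : ChainComplex A ℤ} [HasZeroObject A] {f : K ⟶ L}
    (hf : (degreewiseSplitEpi (A := A)).llp f) : IsDeformationRetract f := by
  have h0 : ∀ M : ChainComplex A ℤ, degreewiseSplitEpi (0 : M ⟶ 0) := fun M =>
    ⟨fun n => 0, fun n =>
      (Functor.map_isZero (HomologicalComplex.eval A _ n) (isZero_zero _)).eq_of_src _ _⟩
  have sq : CommSq (𝟙 K) f (0 : K ⟶ 0) (0 : L ⟶ 0) := ⟨by simp⟩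
  have := hf _ (h0 K)
  have e : f ≫ sq.lift = 𝟙 K := sq.fac_left
  refine ⟨sq.lift, e, ?_⟩
  obtain ⟨h⟩ := exists_nullHomotopy (0 : L ⟶ 0) f
    (hf _ (degreewiseSplitEpi_pathMap _ (h0 L))) (sq.lift ≫ f - 𝟙 L)
    (by rw [Preadditive.comp_sub, reassoc_of% e, Category.comp_id]; exact sub_self f) comp_zero
  exact ⟨Homotopy.equivSubZero.symm h⟩

end Path

end DGModel

/-! ### Compact objects, spheres, disks and generating cofibrations -/

namespace DGModel
universe v u

/-- Maps out of `X` commute with filtered colimits. -/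
def IsCompactObj {C : Type u} [Category.{v} C] [Preadditive C] (X : C) : Prop :=
  ∀ (J : Type) [SmallCategory J] [IsFiltered J] (F : J ⥤ C) (c : Cocone F) (_ : IsColimit c),
    (∀ g : X ⟶ c.pt, ∃ j, ∃ g' : X ⟶ F.obj j, g' ≫ c.ι.app j = g) ∧
    (∀ j (g : X ⟶ F.obj j), g ≫ c.ι.app j = 0 → ∃ (k : J) (f : j ⟶ k), g ≫ F.map f = 0)

theorem IsCompactObj.preservesColimit {C : Type u} [Category.{0} C] [Preadditive C] {X : C}
    (hX : IsCompactObj X) {J : Type} [SmallCategory J] [IsFiltered J] (F : J ⥤ C) :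
    PreservesColimit F (coyoneda.obj (Opposite.op X)) where
  preserves {c} hc := by
    obtain ⟨h1, h2⟩ := hX J F c hc
    refine ⟨Types.FilteredColimit.isColimitOf' _ _ ?_ ?_⟩
    · intro g
      obtain ⟨j, g', h⟩ := h1 g
      exact ⟨j, g', h.symm⟩
    · intro j a b hab
      have hab' : (show X ⟶ F.obj j from a) ≫ c.ι.app j = (show X ⟶ F.obj j from b) ≫ c.ι.app j :=
        hab
      obtain ⟨k, f, h⟩ := h2 j ((show X ⟶ F.obj j from a) - (show X ⟶ F.obj j from b)) (by
        rw [Preadditive.sub_comp, hab', sub_self])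
      rw [Preadditive.sub_comp, sub_eq_zero] at h
      exact ⟨k, f, h⟩

section

variable {A : Type u} [Category.{v} A] [Preadditive A] [HasZeroObject A]

/-- The complex with `X` in degree `n`. -/
abbrev sphere (X : A) (n : ℤ) : ChainComplex A ℤ :=
  (HomologicalComplex.single A (ComplexShape.down ℤ) n).obj X

theorem down_rel (n : ℤ) : (ComplexShape.down ℤ).Rel n (n - 1) := by simp

/-- The complex with `X` in degrees `n` and `n - 1`, with the identity as differential. -/
abbrev disk (X : A) (n : ℤ) : ChainComplex A ℤ :=
  HomologicalComplex.double (𝟙 X) (down_rel n)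

theorem ne_sub_one (n : ℤ) : n ≠ n - 1 := by lia

/-- The inclusion of the boundary of a disk. -/
def sphereToDisk (X : A) (n : ℤ) : sphere X (n - 1) ⟶ disk X n :=
  HomologicalComplex.mkHomFromSingle (HomologicalComplex.doubleXIso₁ _ _ (ne_sub_one n)).inv
    (fun k _ => by rw [HomologicalComplex.double_d_eq_zero₀ _ _ _ _ (ne_sub_one n).symm, comp_zero])

/-- The map of complexes from a disk corresponding to an element. -/
def fromDisk {X : A} {n : ℤ} {K : ChainComplex A ℤ} (x : X ⟶ K.X n) : disk X n ⟶ K :=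
  HomologicalComplex.mkHomFromDouble _ (ne_sub_one n) x (x ≫ K.d n (n - 1)) (by simp) (by simp)

theorem fromDisk_f {X : A} {n : ℤ} {K : ChainComplex A ℤ} (x : X ⟶ K.X n) :
    (HomologicalComplex.doubleXIso₀ (𝟙 X) (down_rel n)).inv ≫ (fromDisk x).f n = x := by
  simp [fromDisk]

theorem disk_ext {X : A} {n : ℤ} {K : ChainComplex A ℤ} {f g : disk X n ⟶ K}
    (h : (HomologicalComplex.doubleXIso₀ (𝟙 X) (down_rel n)).inv ≫ f.f n =
      (HomologicalComplex.doubleXIso₀ (𝟙 X) (down_rel n)).inv ≫ g.f n) : f = g :=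
  (HomologicalComplex.evalCompCoyonedaCorepresentableByDoubleId (down_rel n)
    (ne_sub_one n) X).homEquiv.injective h

theorem sphereToDisk_f {X : A} {n : ℤ} {K : ChainComplex A ℤ} (f : disk X n ⟶ K) :
    (HomologicalComplex.singleObjXSelf _ _ X).inv ≫ (sphereToDisk X n ≫ f).f (n - 1) =
    ((HomologicalComplex.doubleXIso₀ (𝟙 X) (down_rel n)).inv ≫ f.f n) ≫ K.d n (n - 1) := by
  rw [Category.assoc, f.comm, HomologicalComplex.double_d _ _ (ne_sub_one n)]
  simp [sphereToDisk]

variable {ι : Type} (P : ι → A)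

/-- The generating cofibrations. -/
def genCof : MorphismProperty (ChainComplex A ℤ) :=
  MorphismProperty.ofHoms fun x : ι × ℤ => sphereToDisk (P x.1) x.2

open ZeroObject in
/-- The generating trivial cofibrations. -/
def genTrivCof : MorphismProperty (ChainComplex A ℤ) :=
  MorphismProperty.ofHoms fun x : ι × ℤ => (0 : 0 ⟶ disk (P x.1) x.2)

/-- The maps `p` such that all maps from the objects `P i` lift degreewise along `p`. -/
def fibs : MorphismProperty (ChainComplex A ℤ) := fun E B p =>
  ∀ (n : ℤ) (i : ι) (x : P i ⟶ B.X n), ∃ z : P i ⟶ E.X n, z ≫ p.f n = x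

/-- The lifting property which characterizes trivial fibrations. -/
def trivFibs : MorphismProperty (ChainComplex A ℤ) := fun E B p =>
  ∀ (n n' : ℤ) (_ : n' + 1 = n) (i : ι) (x : P i ⟶ B.X n) (y : P i ⟶ E.X n'),
    (∀ n'', y ≫ E.d n' n'' = 0) → x ≫ B.d n n' = y ≫ p.f n' →
      ∃ z : P i ⟶ E.X n, z ≫ E.d n n' = y ∧ z ≫ p.f n = x

/-- Maps out of a disk are chains with values on `P i`, and maps out of a sphere are cycles. A
square from the inclusion of a sphere to p is therefore a chain x of B and a cycle y of E with d x =
p y. -/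
theorem genCof_rlp : (genCof P).rlp = trivFibs P := by
  ext E B p
  constructor
  · intro hp n n' hn i x y hy hxy
    obtain rfl : n' = n - 1 := by lia
    have := hp _ (MorphismProperty.ofHoms.mk (f := fun x : ι × ℤ => sphereToDisk (P x.1) x.2) (i, n))
    have sq : CommSq (HomologicalComplex.mkHomFromSingle y (fun k _ => hy k)) (sphereToDisk (P i) n)
        p (fromDisk x) := ⟨by
      apply HomologicalComplex.from_single_hom_ext
      rw [← cancel_epi (HomologicalComplex.singleObjXSelf (.down ℤ) (n - 1) (P i)).inv,
        sphereToDisk_f, fromDisk_f, hxy]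
      simp⟩
    refine ⟨(HomologicalComplex.doubleXIso₀ (𝟙 (P i)) (down_rel n)).inv ≫ sq.lift.f n, ?_, ?_⟩
    · rw [← sphereToDisk_f, sq.fac_left]
      simp
    · rw [Category.assoc, ← HomologicalComplex.comp_f, sq.fac_right, fromDisk_f]
  · rintro hp _ _ _ ⟨i, n⟩
    refine ⟨fun {t b} sq => ?_⟩
    obtain ⟨z, hz, hz'⟩ := hp n (n - 1) (by lia) i
      ((HomologicalComplex.doubleXIso₀ (𝟙 (P i)) (down_rel n)).inv ≫ b.f n)
      ((HomologicalComplex.singleObjXSelf _ _ (P i)).inv ≫ t.f (n - 1))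
      (fun k => by simp)
      (by rw [← sphereToDisk_f, ← sq.w]; simp)
    refine ⟨⟨⟨fromDisk z, ?_, ?_⟩⟩⟩
    · apply HomologicalComplex.from_single_hom_ext
      rw [← cancel_epi (HomologicalComplex.singleObjXSelf (.down ℤ) (n - 1) (P i)).inv,
        sphereToDisk_f, fromDisk_f, hz]
    · apply disk_ext
      rw [HomologicalComplex.comp_f, ← Category.assoc, fromDisk_f, hz']

open ZeroObject in
theorem genTrivCof_rlp : (genTrivCof P).rlp = fibs P := by
  ext E B p
  constructor
  · intro hp n i x
    have := hp _ (MorphismProperty.ofHoms.mk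
      (f := fun x : ι × ℤ => (0 : (0 : ChainComplex A ℤ) ⟶ disk (P x.1) x.2)) (i, n))
    have sq : CommSq (0 : (0 : ChainComplex A ℤ) ⟶ E) (0 : 0 ⟶ disk (P i) n) p (fromDisk x) :=
      ⟨(isZero_zero _).eq_of_src _ _⟩
    refine ⟨(HomologicalComplex.doubleXIso₀ (𝟙 (P i)) (down_rel n)).inv ≫ sq.lift.f n, ?_⟩
    rw [Category.assoc, ← HomologicalComplex.comp_f, sq.fac_right, fromDisk_f]
  · rintro hp _ _ _ ⟨i, n⟩
    refine ⟨fun {t b} sq => ?_⟩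
    obtain ⟨z, hz⟩ := hp n i ((HomologicalComplex.doubleXIso₀ (𝟙 (P i)) (down_rel n)).inv ≫ b.f n)
    refine ⟨⟨⟨fromDisk z, (isZero_zero _).eq_of_src _ _, ?_⟩⟩⟩
    apply disk_ext
    rw [HomologicalComplex.comp_f, ← Category.assoc, fromDisk_f, hz]

/-- First d x is lifted to a cycle y, by prescribing zero as the boundary of y; then x is lifted
with boundary y. -/
theorem trivFibs_le_fibs : trivFibs P ≤ fibs P := by
  intro E B p hp n i x
  obtain ⟨y, hy, hy'⟩ := hp (n - 1) (n - 2) (by lia) i (x ≫ B.d n (n - 1)) 0 (by simp) (by simp)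
  obtain ⟨z, -, hz⟩ := hp n (n - 1) (by lia) i x y (fun k => by
    by_cases hk : k = n - 2
    · rw [hk, hy]
    · rw [E.shape _ _ (by change ¬ (k + 1 = n - 1); lia), comp_zero]) hy'.symm
  exact ⟨z, hz⟩

theorem degreewiseSplitEpi_le_fibs : degreewiseSplitEpi ≤ fibs P := by
  rintro E B p ⟨s, hs⟩ n i x
  exact ⟨x ≫ s n, by rw [Category.assoc, hs, Category.comp_id]⟩

/-- A map out of the sphere is a map x out of X with x ≫ d = 0. It comes from some stage by
compactness of X, and there x ≫ d vanishes in the colimit, hence at a later stage. -/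
theorem IsCompactObj.sphere {X : A} (hX : IsCompactObj X) [HasColimitsOfSize.{0, 0} A] (n : ℤ) :
    IsCompactObj (sphere X n) := by
  intro J _ _ F c hc
  have key : ∀ n : ℤ, (∀ g : X ⟶ c.pt.X n, ∃ j, ∃ g' : X ⟶ (F.obj j).X n,
      g' ≫ (c.ι.app j).f n = g) ∧ (∀ j (g : X ⟶ (F.obj j).X n), g ≫ (c.ι.app j).f n = 0 →
        ∃ (k : J) (f : j ⟶ k), g ≫ (F.map f).f n = 0) := fun n =>
    hX J _ _ (isColimitOfPreserves (HomologicalComplex.eval A (.down ℤ) n) hc)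
  have hn := key n
  have hn' := key (n - 1)
  constructor
  · intro g
    obtain ⟨j, x, hx⟩ := hn.1 ((HomologicalComplex.singleObjXSelf _ _ X).inv ≫ g.f n)
    obtain ⟨k, f, hk⟩ := hn'.2 j (x ≫ (F.obj j).d n (n - 1)) (by
      rw [Category.assoc, ← (c.ι.app j).comm, reassoc_of% hx]
      simp)
    refine ⟨k, HomologicalComplex.mkHomFromSingle (x ≫ (F.map f).f n) ?_, ?_⟩
    · rintro m hm
      obtain rfl : m = n - 1 := by change m + 1 = n at hm; lia
      rw [Category.assoc, (F.map f).comm, ← Category.assoc, hk]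
    · apply HomologicalComplex.from_single_hom_ext
      rw [HomologicalComplex.comp_f, HomologicalComplex.mkHomFromSingle_f, Category.assoc,
        Category.assoc, ← HomologicalComplex.comp_f, c.w, hx]
      simp
  · intro j g hg
    obtain ⟨k, f, hk⟩ := hn.2 j ((HomologicalComplex.singleObjXSelf _ _ X).inv ≫ g.f n) (by
      rw [Category.assoc, ← HomologicalComplex.comp_f, hg]
      simp)
    refine ⟨k, f, ?_⟩
    apply HomologicalComplex.from_single_hom_ext
    rw [← cancel_epi (HomologicalComplex.singleObjXSelf (.down ℤ) n X).inv]
    simpa using hk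

end

/-! ### The projective model structure -/

section Model

variable {A : Type u} [Category.{0} A] [Preadditive A] [HasZeroObject A] [HasBinaryBiproducts A]
  [HasColimitsOfSize.{0, 0} A] {ι : Type} (P : ι → A) (hP : ∀ i, IsCompactObj (P i))

attribute [local instance] Cardinal.fact_isRegular_aleph0 Cardinal.orderBotAleph0OrdToType

include hP

/-- Smallness is required of the sources of the generators only. These are spheres on compact
objects, so countable iterations suffice. -/
theorem isCardinal_genCof : (genCof P).IsCardinalForSmallObjectArgument Cardinal.aleph0.{0} where
  isSmall := inferInstanceAs (MorphismProperty.IsSmall.{0} (MorphismProperty.ofHoms _))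
  hasIterationOfShape := by
    have : HasColimitsOfSize.{0, 0} (ChainComplex A ℤ) := ⟨fun _ _ => inferInstance⟩
    infer_instance
  hasPushouts := inferInstance
  hasCoproducts := fun J => inferInstance
  preservesColimit := by
    rintro _ _ _ _ _ ⟨i, n⟩ f hf
    exact ((hP i).sphere _).preservesColimit _

theorem isCardinal_genTrivCof :
    (genTrivCof P).IsCardinalForSmallObjectArgument Cardinal.aleph0.{0} where
  isSmall := inferInstanceAs (MorphismProperty.IsSmall.{0} (MorphismProperty.ofHoms _))
  hasIterationOfShape := by
    have : HasColimitsOfSize.{0, 0} (ChainComplex A ℤ) := ⟨fun _ _ => inferInstance⟩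
    infer_instance
  hasPushouts := inferInstance
  hasCoproducts := fun J => inferInstance
  preservesColimit := by
    rintro _ _ _ _ _ ⟨i, n⟩ f hf
    refine IsCompactObj.preservesColimit ?_ _
    intro J _ _ F c hc
    refine ⟨fun g => ⟨IsFiltered.nonempty.some, 0, (isZero_zero _).eq_of_src _ _⟩,
      fun j g _ => ⟨j, 𝟙 j, (isZero_zero _).eq_of_src _ _⟩⟩

theorem hasFactorization_cof :
    MorphismProperty.HasFactorization (trivFibs P).llp (trivFibs P) := by
  have := isCardinal_genCof P hP
  have := SmallObject.hasFunctorialFactorization (genCof P) Cardinal.aleph0.{0}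
  rw [genCof_rlp] at this
  infer_instance

theorem hasFactorization_trivCof :
    MorphismProperty.HasFactorization (fibs P).llp (fibs P) := by
  have := isCardinal_genTrivCof P hP
  have := SmallObject.hasFunctorialFactorization (genTrivCof P) Cardinal.aleph0.{0}
  rw [genTrivCof_rlp] at this
  infer_instance

theorem wfs_cof : MorphismProperty.IsWeakFactorizationSystem (trivFibs P).llp (trivFibs P) := by
  have := hasFactorization_cof P hP
  have : (trivFibs P).IsStableUnderRetracts := by
    rw [← genCof_rlp]
    infer_instance
  exact .mk' _ _ fun _ _ hi hp => hi _ hp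

theorem wfs_trivCof : MorphismProperty.IsWeakFactorizationSystem (fibs P).llp (fibs P) := by
  have := hasFactorization_trivCof P hP
  have : (fibs P).IsStableUnderRetracts := by
    rw [← genTrivCof_rlp]
    infer_instance
  exact .mk' _ _ fun _ _ hi hp => hi _ hp

omit hP in
theorem llp_fibs_le : (fibs P).llp ≤ (trivFibs P).llp :=
  MorphismProperty.antitone_llp (trivFibs_le_fibs P)

variable (W : MorphismProperty (ChainComplex A ℤ)) [W.HasTwoOutOfThreeProperty]
  (hW : ∀ {K L : ChainComplex A ℤ} (e : HomotopyEquiv K L), W e.hom)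
  (hWf : W ⊓ fibs P = trivFibs P)

omit hP [HasBinaryBiproducts A] [HasZeroObject A] [HasColimitsOfSize.{0, 0} A]
  [W.HasTwoOutOfThreeProperty] in
include hW in
theorem _root_.DGModel.IsDeformationRetract.mem {K L : ChainComplex A ℤ} {f : K ⟶ L}
    (hf : IsDeformationRetract f) : W f := by
  obtain ⟨r, hr, ⟨h⟩⟩ := hf
  exact hW ⟨f, r, Homotopy.ofEq hr, h⟩

-- Maps out of `P i` lift along any degreewise split epimorphism, so those belong to `fibs P`. The
-- class `W` plays no role in this, which is what makes acyclicity of the left class of `fibs P`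
-- automatic.
omit hP in
theorem isDeformationRetract_of_llp_fibs {K L : ChainComplex A ℤ} {f : K ⟶ L}
    (hf : (fibs P).llp f) : IsDeformationRetract f :=
  isDeformationRetract_of_llp (MorphismProperty.antitone_llp (degreewiseSplitEpi_le_fibs P) _ hf)

-- The retract argument. Factor f as i ≫ p with i in the left class of `fibs P` and p in `fibs P`.
-- Since i is a homotopy equivalence, p is in `W` by two-out-of-three, hence in `trivFibs P`. Thus f
-- lifts against p and is a retract of i.
include hW hWf in
theorem trivCof_eq : (trivFibs P).llp ⊓ W = (fibs P).llp := by
  apply le_antisymm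
  · rintro K L f ⟨hf, hfW⟩
    have := hasFactorization_trivCof P hP
    let d := MorphismProperty.factorizationData (fibs P).llp (fibs P) f
    have hi : W d.i := (isDeformationRetract_of_llp_fibs P d.hi).mem W hW
    have hp : W d.p := W.of_precomp d.i d.p hi (by rwa [d.fac])
    have hp' : trivFibs P d.p := by
      rw [← hWf]
      exact ⟨hp, d.hp⟩
    have := hf _ hp'
    have sq : CommSq d.i f d.p (𝟙 L) := ⟨by simp⟩
    have r : RetractArrow f d.i :=
      { i := Arrow.homMk (𝟙 _) sq.lift (by simp)
        r := Arrow.homMk (𝟙 _) d.p (by simp) }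
    exact MorphismProperty.of_retract r d.hi
  · intro K L f hf
    exact ⟨llp_fibs_le P _ hf, (isDeformationRetract_of_llp_fibs P hf).mem W hW⟩

include hW hWf in
/-- The projective model structure. -/
abbrev modelCategory [HasFiniteLimits (ChainComplex A ℤ)] : ModelCategory (ChainComplex A ℤ) :=
  letI : CategoryWithFibrations (ChainComplex A ℤ) := ⟨fibs P⟩
  letI : CategoryWithCofibrations (ChainComplex A ℤ) := ⟨(trivFibs P).llp⟩
  letI : CategoryWithWeakEquivalences (ChainComplex A ℤ) := ⟨W⟩
  haveI : HasColimitsOfSize.{0, 0} (ChainComplex A ℤ) := ⟨fun _ _ => inferInstance⟩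
  haveI : (weakEquivalences (ChainComplex A ℤ)).HasTwoOutOfThreeProperty :=
    inferInstanceAs W.HasTwoOutOfThreeProperty
  haveI h1 : trivialFibrations (ChainComplex A ℤ) = trivFibs P :=
    (inf_comm _ _).trans hWf
  haveI h2 : trivialCofibrations (ChainComplex A ℤ) = (fibs P).llp :=
    trivCof_eq P hP W hW hWf
  haveI : MorphismProperty.IsWeakFactorizationSystem (cofibrations (ChainComplex A ℤ))
      (trivialFibrations (ChainComplex A ℤ)) := by
    rw [h1]
    exact wfs_cof P hP
  haveI : MorphismProperty.IsWeakFactorizationSystem (trivialCofibrations (ChainComplex A ℤ))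
      (fibrations (ChainComplex A ℤ)) := by
    rw [h2]
    exact wfs_trivCof P hP
  ModelCategory.mk' (ChainComplex A ℤ)

end Model

end DGModel

/-! ### Path maps of fibrations, and the pullback-hom map -/

namespace DGModel
universe v u
open DGTensor

section PathFib

variable {A : Type u} [Category.{v} A] [Preadditive A] [HasBinaryBiproducts A] {ι : Type}
  (P : ι → A) {E B : ChainComplex A ℤ} (p : E ⟶ B) (n : ℤ)

theorem fibs_pathMap (hp : fibs P p) : fibs P (pathMap p n) := by
  intro m i x
  obtain ⟨z, hz⟩ := hp (m + n) i (x ≫ pfst p (n := n) (m := m) (m + n) rfl)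
  have h' : m + n = m + n - 1 + 1 := by omega
  refine ⟨plift (𝟙 E) (n := n) (m := m) (k := m + n) (l := m + n - 1) rfl h' z
    (x ≫ psnd p (n := n) (m := m) (m + n - 1) h'), ?_⟩
  apply pcomplex_ext p (n := n) (m := m) (k := m + n) (l := m + n - 1) rfl h'
  · rw [Category.assoc, pathMap_fst, ← Category.assoc, plift_fst, hz]
  · rw [Category.assoc, pathMap_snd, plift_snd]

/-- Write x = (b, e) and y = (b', e'). The hypotheses say d b' = e', d b - p e = p b' and -d e = e'.
Hence b' + e is a cycle with p(b' + e) = d b. If z lifts b with boundary b' + e, then (z, e) is the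
required lift. -/
theorem trivFibs_pathMap (hp : trivFibs P p) : trivFibs P (pathMap p n) := by
  intro m m' hm i x y hy hxy
  obtain ⟨k, hk⟩ : ∃ k, m + n = k := ⟨_, rfl⟩
  have a1 := pd_fst p (n := n) hm (k' := k - 1) (k := k) (by omega) hk
  have a2 := pd_snd p (n := n) hm (k' := k - 2) (k := k - 1) (by omega) (by omega)
  have b1 := pd_fst (𝟙 E) (n := n) (m' := m' - 1) (m := m') (by omega) (k' := k - 2) (k := k - 1) (by omega)
    (by omega)
  have hy' := hy (m' - 1)
  have e1 : y ≫ pfst (𝟙 E) (k - 1) (by omega) ≫ E.d (k - 1) (k - 2) =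
      y ≫ psnd (𝟙 E) (k - 2) (by omega) := by
    have := congrArg (· ≫ pfst (𝟙 E) (k - 2) (by omega)) hy'
    rw [zero_comp, Category.assoc, b1, HomologicalComplex.id_f, Category.comp_id,
      Preadditive.comp_sub, sub_eq_zero] at this
    exact this
  have e2 : x ≫ pfst p k hk ≫ B.d k (k - 1) =
      y ≫ pfst (𝟙 E) (k - 1) (by omega) ≫ p.f _ + x ≫ psnd p (k - 1) (by omega) ≫ p.f _ := by
    have := congrArg (· ≫ pfst p (k - 1) (by omega)) hxy
    rw [Category.assoc, a1, Preadditive.comp_sub, Category.assoc, pathMap_fst,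
      sub_eq_iff_eq_add] at this
    exact this
  have e3 : - x ≫ psnd p (k - 1) (by omega) ≫ E.d (k - 1) (k - 2) =
      y ≫ psnd (𝟙 E) (k - 2) (by omega) := by
    have := congrArg (· ≫ psnd p (k - 2) (by omega)) hxy
    rw [Category.assoc, a2, Preadditive.comp_neg, Category.assoc, pathMap_snd] at this
    exact this
  obtain ⟨z, hz, hz'⟩ := hp k (k - 1) (by omega) i (x ≫ pfst p k hk)
    (y ≫ pfst (𝟙 E) (k - 1) (by omega) + x ≫ psnd p (k - 1) (by omega)) (fun l => by
      by_cases hl : l = k - 2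
      · subst hl
        rw [Preadditive.add_comp, Category.assoc, Category.assoc, e1, ← e3, neg_add_cancel]
      · rw [E.shape _ _ (by change ¬ (l + 1 = k - 1); omega), comp_zero])
    (by rw [Preadditive.add_comp, Category.assoc, Category.assoc, Category.assoc, e2])
  have hk' : m + n = k - 1 + 1 := by omega
  refine ⟨plift (𝟙 E) (n := n) (m := m) (k := k) (l := k - 1) hk hk' z
    (x ≫ psnd p (k - 1) hk'), ?_, ?_⟩
  · have c1 := pd_fst (𝟙 E) (n := n) hm (k' := k - 1) (k := k) (by omega) hk
    have c2 := pd_snd (𝟙 E) (n := n) hm (k' := k - 2) (k := k - 1) (by omega) (by omega)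
    apply pcomplex_ext (𝟙 E) (n := n) (m := m') (k := k - 1) (l := k - 2) (by omega) (by omega)
    · rw [Category.assoc, c1, Preadditive.comp_sub, ← Category.assoc, plift_fst, hz,
        HomologicalComplex.id_f, Category.comp_id, plift_snd, add_sub_cancel_right]
    · rw [Category.assoc, c2, Preadditive.comp_neg, ← Category.assoc, plift_snd, Category.assoc, e3]
  · apply pcomplex_ext p (n := n) (m := m) (k := k) (l := k - 1) hk hk'
    · rw [Category.assoc, pathMap_fst, ← Category.assoc, plift_fst, hz']
    · rw [Category.assoc, pathMap_snd, plift_snd]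

end PathFib

section SwapCurry

variable {A : Type u} [Category.{v} A] [Preadditive A] [MonoidalCategory A] [SymmetricCategory A]
  [MonoidalPreadditive A] {H : A → A ⥤ A} (adj : ∀ T : A, tensorLeft T ⊣ H T) {T a a' b b' : A}

/-- The map `a ⟶ [T, b]` which corresponds to a map `a ⊗ T ⟶ b`. -/
def swapCurry (f : a ⊗ T ⟶ b) : a ⟶ (H T).obj b :=
  (adj T).homEquiv _ _ ((β_ _ _).hom ≫ f)

theorem swapCurry_injective {f g : a ⊗ T ⟶ b} (h : swapCurry adj f = swapCurry adj g) : f = g :=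
  (cancel_epi (β_ _ _).hom).1 (((adj T).homEquiv _ _).injective h)

theorem swapCurry_surjective (g : a ⟶ (H T).obj b) : ∃ f, swapCurry adj f = g :=
  ⟨(β_ _ _).inv ≫ ((adj T).homEquiv _ _).symm g, by simp [swapCurry]⟩

theorem swapCurry_left (g : a' ⟶ a) (f : a ⊗ T ⟶ b) :
    swapCurry adj (g ▷ T ≫ f) = g ≫ swapCurry adj f := by
  simp only [swapCurry]
  rw [← Category.assoc, ← BraidedCategory.braiding_naturality_right, Category.assoc]
  exact (adj T).homEquiv_naturality_left _ _

theorem swapCurry_right (f : a ⊗ T ⟶ b) (g : b ⟶ b') :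
    swapCurry adj (f ≫ g) = swapCurry adj f ≫ (H T).map g := by
  simp only [swapCurry]
  rw [← Category.assoc]
  exact (adj T).homEquiv_naturality_right _ _

theorem swapCurry_sub (f g : a ⊗ T ⟶ b) :
    swapCurry adj (f - g) = swapCurry adj f - swapCurry adj g := by
  simp only [swapCurry, Preadditive.comp_sub]
  exact ((adj T).homAddEquiv _ _).map_sub _ _

theorem swapCurry_neg (f : a ⊗ T ⟶ b) : swapCurry adj (- f) = - swapCurry adj f := by
  simp only [swapCurry, Preadditive.comp_neg]
  exact ((adj T).homAddEquiv _ _).map_neg _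

end SwapCurry

section Closed

variable {A : Type u} [Category.{v} A] [Preadditive A] [MonoidalCategory A] [SymmetricCategory A]
  [MonoidalPreadditive A] [HasZeroObject A] [HasBinaryBiproducts A] [HasColimitsOfSize.{0, 0} A]
  [HasProductsOfShape ℤ A] [HasPullbacks A]
  [∀ X : A, PreservesColimitsOfSize.{0, 0} ((curriedTensor A).obj X)]
  [∀ X : A, PreservesColimitsOfSize.{0, 0} ((curriedTensor A).flip.obj X)]

section Ev

variable [MonoidalClosed (ChainComplex A ℤ)]

/-- The evaluation. -/
abbrev evMap (K L : ChainComplex A ℤ) : K ⊗ (ihom K).obj L ⟶ L := (ihom.ev K).app L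

/-- The component `K_i ⊗ hom(K, L)_n ⟶ L_j` of the evaluation. -/
def tev (K L : ChainComplex A ℤ) (i n j : ℤ) (h : i + n = j) :
    K.X i ⊗ ((ihom K).obj L).X n ⟶ L.X j :=
  tι K ((ihom K).obj L) i n j h ≫ (evMap K L).f j

/-- This says only that evaluation is a map of complexes, so it holds for every closed structure,
not just for the one constructed above. -/
theorem d_tev (K L : ChainComplex A ℤ) (i' i n' n j' j : ℤ) (hi : i' + 1 = i)
    (hn : n' + 1 = n) (hj : j' + 1 = j) (h : i + n = j) :
    K.X i ◁ ((ihom K).obj L).d n n' ≫ tev K L i n' j' (by omega) =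
      i.negOnePow • (tev K L i n j h ≫ L.d j j' -
        K.d i i' ▷ _ ≫ tev K L i' n j' (by omega)) := by
  have h1 := tι_d K ((ihom K).obj L) i n j i' n' j' h hi hn hj
  have h3 : tι K ((ihom K).obj L) i n j h ≫ (evMap K L).f j ≫ L.d j j' =
      K.d i i' ▷ _ ≫ tι K ((ihom K).obj L) i' n j' (by omega) ≫ (evMap K L).f j' +
        i.negOnePow • (K.X i ◁ ((ihom K).obj L).d n n' ≫
          tι K ((ihom K).obj L) i n' j' (by omega) ≫ (evMap K L).f j') := by
    rw [HomologicalComplex.Hom.comm, reassoc_of% h1]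
    simp
  simp only [tev, Category.assoc, h3, add_sub_cancel_left, smul_smul, Int.units_mul_self, one_smul]

theorem tev_map (K : ChainComplex A ℤ) {L L' : ChainComplex A ℤ} (f : L ⟶ L') (i n j : ℤ)
    (h : i + n = j) :
    K.X i ◁ ((ihom K).map f).f n ≫ tev K L' i n j h = tev K L i n j h ≫ f.f j := by
  have := congrArg (fun φ => HomologicalComplex.Hom.f φ j) (ihom.ev_naturality K f)
  simp only [HomologicalComplex.comp_f] at this
  have e1 := tι_whiskerLeft K ((ihom K).map f) i n j h
  rw [tev, tev, ← reassoc_of% e1, Category.assoc]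
  exact congrArg (_ ≫ ·) this

theorem tev_pre {K K' : ChainComplex A ℤ} (f : K ⟶ K') (L : ChainComplex A ℤ) (i n j : ℤ)
    (h : i + n = j) :
    K.X i ◁ ((MonoidalClosed.pre f).app L).f n ≫ tev K L i n j h =
      f.f i ▷ _ ≫ tev K' L i n j h := by
  have := congrArg (fun φ => HomologicalComplex.Hom.f φ j)
    (MonoidalClosed.id_tensor_pre_app_comp_ev f L)
  simp only [HomologicalComplex.comp_f] at this
  have e1 := tι_whiskerLeft K ((MonoidalClosed.pre f).app L) i n j h
  have e2 := tι_whiskerRight f ((ihom K').obj L) i n j h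
  rw [tev, tev, ← reassoc_of% e1, ← reassoc_of% e2]
  exact congrArg (_ ≫ ·) this

variable (A) in
/-- Maps `T ⟶ hom(K, L)_n` are families of maps `K_i ⊗ T ⟶ L_{i + n}`. -/
def HomPoints : Prop :=
  ∀ (K L : ChainComplex A ℤ) (n : ℤ) (T : A),
    (∀ f g : T ⟶ ((ihom K).obj L).X n, (∀ (i j : ℤ) (h : i + n = j),
      K.X i ◁ f ≫ tev K L i n j h = K.X i ◁ g ≫ tev K L i n j h) → f = g) ∧
    ∀ (f : ∀ (i j : ℤ) (_ : i + n = j), K.X i ⊗ T ⟶ L.X j), ∃ g : T ⟶ ((ihom K).obj L).X n,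
      ∀ (i j : ℤ) (h : i + n = j), K.X i ◁ g ≫ tev K L i n j h = f i j h

variable {X Y E B : ChainComplex A ℤ}

/-- The comparison map from `hom(Y, E)` to the pullback of `hom(X, E)` and `hom(Y, B)` has the
lifting property of trivial fibrations if lifting problems for homotopies can be solved. -/
theorem trivFibs_pullback (hH : HomPoints A) {ι : Type} {P : ι → A} {H : A → A ⥤ A}
    [∀ T, (H T).Additive] (adj : ∀ T : A, tensorLeft T ⊣ H T) (j : X ⟶ Y) (p : E ⟶ B)
    {Q : ChainComplex A ℤ} {fst : Q ⟶ (ihom X).obj E} {snd : Q ⟶ (ihom Y).obj B}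
    (hQ : IsPullback fst snd ((ihom X).map p) ((MonoidalClosed.pre j).app B))
    (π : (ihom Y).obj E ⟶ Q) (h₁ : π ≫ fst = (MonoidalClosed.pre j).app E)
    (h₂ : π ≫ snd = (ihom Y).map p)
    (hj : ∀ i n, HasLiftingProperty j
      (pathMap (((H (P i)).mapHomologicalComplex (.down ℤ)).map p) n)) :
    trivFibs P π := by
  intro n n' hn t x y hy hxy
  -- By evaluation, x amounts to maps X_i ⊗ P → E and Y_i ⊗ P → B of degree n, and y to maps Y_i ⊗ P
  -- → E of degree n'. This identity and the next three are the hypotheses of `exists_homotopyLift`,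
  -- before transposing P to the target, with θ equal to (-1)^i y.
  have hx : ∀ (i k : ℤ) (h : i + n = k),
      (X.X i ◁ (x ≫ fst.f n) ≫ tev X E i n k h) ≫ p.f k =
        j.f i ▷ P t ≫ Y.X i ◁ (x ≫ snd.f n) ≫ tev Y B i n k h := by
    intro i k h
    rw [Category.assoc, ← tev_map, ← whiskerLeft_comp_assoc, Category.assoc,
      ← HomologicalComplex.comp_f, hQ.w, HomologicalComplex.comp_f, ← Category.assoc,
      whiskerLeft_comp_assoc, tev_pre, whisker_exchange_assoc]
  have hx1 : ∀ (i i' k k' : ℤ) (h : i + n = k) (_ : i' + 1 = i) (_ : k' + 1 = k),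
      X.d i i' ▷ P t ≫ X.X i' ◁ (x ≫ fst.f n) ≫ tev X E i' n k' (by omega) =
        (X.X i ◁ (x ≫ fst.f n) ≫ tev X E i n k h) ≫ E.d k k' -
          j.f i ▷ P t ≫ (i.negOnePow • (Y.X i ◁ y ≫ tev Y E i n' k' (by omega))) := by
    intro i i' k k' h hi hk
    have e := d_tev X E i' i n' n k' k hi hn hk h
    have e' : X.X i ◁ (x ≫ fst.f n ≫ ((ihom X).obj E).d n n') ≫ tev X E i n' k' (by omega) =
        j.f i ▷ P t ≫ Y.X i ◁ y ≫ tev Y E i n' k' (by omega) := by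
      rw [fst.comm, reassoc_of% hxy, ← HomologicalComplex.comp_f, h₁, whiskerLeft_comp_assoc,
        tev_pre, whisker_exchange_assoc]
    rw [← Category.assoc, whiskerLeft_comp_assoc, e] at e'
    rw [Linear.comp_units_smul, ← e']
    simp [smul_smul, whisker_exchange_assoc]
  have hy1 : ∀ (i i' k k' : ℤ) (h : i + n = k) (_ : i' + 1 = i) (_ : k' + 1 = k),
      Y.d i i' ▷ P t ≫ Y.X i' ◁ (x ≫ snd.f n) ≫ tev Y B i' n k' (by omega) =
        (Y.X i ◁ (x ≫ snd.f n) ≫ tev Y B i n k h) ≫ B.d k k' -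
          (i.negOnePow • (Y.X i ◁ y ≫ tev Y E i n' k' (by omega))) ≫ p.f k' := by
    intro i i' k k' h hi hk
    have e := d_tev Y B i' i n' n k' k hi hn hk h
    have e' : Y.X i ◁ (x ≫ snd.f n ≫ ((ihom Y).obj B).d n n') ≫ tev Y B i n' k' (by omega) =
        (Y.X i ◁ y ≫ tev Y E i n' k' (by omega)) ≫ p.f k' := by
      rw [snd.comm, reassoc_of% hxy, ← HomologicalComplex.comp_f, h₂, whiskerLeft_comp_assoc,
        tev_map, Category.assoc]
    rw [← Category.assoc, whiskerLeft_comp_assoc, e] at e'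
    rw [Linear.units_smul_comp, ← e']
    simp [smul_smul, whisker_exchange_assoc]
  have hy2 : ∀ (i i' k k' : ℤ) (h : i + n = k + 1) (_ : i' + 1 = i) (_ : k' + 1 = k),
      Y.d i i' ▷ P t ≫ (i'.negOnePow • (Y.X i' ◁ y ≫ tev Y E i' n' k' (by omega))) =
        - (i.negOnePow • (Y.X i ◁ y ≫ tev Y E i n' k (by omega))) ≫ E.d k k' := by
    intro i i' k k' h hi hk
    have e := d_tev Y E i' i (n' - 1) n' k' k hi (by omega) hk (by omega)
    have e' := congrArg (fun f => Y.X i ◁ f ≫ tev Y E i (n' - 1) k' (by omega)) (hy (n' - 1))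
    rw [whiskerLeft_comp_assoc, e, MonoidalPreadditive.whiskerLeft_zero, zero_comp,
      Linear.comp_units_smul, smul_eq_zero_iff_eq, Preadditive.comp_sub, sub_eq_zero] at e'
    rw [Linear.comp_units_smul, ← whisker_exchange_assoc, ← e']
    obtain rfl : i' = i - 1 := by omega
    rw [Int.negOnePow_sub, Int.negOnePow_one]
    simp
  obtain ⟨χ, hχ₁, hχ₂, hχ₃⟩ := exists_homotopyLift
    (((H (P t)).mapHomologicalComplex (.down ℤ)).map p) (n := n) j (hj t n)
    (fun m k h => swapCurry adj (X.X m ◁ (x ≫ fst.f n) ≫ tev X E m n k h))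
    (fun m k h => swapCurry adj (Y.X m ◁ (x ≫ snd.f n) ≫ tev Y B m n k h))
    (fun m l h => swapCurry adj (m.negOnePow • (Y.X m ◁ y ≫ tev Y E m n' l (by omega))))
    (fun m k h => by
      have e := congrArg (swapCurry adj) (hx m k h)
      rw [swapCurry_left, swapCurry_right] at e
      exact e)
    (fun m m' k k' h hm hk => by
      have e := congrArg (swapCurry adj) (hx1 m m' k k' h hm hk)
      rw [swapCurry_left, swapCurry_sub, swapCurry_left, swapCurry_right adj _ (E.d k k')] at e
      exact e)
    (fun m m' k k' h hm hk => by
      have e := congrArg (swapCurry adj) (hy1 m m' k k' h hm hk)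
      rw [swapCurry_left, swapCurry_sub, swapCurry_right adj _ (B.d k k'),
        swapCurry_right adj _ (p.f k')] at e
      exact e)
    (fun m m' k k' h hm hk => by
      have e := congrArg (swapCurry adj) (hy2 m m' k k' h hm hk)
      rw [swapCurry_left, swapCurry_neg, swapCurry_right] at e
      exact e)
  -- The lifted homotopy, transposed back, is a family Y_i ⊗ P → E of degree n. By `hH` such a
  -- family is the same as a map z into hom(Y, E)_n.
  choose χ' hχ' using fun m k h => swapCurry_surjective adj (χ m k h)
  obtain ⟨z, hz⟩ := (hH Y E n (P t)).2 χ'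
  have hd : ∀ (i i' k k' : ℤ) (h : i + n = k) (_ : i' + 1 = i) (_ : k' + 1 = k),
      Y.d i i' ▷ P t ≫ χ' i' k' (by omega) = χ' i k h ≫ E.d k k' -
        (i.negOnePow • (Y.X i ◁ y ≫ tev Y E i n' k' (by omega))) := by
    intro i i' k k' h hi hk
    apply swapCurry_injective adj
    rw [swapCurry_left, hχ', swapCurry_sub, swapCurry_right adj _ (E.d k k'), hχ']
    exact hχ₃ i i' k k' h hi hk
  refine ⟨z, (hH Y E n' (P t)).1 _ _ fun i k' h => ?_, ?_⟩
  · have e := d_tev Y E (i - 1) i n' n k' (k' + 1) (by omega) hn rfl (by omega)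
    have e' := hd i (i - 1) (k' + 1) k' (by omega) (by omega) rfl
    rw [whiskerLeft_comp_assoc, e, Linear.comp_units_smul, Preadditive.comp_sub,
      ← Category.assoc, hz, whisker_exchange_assoc, hz, e']
    simp [smul_smul]
  · have hQ' := hQ.map (HomologicalComplex.eval A (.down ℤ) n)
    apply hQ'.hom_ext
    · apply (hH X E n (P t)).1
      intro i k h
      change X.X i ◁ ((z ≫ π.f n) ≫ fst.f n) ≫ _ = X.X i ◁ (x ≫ fst.f n) ≫ _
      rw [Category.assoc, ← HomologicalComplex.comp_f, h₁, whiskerLeft_comp_assoc, tev_pre,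
        whisker_exchange_assoc, hz]
      apply swapCurry_injective adj
      rw [swapCurry_left, hχ']
      exact hχ₁ i k h
    · apply (hH Y B n (P t)).1
      intro i k h
      change Y.X i ◁ ((z ≫ π.f n) ≫ snd.f n) ≫ _ = Y.X i ◁ (x ≫ snd.f n) ≫ _
      rw [Category.assoc, ← HomologicalComplex.comp_f, h₂, whiskerLeft_comp_assoc, tev_map,
        ← Category.assoc, hz]
      apply swapCurry_injective adj
      rw [swapCurry_right, hχ']
      exact hχ₂ i k h

end Ev

theorem homPoints {H : A → A ⥤ A} (adj : ∀ X : A, tensorLeft X ⊣ H X) :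
    letI := monoidalClosed adj
    HomPoints A := by
  let _ := monoidalClosed adj
  intro K L n T
  have e : ∀ (i j : ℤ) (h : i + n = j), tev K L i n j h = hev adj K L i n j h :=
    fun i j h => tι_ev adj K L i n j h
  constructor
  · intro f g h
    apply hev_ext adj
    intro i j hj
    have := h i j hj
    rwa [e] at this
  · intro f
    refine ⟨hlift adj f, fun i j h => ?_⟩
    rw [e]
    exact hlift_hev adj f i j h

end Closed

end DGModel

/-! ### Pushout-product, unit and monoid axioms -/

namespace DGModel
universe v u
open DGTensor

section Preserve

variable {A : Type u} [Category.{v} A] [Preadditive A] [MonoidalCategory A]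
  [MonoidalPreadditive A] {H : A → A ⥤ A} [∀ T, (H T).Additive]
  (adj : ∀ T : A, tensorLeft T ⊣ H T) {ι : Type} (P : ι → A)
  {E B : ChainComplex A ℤ} (p : E ⟶ B) (T : A)

include adj

/-- By adjunction, lifting `P j` along [T, p] is lifting T ⊗ `P j` along p. This is where tensor
products of generators enter. -/
theorem fibs_map (h : ∀ j, fibs (fun _ : Unit => T ⊗ P j) p) :
    fibs P (((H T).mapHomologicalComplex (.down ℤ)).map p) := by
  intro n j x
  obtain ⟨z, hz⟩ := h j n () (((adj T).homEquiv _ _).symm x)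
  refine ⟨(adj T).homEquiv _ _ z, ?_⟩
  refine ((adj T).homEquiv_naturality_right z (p.f n)).symm.trans ?_
  rw [hz]
  exact Equiv.apply_symm_apply _ _

theorem trivFibs_map (h : ∀ j, trivFibs (fun _ : Unit => T ⊗ P j) p) :
    trivFibs P (((H T).mapHomologicalComplex (.down ℤ)).map p) := by
  intro n n' hn j x y hy hxy
  have h0 : ∀ {a b : A}, ((adj T).homEquiv a b).symm 0 = 0 := fun {a b} =>
    ((adj T).homAddEquiv a b).symm.map_zero
  obtain ⟨z, hz, hz'⟩ := h j n n' hn () (((adj T).homEquiv _ _).symm x)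
    (((adj T).homEquiv _ _).symm y) (fun n'' => by
      have := (adj T).homEquiv_naturality_right_symm y (E.d n' n'')
      rw [← this]
      exact (congrArg _ (hy n'')).trans h0) (by
      have e1 := (adj T).homEquiv_naturality_right_symm x (B.d n n')
      have e2 := (adj T).homEquiv_naturality_right_symm y (p.f n')
      rw [← e1, ← e2]
      exact congrArg _ hxy)
  refine ⟨(adj T).homEquiv _ _ z, ?_, ?_⟩
  · refine ((adj T).homEquiv_naturality_right z (E.d n n')).symm.trans ?_
    rw [hz]
    exact Equiv.apply_symm_apply _ _
  · refine ((adj T).homEquiv_naturality_right z (p.f n)).symm.trans ?_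
    rw [hz']
    exact Equiv.apply_symm_apply _ _

end Preserve

section Axioms

variable {A : Type u} [Category.{0} A] [Preadditive A] [MonoidalCategory A] [SymmetricCategory A]
  [MonoidalPreadditive A] [HasZeroObject A] [HasBinaryBiproducts A] [HasColimitsOfSize.{0, 0} A]
  [HasProductsOfShape ℤ A] [HasPullbacks A]
  [∀ X : A, PreservesColimitsOfSize.{0, 0} ((curriedTensor A).obj X)]
  [∀ X : A, PreservesColimitsOfSize.{0, 0} ((curriedTensor A).flip.obj X)]
  {ι : Type} (P : ι → A)

section PushoutProduct

variable {H : A → A ⥤ A} (adj : ∀ T : A, tensorLeft T ⊣ H T)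
  [MonoidalClosed (ChainComplex A ℤ)] (hH : HomPoints A)
  [HasPushouts (ChainComplex A ℤ)] [HasPullbacks (ChainComplex A ℤ)]

-- Additivity of `H T`, needed to apply it to complexes, follows from the adjunction; it is passed
-- on to `hj` so that callers need not supply it.
include adj hH in
theorem trivFibs_pullbackHom {X Y E B : ChainComplex A ℤ} (j : X ⟶ Y) (p : E ⟶ B)
    (hj : ∀ (i : ι) (n : ℤ), ∀ (_ : ∀ T, (H T).Additive), HasLiftingProperty j
      (pathMap (((H (P i)).mapHomologicalComplex (.down ℤ)).map p) n)) :
    trivFibs P (((Arrow.pullbackHom.obj (.op (Arrow.mk j))).obj (Arrow.mk p)).hom) := by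
  have : ∀ T, (H T).Additive := fun T => (adj T).right_adjoint_additive
  let sq := Functor.PullbackObjObj.ofHasPullback
    (MonoidalClosed.internalHom (C := ChainComplex A ℤ)) j p
  exact trivFibs_pullback hH adj j p sq.isPullback sq.π sq.π_fst sq.π_snd
    (fun i n => hj i n this)

variable (hfib : ∀ (i j : ι) {E B : ChainComplex A ℤ} (p : E ⟶ B), fibs P p →
    fibs (fun _ : Unit => P i ⊗ P j) p)
  (htriv : ∀ (i j : ι) {E B : ChainComplex A ℤ} (p : E ⟶ B), trivFibs P p →
    trivFibs (fun _ : Unit => P i ⊗ P j) p)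

-- Lifting the pushout-product against p is lifting i against the pullback-hom of j and p. The
-- latter is in `trivFibs` once j lifts against the path maps of [P, p], and these are again in
-- `trivFibs`.
include adj hH htriv in
theorem pushoutProduct_cof {X Y K L : ChainComplex A ℤ} {i : K ⟶ L} {j : X ⟶ Y}
    (hi : (trivFibs P).llp i) (hj : (trivFibs P).llp j) :
    (trivFibs P).llp ((Arrow.pushoutProduct.obj (Arrow.mk i)).obj (Arrow.mk j)).hom := by
  intro E B p hp
  refine Arrow.PushoutProduct.hasLiftingProperty_mk_iff'.2
    (hi _ (trivFibs_pullbackHom P adj hH j p fun t n _ => hj _ ?_))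
  exact trivFibs_pathMap _ _ _ (trivFibs_map adj P p _ fun s => htriv t s p hp)

-- If j lifts against all fibrations, then it lifts against the path maps of [P, p] for any
-- fibration p. The pullback-hom is thus in `trivFibs`, and it is enough that i is a cofibration.
include adj hH hfib in
theorem pushoutProduct_trivCof_right {X Y K L : ChainComplex A ℤ} {i : K ⟶ L} {j : X ⟶ Y}
    (hi : (trivFibs P).llp i) (hj : (fibs P).llp j) :
    (fibs P).llp ((Arrow.pushoutProduct.obj (Arrow.mk i)).obj (Arrow.mk j)).hom := by
  intro E B p hp
  refine Arrow.PushoutProduct.hasLiftingProperty_mk_iff'.2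
    (hi _ (trivFibs_pullbackHom P adj hH j p fun t n _ => hj _ ?_))
  exact fibs_pathMap _ _ _ (fibs_map adj P p _ fun s => hfib t s p hp)

include adj hH hfib in
theorem pushoutProduct_trivCof_left {X Y K L : ChainComplex A ℤ} {i : K ⟶ L} {j : X ⟶ Y}
    (hi : (fibs P).llp i) (hj : (trivFibs P).llp j) :
    (fibs P).llp ((Arrow.pushoutProduct.obj (Arrow.mk i)).obj (Arrow.mk j)).hom := by
  intro E B p hp
  refine Arrow.PushoutProduct.hasLiftingProperty_mk_iff.2
    (hj _ (trivFibs_pullbackHom P adj hH i p fun t n _ => hi _ ?_))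
  exact fibs_pathMap _ _ _ (fibs_map adj P p _ fun s => hfib t s p hp)

end PushoutProduct

section Monoid

/-- Tensoring preserves homotopies. -/
def homotopyWhiskerRight {K L : ChainComplex A ℤ} {f g : K ⟶ L} (h : Homotopy f g)
    (Z : ChainComplex A ℤ) : Homotopy (f ▷ Z) (g ▷ Z) :=
  HomologicalComplex.mapBifunctorMapHomotopy₁ h (𝟙 Z) (curriedTensor A) (.down ℤ)

/-- Tensoring preserves homotopy equivalences. -/
def homotopyEquivWhiskerRight {K L : ChainComplex A ℤ} (e : HomotopyEquiv K L)
    (Z : ChainComplex A ℤ) : HomotopyEquiv (K ⊗ Z) (L ⊗ Z) where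
  hom := e.hom ▷ Z
  inv := e.inv ▷ Z
  homotopyHomInvId := (Homotopy.ofEq (comp_whiskerRight _ _ _).symm).trans
    ((homotopyWhiskerRight e.homotopyHomInvId Z).trans (Homotopy.ofEq (id_whiskerRight _ _)))
  homotopyInvHomId := (Homotopy.ofEq (comp_whiskerRight _ _ _).symm).trans
    ((homotopyWhiskerRight e.homotopyInvHomId Z).trans (Homotopy.ofEq (id_whiskerRight _ _)))

theorem IsDeformationRetract.whiskerRight {K L : ChainComplex A ℤ} {f : K ⟶ L}
    (hf : IsDeformationRetract f) (Z : ChainComplex A ℤ) : IsDeformationRetract (f ▷ Z) := by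
  obtain ⟨r, hr, ⟨h⟩⟩ := hf
  refine ⟨r ▷ Z, by rw [← comp_whiskerRight, hr, id_whiskerRight], ⟨?_⟩⟩
  exact (Homotopy.ofEq (comp_whiskerRight _ _ _).symm).trans
    ((homotopyWhiskerRight h Z).trans (Homotopy.ofEq (id_whiskerRight _ _)))

end Monoid

section Unit

/-- The unit complex is concentrated in degree 0, so a section of b is a cycle of Q in degree 0 over
the identity of the unit. The lifting property with y = 0 in degree -1 provides it. -/
theorem exists_section_unit {Q : ChainComplex A ℤ} {b : Q ⟶ 𝟙_ (ChainComplex A ℤ)}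
    (hb : trivFibs (fun _ : Unit => 𝟙_ A) b) :
    ∃ s : 𝟙_ (ChainComplex A ℤ) ⟶ Q, s ≫ b = 𝟙 _ := by
  let S := (HomologicalComplex.single A (.down ℤ) (0 : ℤ)).obj (𝟙_ A)
  change ∃ s : S ⟶ Q, s ≫ b = 𝟙 S
  obtain ⟨z, hz, hz'⟩ := hb 0 (-1) (by omega) ()
    (HomologicalComplex.singleObjXSelf (.down ℤ) (0 : ℤ) (𝟙_ A)).inv 0 (fun _ => zero_comp) (by
      rw [zero_comp]
      exact ((HomologicalComplex.isZero_single_obj_X (.down ℤ) (0 : ℤ) (𝟙_ A) (-1)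
        (by omega)).eq_of_tgt _ _))
  refine ⟨HomologicalComplex.mkHomFromSingle z (fun k hk => ?_), ?_⟩
  · obtain rfl : k = -1 := by simp at hk; omega
    exact hz
  · apply HomologicalComplex.from_single_hom_ext
    rw [HomologicalComplex.comp_f, HomologicalComplex.mkHomFromSingle_f, Category.assoc]
    erw [hz']
    simp
    rfl

/-- For a section s of b, the map b ≫ s - 1 becomes zero after composition with b. As Q is cofibrant
and b is a trivial fibration, `exists_nullHomotopy` contracts it. -/
theorem homotopyEquiv_of_trivFibs_unit [HasInitial (ChainComplex A ℤ)] {Q : ChainComplex A ℤ}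
    {b : Q ⟶ 𝟙_ (ChainComplex A ℤ)} (hc : (trivFibs P).llp (initial.to Q)) (hb' : trivFibs P b)
    (hb : trivFibs (fun _ : Unit => 𝟙_ A) b) :
    ∃ e : HomotopyEquiv Q (𝟙_ (ChainComplex A ℤ)), e.hom = b := by
  obtain ⟨s, hs⟩ := exists_section_unit hb
  obtain ⟨h⟩ := exists_nullHomotopy b (initial.to Q) (hc _ (trivFibs_pathMap _ _ _ hb'))
    (b ≫ s - 𝟙 Q) (initial.hom_ext _ _) (by
      rw [Preadditive.sub_comp, Category.assoc, hs, Category.comp_id, Category.id_comp]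
      exact sub_self b)
  exact ⟨⟨b, s, Homotopy.equivSubZero.symm h, Homotopy.ofEq hs⟩, rfl⟩

end Unit

section Main

variable (hP : ∀ i, IsCompactObj (P i)) (W : MorphismProperty (ChainComplex A ℤ))
  [W.HasTwoOutOfThreeProperty] (hW : ∀ {K L : ChainComplex A ℤ} (e : HomotopyEquiv K L), W e.hom)
  (hWf : W ⊓ fibs P = trivFibs P) [HasFiniteLimits (ChainComplex A ℤ)]

theorem pushoutProductAxiom {H : A → A ⥤ A} (adj : ∀ T : A, tensorLeft T ⊣ H T)
    (hfib : ∀ (i j : ι) {E B : ChainComplex A ℤ} (p : E ⟶ B), fibs P p →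
      fibs (fun _ : Unit => P i ⊗ P j) p)
    (htriv : ∀ (i j : ι) {E B : ChainComplex A ℤ} (p : E ⟶ B), trivFibs P p →
      trivFibs (fun _ : Unit => P i ⊗ P j) p) :
    letI := modelCategory P hP W hW hWf
    MonoidalModel.PushoutProductAxiom (ChainComplex A ℤ) := by
  let _ := modelCategory P hP W hW hWf
  let _ := monoidalClosed adj
  have hH : HomPoints A := homPoints adj
  have e := trivCof_eq P hP W hW hWf
  intro K L X Y i j hi hj
  refine ⟨pushoutProduct_cof P adj hH htriv hi hj, ?_⟩
  rintro (hi' | hj')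
  · have h : (fibs P).llp i := by
      rw [← e]
      exact ⟨hi, hi'⟩
    have := pushoutProduct_trivCof_left P adj hH hfib h hj
    rw [← e] at this
    exact this.2
  · have h : (fibs P).llp j := by
      rw [← e]
      exact ⟨hj, hj'⟩
    have := pushoutProduct_trivCof_right P adj hH hfib hi h
    rw [← e] at this
    exact this.2

/-- Factor q into a deformation retract and a trivial fibration onto the unit. The second factor
starts from a cofibrant complex, so it is a homotopy equivalence too, and tensoring preserves both
kinds of maps. The symmetry carries the result to the other side. -/
theorem unitAxiom (hunit : ∀ {E B : ChainComplex A ℤ} (p : E ⟶ B), trivFibs P p →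
      trivFibs (fun _ : Unit => 𝟙_ A) p) :
    letI := modelCategory P hP W hW hWf
    MonoidalModel.UnitAxiom (ChainComplex A ℤ) := by
  let _ := modelCategory P hP W hW hWf
  intro Q X q hQ hq _
  have hc : (trivFibs P).llp (initial.to Q) := hQ.mem
  have := hasFactorization_trivCof P hP
  let d := MorphismProperty.factorizationData (fibs P).llp (fibs P) q
  have hi := isDeformationRetract_of_llp_fibs P d.hi
  have hp : W d.p := W.of_precomp d.i d.p (hi.mem W hW) (by rw [d.fac]; exact hq)
  have hp' : trivFibs P d.p := by
    rw [← hWf]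
    exact ⟨hp, d.hp⟩
  have hc' : (trivFibs P).llp (initial.to d.Z) := by
    have : initial.to d.Z = initial.to Q ≫ d.i := initial.hom_ext _ _
    rw [this]
    exact MorphismProperty.comp_mem _ _ _ hc (llp_fibs_le P _ d.hi)
  obtain ⟨e, he⟩ := homotopyEquiv_of_trivFibs_unit P hc' hp' (hunit _ hp')
  have h1 : W (q ▷ X) := by
    have h2 : q ▷ X = d.i ▷ X ≫ (homotopyEquivWhiskerRight e X).hom := by
      change _ = _ ≫ e.hom ▷ X
      rw [he, ← comp_whiskerRight, d.fac]
    rw [h2]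
    exact MorphismProperty.comp_mem _ _ _ ((hi.whiskerRight X).mem W hW) (hW _)
  have iso : ∀ {K L : ChainComplex A ℤ} (f : K ≅ L), W f.hom := fun f =>
    hW (HomotopyEquiv.ofIso f)
  refine ⟨h1, ?_⟩
  have h3 : X ◁ q = (β_ X Q).hom ≫ q ▷ X ≫ (β_ (𝟙_ _) X).hom := by
    rw [BraidedCategory.braiding_naturality_left, SymmetricCategory.symmetry_assoc]
  rw [h3]
  exact MorphismProperty.comp_mem _ _ _ (iso _) (MorphismProperty.comp_mem _ _ _ h1 (iso _))

/-- The maps j ⊗ Z are deformation retracts, that is, they lie in the left class of degreewise split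
epimorphisms. This class is closed under pushouts and transfinite compositions, and its members are
homotopy equivalences. -/
theorem monoidAxiom :
    letI := modelCategory P hP W hW hWf
    MonoidalModel.MonoidAxiom (ChainComplex A ℤ) := by
  let _ := modelCategory P hP W hW hWf
  have e := trivCof_eq P hP W hW hWf
  have h1 : MonoidalModel.trivialCofibrationsTensor (ChainComplex A ℤ) ≤
      (degreewiseSplitEpi (A := A)).llp := by
    rintro _ _ _ ⟨K, L, Z, j, hj⟩
    have hj' : (fibs P).llp j := by
      rw [← e]
      exact hj
    exact ((isDeformationRetract_of_llp_fibs P hj').whiskerRight Z).llp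
  have h2 : (MonoidalModel.trivialCofibrationsTensor (ChainComplex A ℤ)).pushouts ≤
      (degreewiseSplitEpi (A := A)).llp :=
    MorphismProperty.pushouts_le_iff.2 h1
  have h3 := MorphismProperty.transfiniteCompositions_le_iff.{0}.2 h2
  intro K L f hf
  exact (isDeformationRetract_of_llp (h3 _ hf)).mem W hW

end Main

end Axioms
end DGModel


/-! ### Limits in a comma category whose left functor has a right adjoint -/

namespace CommaLimits
universe v₁ v₂ v₃ v₄ u₁ u₂ u₃ u₄

variable {D : Type u₁} [Category.{v₁} D] {S : Type u₂} [Category.{v₂} S] {T : Type u₃}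
  [Category.{v₃} T] {L : D ⥤ T} {G : T ⥤ D} (adj : L ⊣ G) (R : S ⥤ T) {J : Type u₄}
  [Category.{v₄} J] [HasLimitsOfShape J D] [HasPullbacks D] [HasLimitsOfShape J S]
  (F : J ⥤ Comma L R)

/-- The transposes of the structure maps. -/
def transposeHom : F ⋙ Comma.fst L R ⟶ (F ⋙ Comma.snd L R) ⋙ R ⋙ G where
  app j := adj.homEquiv _ _ (F.obj j).hom
  naturality i j f := by
    refine (adj.homEquiv_naturality_left _ _).symm.trans
      (Eq.trans ?_ (adj.homEquiv_naturality_right _ _))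
    exact congrArg _ (F.map f).w

/-- The comparison map for the limit of the second components. -/
def limitComparison : (R ⋙ G).obj (limit (F ⋙ Comma.snd L R)) ⟶
    limit ((F ⋙ Comma.snd L R) ⋙ R ⋙ G) := limit.post _ _

/-- The limit object: its first component is a pullback. -/
def limitObj : Comma L R where
  -- Transposed along L ⊣ G, a structure map for the limit is a map to G R (lim). Its compatibility
  -- with the structure maps of all F j is a condition over lim G R F, which the pullback imposes.
  left := pullback (limMap (transposeHom adj R F)) (limitComparison R F (G := G))
  right := limit (F ⋙ Comma.snd L R)
  hom := (adj.homEquiv _ _).symm (pullback.snd _ _)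

/-- The limit cone. -/
def limitCone : Cone F where
  pt := limitObj adj R F
  π :=
    { app := fun j =>
        { left := pullback.fst _ _ ≫ limit.π (F ⋙ Comma.fst L R) j
          right := limit.π (F ⋙ Comma.snd L R) j
          w := by
            apply (adj.homEquiv _ _).injective
            have e1 := adj.homEquiv_naturality_left (pullback.fst (limMap (transposeHom adj R F))
              (limitComparison R F (G := G)) ≫ limit.π (F ⋙ Comma.fst L R) j) (F.obj j).hom
            have e2 := adj.homEquiv_naturality_right ((adj.homEquiv _ _).symm
              (pullback.snd (limMap (transposeHom adj R F)) (limitComparison R F (G := G))))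
              (R.map (limit.π (F ⋙ Comma.snd L R) j))
            refine e1.trans (Eq.trans ?_ e2.symm)
            rw [Equiv.apply_symm_apply]
            have e3 : limMap (transposeHom adj R F) ≫ limit.π _ j =
              limit.π (F ⋙ Comma.fst L R) j ≫ adj.homEquiv _ _ (F.obj j).hom := limMap_π _ _
            have e4 : limitComparison R F (G := G) ≫ limit.π _ j =
              G.map (R.map (limit.π (F ⋙ Comma.snd L R) j)) := limit.post_π _ _ _
            rw [Category.assoc, ← e3, pullback.condition_assoc, e4] }
      naturality := fun i j f => by
        apply CommaMorphism.ext
        · change 𝟙 _ ≫ pullback.fst _ _ ≫ limit.π (F ⋙ Comma.fst L R) j =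
            (pullback.fst _ _ ≫ limit.π (F ⋙ Comma.fst L R) i) ≫ (F ⋙ Comma.fst L R).map f
          rw [Category.id_comp, Category.assoc, limit.w]
        · exact (Category.id_comp _).trans (limit.w (F ⋙ Comma.snd L R) f).symm }

/-- The first component of the map to the limit. -/
def limitLiftLeft (s : Cone F) : s.pt.left ⟶
    pullback (limMap (transposeHom adj R F)) (limitComparison R F (G := G)) :=
  pullback.lift (limit.lift (F ⋙ Comma.fst L R) ((Comma.fst L R).mapCone s))
    (adj.homEquiv _ _ (s.pt.hom ≫ R.map
      (limit.lift (F ⋙ Comma.snd L R) ((Comma.snd L R).mapCone s)))) (by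
    apply limit.hom_ext
    intro j
    have e4 : limitComparison R F (G := G) ≫ limit.π _ j =
      G.map (R.map (limit.π (F ⋙ Comma.snd L R) j)) := limit.post_π _ _ _
    have e3 : limMap (transposeHom adj R F) ≫ limit.π _ j =
      limit.π (F ⋙ Comma.fst L R) j ≫ adj.homEquiv _ _ (F.obj j).hom := limMap_π _ _
    rw [Category.assoc, Category.assoc, e4, e3, limit.lift_π_assoc]
    refine (adj.homEquiv_naturality_left _ _).symm.trans
      (Eq.trans ?_ (adj.homEquiv_naturality_right _ _))
    rw [Category.assoc, ← R.map_comp, limit.lift_π]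
    exact congrArg _ (s.π.app j).w)

theorem limitLiftLeft_fst (s : Cone F) : limitLiftLeft adj R F s ≫ pullback.fst _ _ =
    limit.lift (F ⋙ Comma.fst L R) ((Comma.fst L R).mapCone s) := pullback.lift_fst _ _ _

theorem limitLiftLeft_snd (s : Cone F) : limitLiftLeft adj R F s ≫ pullback.snd _ _ =
    adj.homEquiv _ _ (s.pt.hom ≫ R.map
      (limit.lift (F ⋙ Comma.snd L R) ((Comma.snd L R).mapCone s))) := pullback.lift_snd _ _ _

/-- The cone is a limit cone. -/
def isLimitLimitCone : IsLimit (limitCone adj R F) where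
  lift s :=
    { left := limitLiftLeft adj R F s
      right := limit.lift (F ⋙ Comma.snd L R) ((Comma.snd L R).mapCone s)
      w := by
        apply (adj.homEquiv _ _).injective
        refine (adj.homEquiv_naturality_left _ _).trans ?_
        refine Eq.trans ?_ (limitLiftLeft_snd adj R F s)
        exact congrArg _ (Equiv.apply_symm_apply _ _) }
  fac s j := by
    apply CommaMorphism.ext
    · change limitLiftLeft adj R F s ≫ pullback.fst _ _ ≫ limit.π (F ⋙ Comma.fst L R) j = _
      refine (Category.assoc _ _ _).symm.trans ?_
      rw [limitLiftLeft_fst, limit.lift_π]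
      rfl
    · exact limit.lift_π ((Comma.snd L R).mapCone s) j
  uniq s m hm := by
    have h2 : m.right = limit.lift (F ⋙ Comma.snd L R) ((Comma.snd L R).mapCone s) := by
      apply limit.hom_ext
      intro j
      rw [limit.lift_π]
      exact congrArg CommaMorphism.right (hm j)
    apply CommaMorphism.ext
    · apply pullback.hom_ext
      · refine Eq.trans ?_ (limitLiftLeft_fst adj R F s).symm
        apply limit.hom_ext
        intro j
        rw [limit.lift_π]
        exact (Category.assoc _ _ _).trans (congrArg CommaMorphism.left (hm j))
      · refine Eq.trans ?_ (limitLiftLeft_snd adj R F s).symm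
        rw [← h2]
        refine Eq.trans ?_ (congrArg (adj.homEquiv _ _) m.w)
        refine Eq.trans ?_ (adj.homEquiv_naturality_left _ _).symm
        exact congrArg (m.left ≫ ·) (Equiv.apply_symm_apply _ _).symm
    · exact h2

include adj in
theorem hasLimitsOfShape : HasLimitsOfShape J (Comma L R) :=
  ⟨fun F => ⟨⟨limitCone adj R F, isLimitLimitCone adj R F⟩⟩⟩

end CommaLimits

/-! ### Limits in the algebraic model -/

namespace ZpModel
variable (p : ℕ) [Fact p.Prime]

/-- The discrete part, as a functor. -/
def discPart : Rep.{0} ℚ (Gp p) ⥤ DiscMod p where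
  obj M := discrete M.ρ
  map {M N} f := mkHom (X := discrete M.ρ) (Y := discrete N.ρ)
    (f.hom.toLinearMap.restrict (p := discretePart M.ρ) (q := discretePart N.ρ) (by
      rintro v ⟨n, hn⟩
      refine ⟨n, fun g hg => ?_⟩
      have := Rep.hom_comm_apply f g v
      rw [hn g hg] at this
      exact this.symm)) (fun g v => Subtype.ext (Rep.hom_comm_apply f g v.1))
  map_id _ := rfl
  map_comp _ _ := rfl

/-- The discrete part is right adjoint to the inclusion. -/
def discPartAdj : (IsDiscrete p).ι ⊣ discPart p :=
  Adjunction.mkOfHomEquiv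
    { homEquiv := fun X M =>
        { toFun := fun f => mkHom (X := X) (Y := discrete M.ρ)
            (f.hom.toLinearMap.codRestrict (discretePart M.ρ) (fun v => by
              obtain ⟨n, hn⟩ := X.property v
              refine ⟨n, fun g hg => ?_⟩
              have := Rep.hom_comm_apply f g v
              have h2 : X.obj.ρ g v = v := hn g hg
              exact this.symm.trans (congrArg f.hom h2)))
            (fun g v => Subtype.ext (Rep.hom_comm_apply f g v))
          invFun := fun f => Rep.ofHom ⟨(discretePart M.ρ).subtype ∘ₗ lin f, fun g =>
            LinearMap.ext fun v => congrArg Subtype.val (lin_comm f g v)⟩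
          left_inv := fun _ => rfl
          right_inv := fun _ => rfl }
      homEquiv_naturality_left_symm := fun _ _ => rfl
      homEquiv_naturality_right := fun _ _ => rfl }

instance : HasLimits (DiscMod p) := by
  have : Coreflective (IsDiscrete p).ι := ⟨discPart p, discPartAdj p⟩
  exact hasLimits_of_coreflective (IsDiscrete p).ι

instance : HasLimits (Fam p) :=
  ⟨fun _ _ => ⟨fun _ => pi.hasLimit_of_hasLimit_comp_eval⟩⟩

instance : HasLimits (AlgModel p) :=
  ⟨fun _ _ => CommaLimits.hasLimitsOfShape (discPartAdj p) _⟩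

instance : HasLimits (DG p) := ⟨fun _ _ => inferInstance⟩

end ZpModel


/-! ### Rational linear algebra and averaging -/

namespace ZpModel

section LinearAlgebra

variable {Q M N : Type} [AddCommGroup Q] [Module ℚ Q] [AddCommGroup M] [Module ℚ M]
  [AddCommGroup N] [Module ℚ N]

/-- Vector spaces are projective. Only the image of x has to be reached by f; this matters later for
maps into biproducts which need not be surjective. -/
theorem exists_linear_lift (f : M →ₗ[ℚ] N) (x : Q →ₗ[ℚ] N) (h : ∀ q, ∃ m, f m = x q) :
    ∃ y : Q →ₗ[ℚ] M, ∀ q, f (y q) = x q := by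
  obtain ⟨y, hy⟩ := Module.projective_lifting_property f.rangeRestrict
    (x.codRestrict (LinearMap.range f) h) f.surjective_rangeRestrict
  exact ⟨y, fun q => congrArg Subtype.val (LinearMap.congr_fun hy q)⟩

/-- Each vector of a finite basis lies in some `P i`, and by directedness one member of the family
contains all of them. Every use of finite-dimensionality below goes through this. -/
theorem exists_eq_top [Module.Finite ℚ Q] {ι : Type} [Nonempty ι] (P : ι → Submodule ℚ Q)
    (hd : Directed (· ≤ ·) P) (h : ∀ v, ∃ i, v ∈ P i) : ∃ i, P i = ⊤ := by
  let b := Module.finBasis ℚ Q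
  choose i hi using fun j => h (b j)
  obtain ⟨k, hk⟩ := hd.finite_le i
  refine ⟨k, eq_top_iff.2 ?_⟩
  rw [← b.span_eq, Submodule.span_le]
  rintro _ ⟨j, rfl⟩
  exact hk j (hi j)

theorem eventually_eq [Module.Finite ℚ Q] {W : ℕ → Type} [∀ k, AddCommGroup (W k)]
    [∀ k, Module ℚ (W k)] (a b : ∀ k, Q →ₗ[ℚ] W k)
    (h : ∀ v, ∃ n, ∀ k, n ≤ k → a k v = b k v) : ∃ n, ∀ k, n ≤ k → ∀ v, a k v = b k v := by
  let P : ℕ → Submodule ℚ Q := fun n => ⨅ (k) (_ : n ≤ k), LinearMap.eqLocus (a k) (b k)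
  have hP : ∀ n v, v ∈ P n ↔ ∀ k, n ≤ k → a k v = b k v := by
    intro n v
    simp [P, Submodule.mem_iInf]
  obtain ⟨n, hn⟩ := exists_eq_top P (directed_of_isDirected_le fun m n hmn v hv =>
    (hP n v).2 fun k hk => (hP m v).1 hv k (hmn.trans hk)) (fun v => by
      obtain ⟨n, hn⟩ := h v
      exact ⟨n, (hP n v).2 hn⟩)
  exact ⟨n, fun k hk v => (hP n v).1 (hn ▸ Submodule.mem_top) k hk⟩

/-- Averaging over a finite quotient group. -/
theorem exists_average {Γ H : Type} [Group Γ] [Group H] [Finite H] (π : Γ →* H) (l : H → Γ)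
    (hl : ∀ h, π (l h) = h) (ρ : Representation ℚ Γ Q) (τ : Representation ℚ Γ M) (y : Q →ₗ[ℚ] M)
    (hy : ∀ g g', π g = π g' → ∀ q, τ g (y (ρ g⁻¹ q)) = τ g' (y (ρ g'⁻¹ q)))
    (f : M →ₗ[ℚ] N) (hf : ∀ g q, f (τ g (y (ρ g⁻¹ q))) = f (y q)) :
    ∃ y' : Q →ₗ[ℚ] M, (∀ g q, y' (ρ g q) = τ g (y' q)) ∧ ∀ q, f (y' q) = f (y q) := by
  have := Fintype.ofFinite H
  refine ⟨(Fintype.card H : ℚ)⁻¹ • ∑ h, τ (l h) ∘ₗ y ∘ₗ ρ (l h)⁻¹, fun g q => ?_, fun q => ?_⟩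
  · simp only [LinearMap.smul_apply, LinearMap.sum_apply, LinearMap.comp_apply, map_smul, map_sum]
    congr 1
    refine Fintype.sum_equiv (Equiv.mulLeft (π g)⁻¹) _ _ fun h => ?_
    -- The elements l h and g · l(π(g)⁻¹ h) have the same image in H, so by `hy` they conjugate y in
    -- the same way. Hence translating the sum by g only permutes its terms.
    have e := hy (l h) (g * l ((π g)⁻¹ * h)) (by rw [map_mul, hl, hl, mul_inv_cancel_left])
      (ρ g q)
    rw [e, map_mul, mul_inv_rev, map_mul, Module.End.mul_apply, Module.End.mul_apply,
      ← Module.End.mul_apply (ρ g⁻¹), ← map_mul, inv_mul_cancel, map_one, Module.End.one_apply]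
    rfl
  · simp only [LinearMap.smul_apply, LinearMap.sum_apply, LinearMap.comp_apply, map_smul, map_sum,
      hf]
    rw [Finset.sum_const, Finset.card_univ, ← Nat.cast_smul_eq_nsmul ℚ, smul_smul,
      inv_mul_cancel₀ (Nat.cast_ne_zero.2 Fintype.card_ne_zero), one_smul]

end LinearAlgebra

variable {p : ℕ} [Fact p.Prime]

instance (k : ℕ) : Finite (Gk p k) := by
  have : NeZero (p ^ k) := ⟨pow_ne_zero _ (Fact.out : p.Prime).ne_zero⟩
  exact inferInstanceAs (Finite (ZMod (p ^ k)))

/-- The underlying linear map of a map of representations. -/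
abbrev rlin {G : Type} [Group G] {M N : Rep.{0} ℚ G} (f : M ⟶ N) : M.V →ₗ[ℚ] N.V :=
  f.hom.toLinearMap

theorem rlin_ext {G : Type} [Group G] {M N : Rep.{0} ℚ G} {f g : M ⟶ N}
    (h : ∀ x, rlin f x = rlin g x) : f = g := by
  apply Rep.hom_ext
  apply Representation.IntertwiningMap.ext
  exact LinearMap.ext h

theorem rlin_comm {G : Type} [Group G] {M N : Rep.{0} ℚ G} (f : M ⟶ N) (g : G) (x : M.V) :
    rlin f (M.ρ g x) = N.ρ g (rlin f x) := Rep.hom_comm_apply f g x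

/-- An equivariant linear map as a map of representations. -/
def mkRep {G : Type} [Group G] {M N : Rep.{0} ℚ G} (f : M.V →ₗ[ℚ] N.V)
    (h : ∀ g x, f (M.ρ g x) = N.ρ g (f x)) : M ⟶ N :=
  Rep.ofHom ⟨f, fun g => LinearMap.ext (h g)⟩

@[simp]
theorem rlin_mkRep {G : Type} [Group G] {M N : Rep.{0} ℚ G} (f : M.V →ₗ[ℚ] N.V)
    (h : ∀ g x, f (M.ρ g x) = N.ρ g (f x)) : rlin (mkRep f h) = f := rfl

theorem rep_inv_self {G V : Type} [Group G] [AddCommGroup V] [Module ℚ V]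
    (ρ : Representation ℚ G V) (g : G) (v : V) : ρ g (ρ g⁻¹ v) = v := by
  rw [← Module.End.mul_apply, ← map_mul, mul_inv_cancel, map_one, Module.End.one_apply]

theorem rep_mul_apply {G V : Type} [Group G] [AddCommGroup V] [Module ℚ V]
    (ρ : Representation ℚ G V) (g h : G) (v : V) : ρ (g * h) v = ρ g (ρ h v) := by
  rw [map_mul, Module.End.mul_apply]

theorem exists_rep_of_linear {G : Type} [Group G] [Finite G] {Q M N : Rep.{0} ℚ G} (f : M ⟶ N)
    (x : Q ⟶ N) (y : Q.V →ₗ[ℚ] M.V) (hy : ∀ q, rlin f (y q) = rlin x q) :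
    ∃ y' : Q ⟶ M, y' ≫ f = x := by
  obtain ⟨y', h1, h2⟩ := exists_average (MonoidHom.id G) id (fun _ => rfl) Q.ρ M.ρ y
    (by rintro g _ rfl q; rfl) (rlin f) (fun g q => by
      rw [rlin_comm, hy, ← rlin_comm, rep_inv_self, hy])
  exact ⟨mkRep y' h1, rlin_ext fun q => (h2 q).trans (hy q)⟩

theorem exists_rep_lift {G : Type} [Group G] [Finite G] {Q M N : Rep.{0} ℚ G} (f : M ⟶ N)
    (x : Q ⟶ N) (h : ∀ q, ∃ m, rlin f m = rlin x q) : ∃ y' : Q ⟶ M, y' ≫ f = x := by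
  obtain ⟨y, hy⟩ := exists_linear_lift (rlin f) (rlin x) h
  exact exists_rep_of_linear f x y hy

theorem exists_level {Q : Type} [AddCommGroup Q] [Module ℚ Q] [Module.Finite ℚ Q] (M : DiscMod p)
    (y : Q →ₗ[ℚ] M.obj.V) : ∃ n : ℕ, ∀ g : Gp p, InLevel n g → ∀ q, M.obj.ρ g (y q) = y q := by
  let P : ℕ → Submodule ℚ Q := fun n => (fixedSub M.obj.ρ n).comap y
  obtain ⟨n, hn⟩ := exists_eq_top P (directed_of_isDirected_le fun m n hmn v hv g hg =>
    hv g (hg.mono hmn)) (fun v => M.property (y v))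
  exact ⟨n, fun g hg q => (show q ∈ P n from hn ▸ Submodule.mem_top) g hg⟩

/-- By finite-dimensionality some p^a ℤ_p fixes the image of y and some p^b ℤ_p fixes Q. The
conjugates of y then depend on the class modulo p^max(a,b) only, and one averages over that finite
quotient. -/
theorem exists_disc_of_linear {Q M N : DiscMod p} [Module.Finite ℚ Q.obj.V] (f : M ⟶ N)
    (x : Q ⟶ N) (y : Q.obj.V →ₗ[ℚ] M.obj.V) (hy : ∀ q, lin f (y q) = lin x q) :
    ∃ y' : Q ⟶ M, y' ≫ f = x := by
  obtain ⟨a, ha⟩ := exists_level M y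
  obtain ⟨b, hb⟩ := exists_level Q LinearMap.id
  obtain ⟨y', h1, h2⟩ := exists_average (proj p (max a b)) (liftGk _) (proj_liftGk _) Q.obj.ρ
    M.obj.ρ y (by
      intro g g' hgg q
      have e1 : Q.obj.ρ g⁻¹ q = Q.obj.ρ g'⁻¹ q := by
        apply fixed_eq Q.obj.ρ (max a b) (by rw [map_inv, map_inv, hgg])
        intro h hh
        exact hb h (hh.mono (le_max_right _ _)) q
      rw [e1]
      apply fixed_eq M.obj.ρ (max a b) hgg
      intro h hh
      exact ha h (hh.mono (le_max_left _ _)) _) (lin f) (fun g q => by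
      rw [lin_comm, hy, ← lin_comm, rep_inv_self, hy])
  exact ⟨mkHom y' h1, lin_ext fun q => (h2 q).trans (hy q)⟩

theorem exists_disc_lift {Q M N : DiscMod p} [Module.Finite ℚ Q.obj.V] (f : M ⟶ N)
    (x : Q ⟶ N) (h : ∀ q, ∃ m, lin f m = lin x q) : ∃ y' : Q ⟶ M, y' ≫ f = x := by
  obtain ⟨y, hy⟩ := exists_linear_lift (lin f) (lin x) h
  exact exists_disc_of_linear f x y hy

/-! ### Good objects are projective for pointwise surjections -/

section Good

/-- The structure maps are compatible with `y` and `z`. -/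
def Compat {Q M : AlgModel p} (y : Q.left ⟶ M.left) (z : Q.right ⟶ M.right) : Prop :=
  ∀ q, str M (lin y q) = tailsMap (fun k => rlin (z k)) (str Q q)

theorem compat_hom {Q M : AlgModel p} (f : Q ⟶ M) : Compat f.left f.right := fun q =>
  congrArg (fun φ => φ.hom q) f.w

/-- The map with given components. -/
def mkAlg {Q M : AlgModel p} (y : Q.left ⟶ M.left) (z : Q.right ⟶ M.right) (h : Compat y z) :
    Q ⟶ M where
  left := y
  right := z
  w := by
    apply rlin_ext
    exact h

/-- The object `Q` is finite-dimensional at each point and constant near infinity. -/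
structure Good (Q : AlgModel p) where
  /-- The maps which induce the structure map. -/
  s : ∀ k, Q.left.obj.V →ₗ[ℚ] (Q.right k).V
  s_act : ∀ k g v, s k (Q.left.obj.ρ g v) = (Q.right k).ρ (proj p k g) (s k v)
  str_eq : ∀ v, str Q v = tailsMk (fun k => (Q.right k).V) fun k => s k v
  /-- The maps are bijective from here on. -/
  N : ℕ
  bij : ∀ k, N ≤ k → Function.Bijective (s k)
  fin_left : Module.Finite ℚ Q.left.obj.V
  fin_right : ∀ k, Module.Finite ℚ (Q.right k).V

/-- A topological generator of `ℤ_p`. -/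
def gen (p : ℕ) [Fact p.Prime] : Gp p := Multiplicative.ofAdd 1

theorem proj_gen_pow (k : ℕ) (g : Gk p k) : ∃ n : ℕ, g = proj p k (gen p) ^ n := by
  refine ⟨(Multiplicative.toAdd g).val, ?_⟩
  conv_lhs => rw [← proj_liftGk k g]
  rw [← map_pow]
  congr 1
  change _ = Multiplicative.ofAdd ((Multiplicative.toAdd g).val • (1 : ℤ_[p]))
  rw [nsmul_one]
  rfl

theorem comm_of_gen {k : ℕ} {V W : Rep.{0} ℚ (Gk p k)} (f : V.V →ₗ[ℚ] W.V)
    (h : ∀ v, f (V.ρ (proj p k (gen p)) v) = W.ρ (proj p k (gen p)) (f v)) (g : Gk p k) (v : V.V) :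
    f (V.ρ g v) = W.ρ g (f v) := by
  obtain ⟨n, rfl⟩ := proj_gen_pow k g
  induction n generalizing v with
  | zero => simp
  | succ n ih => rw [pow_succ, rep_mul_apply, rep_mul_apply, ih, h]

variable {Q M N : AlgModel p} (hQ : Good Q)
include hQ

/-- Choose linear maps w_k : Q_∞ → M_k which represent the tails of σ_M ∘ y. For large k they
commute with the topological generator of ℤ_p, and hence with ℤ/p^k, which its image generates.
Transporting w_k along the bijection Q_∞ → Q_k gives z_k for large k; the remaining components,
which do not affect tails, are zero. -/
theorem Good.exists_compat (y : Q.left ⟶ M.left) : ∃ z : Q.right ⟶ M.right, Compat y z := by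
  have := hQ.fin_left
  obtain ⟨w, hw⟩ := exists_linear_lift (tailsMk fun k => (M.right k).V) (str M ∘ₗ lin y)
    fun q => tailsMk_surjective _
  -- Equivariance is tested on one generator: bounds found separately for each group element could
  -- be unbounded.
  obtain ⟨n, hn⟩ := eventually_eq
    (fun k => LinearMap.proj (φ := fun k => (M.right k).V) k ∘ₗ w ∘ₗ Q.left.obj.ρ (gen p))
    (fun k => (M.right k).ρ (proj p k (gen p)) ∘ₗ LinearMap.proj k ∘ₗ w) (fun v => by
      have e : tailsMk (fun k => (M.right k).V) (w (Q.left.obj.ρ (gen p) v)) =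
          tailsMk _ (fun k => (M.right k).ρ (proj p k (gen p)) (w v k)) := by
        rw [hw]
        change str M (lin y _) = tailsRep p M.right (gen p) (tailsMk _ (w v))
        rw [lin_comm, str_act, hw]
        rfl
      exact tailsMk_eq_iff.1 e)
  classical
  let K := max n hQ.N
  let e : ∀ k, K ≤ k → Q.left.obj.V ≃ₗ[ℚ] (Q.right k).V := fun k hk =>
    LinearEquiv.ofBijective (hQ.s k) (hQ.bij k ((le_max_right _ _).trans hk))
  have hc : ∀ k (hk : K ≤ k) v,
      (LinearMap.proj (φ := fun k => (M.right k).V) k ∘ₗ w ∘ₗ (e k hk).symm.toLinearMap)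
        ((Q.right k).ρ (proj p k (gen p)) v) = (M.right k).ρ (proj p k (gen p))
        ((LinearMap.proj (φ := fun k => (M.right k).V) k ∘ₗ w ∘ₗ (e k hk).symm.toLinearMap) v) := by
    intro k hk v
    obtain ⟨u, rfl⟩ := (e k hk).surjective v
    have e1 : (Q.right k).ρ (proj p k (gen p)) (e k hk u) = e k hk (Q.left.obj.ρ (gen p) u) :=
      (hQ.s_act k (gen p) u).symm
    rw [e1]
    simp only [LinearMap.comp_apply, LinearEquiv.coe_coe, LinearEquiv.symm_apply_apply]
    exact hn k ((le_max_left _ _).trans hk) u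
  let z : Q.right ⟶ M.right := fun k =>
    if hk : K ≤ k then mkRep _ (comm_of_gen _ (hc k hk)) else 0
  have hz : ∀ k (hk : K ≤ k) v, rlin (z k) (hQ.s k v) = w v k := by
    intro k hk v
    have : z k = mkRep _ (comm_of_gen _ (hc k hk)) := dif_pos hk
    rw [this, rlin_mkRep]
    exact congrArg (fun u => w u k) ((e k hk).symm_apply_apply v)
  refine ⟨z, fun q => ?_⟩
  rw [hQ.str_eq, tailsMap_mk]
  refine (hw q).symm.trans ?_
  rw [tailsMk_eq_iff]
  exact ⟨K, fun k hk => (hz k hk q).symm⟩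

omit hQ in
theorem Compat.congr {y : Q.left ⟶ M.left} {z z' : Q.right ⟶ M.right} (h : Compat y z) {K : ℕ}
    (hz : ∀ k, K ≤ k → z' k = z k) : Compat y z' := by
  intro q
  rw [h q]
  obtain ⟨v, hv⟩ := tailsMk_surjective (str Q q)
  rw [← hv, tailsMap_mk, tailsMap_mk, tailsMk_eq_iff]
  exact ⟨K, fun k hk => by rw [hz k hk]⟩

/-- Both z and z' agree in the tails on the image of Q_∞, uniformly because Q_∞ is
finite-dimensional; and for large k the map Q_∞ → Q_k is onto. -/
theorem Good.eventually_eq {y : Q.left ⟶ M.left} {z z' : Q.right ⟶ M.right} (h : Compat y z)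
    (h' : Compat y z') : ∃ K, ∀ k, K ≤ k → z k = z' k := by
  have := hQ.fin_left
  obtain ⟨n, hn⟩ := ZpModel.eventually_eq (fun k => rlin (z k) ∘ₗ hQ.s k)
    (fun k => rlin (z' k) ∘ₗ hQ.s k) (fun v => by
      have e := (h v).symm.trans (h' v)
      rw [hQ.str_eq, tailsMap_mk, tailsMap_mk, tailsMk_eq_iff] at e
      exact e)
  refine ⟨max n hQ.N, fun k hk => rlin_ext fun v => ?_⟩
  obtain ⟨u, rfl⟩ := (hQ.bij k ((le_max_right _ _).trans hk)).2 v
  exact hn k ((le_max_left _ _).trans hk) u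

/-- Maps out of `Q` lift if they lift at each point. -/
theorem Good.exists_lift (f : M ⟶ N) (x : Q ⟶ N)
    (h : ∀ q, ∃ m, lin f.left m = lin x.left q)
    (h' : ∀ k q, ∃ m, rlin (f.right k) m = rlin (x.right k) q) : ∃ z : Q ⟶ M, z ≫ f = x := by
  have := hQ.fin_left
  obtain ⟨y, hy⟩ := exists_disc_lift f.left x.left h
  obtain ⟨z, hz⟩ := hQ.exists_compat y
  choose z' hz' using fun k => exists_rep_lift (f.right k) (x.right k) (h' k)
  -- Both z ≫ f and x are compatible with the same map at ∞, so z lifts x at all large k. At the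
  -- finitely many other k it is replaced by any pointwise lift.
  have h1 : Compat x.left (z ≫ f.right) := by
    rw [← hy]
    exact compat_hom (mkAlg y z hz ≫ f)
  obtain ⟨K, hK⟩ := hQ.eventually_eq h1 (compat_hom x)
  classical
  let t : Q.right ⟶ M.right := fun k => if K ≤ k then z k else z' k
  have ht : Compat y t := hz.congr (K := K) fun k hk => if_pos hk
  refine ⟨mkAlg y t ht, ?_⟩
  apply CommaMorphism.ext
  · exact hy
  · funext k
    change t k ≫ f.right k = x.right k
    by_cases hk : K ≤ k
    · rw [show t k = z k from if_pos hk]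
      exact hK k hk
    · rw [show t k = z' k from if_neg hk]
      exact hz' k

end Good
end ZpModel


/-! ### Good objects are compact -/

namespace ZpModel
variable {p : ℕ} [Fact p.Prime]

theorem preservesColimits_fst (J : Type) [SmallCategory J] :
    PreservesColimitsOfShape J (Comma.fst (IsDiscrete p).ι (tails p)) where
  preservesColimit {F} := preservesColimit_of_preserves_colimit_cocone
    (Comma.coconeOfPreservesIsColimit F (colimit.isColimit _) (colimit.isColimit _))
    (colimit.isColimit (F ⋙ Comma.fst _ _))

theorem preservesColimits_snd (J : Type) [SmallCategory J] :
    PreservesColimitsOfShape J (Comma.snd (IsDiscrete p).ι (tails p)) where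
  preservesColimit {F} := preservesColimit_of_preserves_colimit_cocone
    (Comma.coconeOfPreservesIsColimit F (colimit.isColimit _) (colimit.isColimit _))
    (colimit.isColimit (F ⋙ Comma.snd _ _))

instance (J : Type) [SmallCategory J] : PreservesColimitsOfShape J (evalInfty p) := by
  have := preservesColimits_fst (p := p) J
  have : PreservesColimitsOfShape J ((IsDiscrete p).ι) := inferInstance
  exact comp_preservesColimitsOfShape _ _

instance (J : Type) [SmallCategory J] (k : ℕ) : PreservesColimitsOfShape J (evalAt p k) := by
  have := preservesColimits_snd (p := p) J
  have : PreservesColimitsOfShape J (Pi.eval (fun k => Rep.{0} ℚ (Gk p k)) k) :=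
    ⟨fun {F} => preservesColimit_of_preserves_colimit_cocone
      (pi.coconeOfCoconeEvalIsColimit (F := F) fun _ => colimit.isColimit _)
      (colimit.isColimit (F ⋙ Pi.eval _ k))⟩
  exact comp_preservesColimitsOfShape _ _

section Filtered

variable {J : Type} [SmallCategory J] [IsFiltered J] {F : J ⥤ AlgModel p} {c : Cocone F}
  (hc : IsColimit c) (E : AlgModel p ⥤ ModuleCat.{0} ℚ) [PreservesColimitsOfShape J E]
  {Q : Type} [AddCommGroup Q] [Module ℚ Q] [Module.Finite ℚ Q]

include hc

theorem exists_stage (x : Q →ₗ[ℚ] E.obj c.pt) :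
    ∃ j, ∀ q, ∃ m : E.obj (F.obj j), E.map (c.ι.app j) m = x q := by
  let P : J → Submodule ℚ Q := fun j => (LinearMap.range (E.map (c.ι.app j)).hom).comap x
  have mono : ∀ i j (f : i ⟶ j), P i ≤ P j := by
    rintro i j f v ⟨m, hm⟩
    refine ⟨E.map (F.map f) m, ?_⟩
    rw [← hm, ← c.w f, E.map_comp]
    rfl
  have := IsFiltered.nonempty (C := J)
  obtain ⟨j, hj⟩ := exists_eq_top P (fun i j => ⟨IsFiltered.max i j,
    mono _ _ (IsFiltered.leftToMax i j), mono _ _ (IsFiltered.rightToMax i j)⟩) (fun v =>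
      Concrete.isColimit_exists_rep (F ⋙ E) (isColimitOfPreserves E hc) (x v))
  exact ⟨j, fun q => (show q ∈ P j from hj ▸ Submodule.mem_top)⟩

theorem exists_stage_zero {j : J} (x : Q →ₗ[ℚ] E.obj (F.obj j))
    (hx : ∀ q, E.map (c.ι.app j) (x q) = 0) :
    ∃ (k : J) (f : j ⟶ k), ∀ q, E.map (F.map f) (x q) = 0 := by
  let P : (Σ k, (j ⟶ k)) → Submodule ℚ Q := fun f =>
    (LinearMap.ker (E.map (F.map f.2)).hom).comap x
  have mono : ∀ (k l : J) (f : j ⟶ k) (g : k ⟶ l), P ⟨k, f⟩ ≤ P ⟨l, f ≫ g⟩ := by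
    intro k l f g v hv
    have hv' : E.map (F.map f) (x v) = 0 := hv
    change E.map (F.map (f ≫ g)) (x v) = 0
    rw [F.map_comp, E.map_comp]
    change E.map (F.map g) (E.map (F.map f) (x v)) = 0
    rw [hv', map_zero]
  have : Nonempty (Σ k, (j ⟶ k)) := ⟨⟨j, 𝟙 j⟩⟩
  obtain ⟨⟨k, f⟩, hj⟩ := exists_eq_top P (by
      rintro ⟨k, f⟩ ⟨l, g⟩
      obtain ⟨m, u, v, h⟩ := IsFiltered.span f g
      exact ⟨⟨m, f ≫ u⟩, mono _ _ _ _, h ▸ mono _ _ _ _⟩) (fun v => by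
      obtain ⟨k, f, g, h⟩ := Concrete.isColimit_exists_of_rep_eq (F ⋙ E)
        (isColimitOfPreserves E hc) (x v) (0 : E.obj (F.obj j)) (by
          refine (hx v).trans (map_zero (E.map (c.ι.app j)).hom).symm)
      exact ⟨⟨k, f⟩, h.trans (map_zero (E.map (F.map g)).hom)⟩)
  exact ⟨k, f, fun q => (show q ∈ P ⟨k, f⟩ from hj ▸ Submodule.mem_top)⟩

end Filtered

-- A map out of a good object is given, for all but finitely many k, by its component at ∞. So only
-- ∞ and finitely many k have to be moved to a stage of the colimit, each of which is possible
-- because the spaces are finite-dimensional, and filteredness provides a common stage.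
open DGModel in
theorem Good.isCompactObj {Q : AlgModel p} (hQ : Good Q) : IsCompactObj Q := by
  have := hQ.fin_left
  have := hQ.fin_right
  classical
  intro J _ _ F c hc
  constructor
  · intro x
    obtain ⟨j₀, h₀⟩ := exists_stage hc (evalInfty p) (lin x.left)
    obtain ⟨y, hy⟩ := exists_disc_lift (c.ι.app j₀).left x.left h₀
    obtain ⟨z, hz⟩ := hQ.exists_compat y
    have h1 : Compat x.left (z ≫ (c.ι.app j₀).right) := by
      rw [← hy]
      exact compat_hom (mkAlg y z hz ≫ c.ι.app j₀)
    obtain ⟨K, hK⟩ := hQ.eventually_eq h1 (compat_hom x)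
    have hs : ∀ k, ∃ j, ∃ z' : Q.right k ⟶ (F.obj j).right k,
        z' ≫ (c.ι.app j).right k = x.right k := by
      intro k
      obtain ⟨j, hj⟩ := exists_stage hc (evalAt p k) (rlin (x.right k))
      exact ⟨j, exists_rep_lift ((c.ι.app j).right k) (x.right k) hj⟩
    choose j z' hz' using hs
    obtain ⟨l, hl⟩ := IsFiltered.sup_objs_exists (insert j₀ ((Finset.range K).image j))
    obtain ⟨f₀⟩ := hl (Finset.mem_insert_self _ _)
    have hl' : ∀ k, k < K → Nonempty (j k ⟶ l) := fun k hk => hl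
      (Finset.mem_insert_of_mem (Finset.mem_image_of_mem _ (Finset.mem_range.2 hk)))
    let t : Q.right ⟶ (F.obj l).right := fun k =>
      if hk : k < K then z' k ≫ (F.map (hl' k hk).some).right k
      else z k ≫ (F.map f₀).right k
    have h2 : Compat (y ≫ (F.map f₀).left) (z ≫ (F.map f₀).right) :=
      compat_hom (mkAlg y z hz ≫ F.map f₀)
    have ht : Compat (y ≫ (F.map f₀).left) t :=
      h2.congr (K := K) fun k hk => dif_neg (not_lt.2 hk)
    refine ⟨l, mkAlg _ t ht, ?_⟩
    apply CommaMorphism.ext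
    · change (y ≫ (F.map f₀).left) ≫ (c.ι.app l).left = x.left
      rw [Category.assoc, ← hy, ← c.w f₀]
      rfl
    · funext k
      change t k ≫ (c.ι.app l).right k = x.right k
      by_cases hk : k < K
      · rw [show t k = _ from dif_pos hk, Category.assoc, ← hz' k, ← c.w (hl' k hk).some]
        rfl
      · rw [show t k = _ from dif_neg hk, Category.assoc]
        refine Eq.trans ?_ (hK k (not_lt.1 hk))
        rw [← c.w f₀]
        rfl
  · intro j x hx
    obtain ⟨l, f, hf⟩ := exists_stage_zero hc (evalInfty p) (lin x.left)
      fun q => congrArg (fun u => lin u.left q) hx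
    have h0 : (x ≫ F.map f).left = 0 := lin_ext hf
    have h1 := compat_hom (x ≫ F.map f)
    rw [h0] at h1
    obtain ⟨K, hK⟩ := hQ.eventually_eq h1 (compat_hom (0 : Q ⟶ F.obj l))
    -- The components at k ≥ K vanish because the one at ∞ does; those below K are killed one after
    -- another by moving to later stages.
    have key : ∀ n, ∃ (m : J) (g : l ⟶ m), ∀ k, k < n → (x ≫ F.map f ≫ F.map g).right k = 0 := by
      intro n
      induction n with
      | zero => exact ⟨l, 𝟙 l, fun k hk => absurd hk (Nat.not_lt_zero k)⟩
      | succ n ih =>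
        obtain ⟨m, g, hg⟩ := ih
        obtain ⟨m', g', hg'⟩ := exists_stage_zero hc (evalAt p n)
          (rlin ((x ≫ F.map f ≫ F.map g).right n)) (fun q => by
            have e : (x ≫ F.map f ≫ F.map g) ≫ c.ι.app m = 0 := by
              rw [Category.assoc, Category.assoc, c.w, c.w, hx]
            exact congrArg (fun u => rlin (u.right n) q) e)
        refine ⟨m', g ≫ g', fun k hk => ?_⟩
        have e : x ≫ F.map f ≫ F.map (g ≫ g') = (x ≫ F.map f ≫ F.map g) ≫ F.map g' := by
          rw [F.map_comp]
          simp
        rw [e]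
        rcases Nat.lt_succ_iff_lt_or_eq.1 hk with hk | rfl
        · change (x ≫ F.map f ≫ F.map g).right k ≫ _ = 0
          rw [hg k hk, zero_comp]
        · exact rlin_ext hg'
    obtain ⟨m, g, hg⟩ := key K
    refine ⟨m, f ≫ g, ?_⟩
    rw [F.map_comp]
    apply CommaMorphism.ext
    · change (x ≫ F.map f).left ≫ (F.map g).left = 0
      rw [h0, zero_comp]
    · funext k
      by_cases hk : k < K
      · exact hg k hk
      · change (x ≫ F.map f).right k ≫ (F.map g).right k = 0
        rw [hK k (not_lt.1 hk)]
        exact zero_comp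

end ZpModel


/-! ### Surjective homology isomorphisms of complexes of vector spaces -/

namespace ZpModel

/-- Compatible pairs of a chain in the target and a cycle in the source lift. -/
def PairLift {K L : ChainComplex (ModuleCat.{0} ℚ) ℤ} (φ : K ⟶ L) : Prop :=
  ∀ (n n' : ℤ) (_ : n' + 1 = n) (b : L.X n) (e : K.X n'), (∀ n'', K.d n' n'' e = 0) →
    L.d n n' b = φ.f n' e → ∃ e' : K.X n, K.d n n' e' = e ∧ φ.f n e' = b

section Homology

variable {K L : ChainComplex (ModuleCat.{0} ℚ) ℤ} {φ : K ⟶ L}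

theorem d_d_apply (K : ChainComplex (ModuleCat.{0} ℚ) ℤ) (i j k : ℤ) (x : K.X i) :
    K.d j k (K.d i j x) = 0 :=
  congrArg (fun f => f.hom x) (K.d_comp_d i j k)

theorem f_d_apply (φ : K ⟶ L) (i j : ℤ) (x : K.X i) : L.d i j (φ.f i x) = φ.f j (K.d i j x) :=
  congrArg (fun f => f.hom x) (φ.comm i j)

theorem d_zero_of (K : ChainComplex (ModuleCat.{0} ℚ) ℤ) {n : ℤ} (x : K.X n)
    (h : K.d n (n - 1) x = 0) (m : ℤ) : K.d n m x = 0 := by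
  by_cases hm : m = n - 1
  · rw [hm, h]
  · rw [K.shape _ _ (by change ¬ (m + 1 = n); omega)]
    rfl

theorem PairLift.surjective (h : PairLift φ) (n : ℤ) : Function.Surjective (φ.f n) := by
  intro b
  obtain ⟨e, he, he'⟩ := h (n - 1) (n - 2) (by omega) (L.d n (n - 1) b) 0
    (fun _ => map_zero (K.d _ _).hom) (by
      rw [d_d_apply]
      exact (map_zero (φ.f _).hom).symm)
  obtain ⟨e', -, h'⟩ := h n (n - 1) (by omega) b e
    (d_zero_of K e (by rw [show n - 1 - 1 = n - 2 by omega]; exact he)) he'.symm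
  exact ⟨e', h'⟩

/-- Injectivity in homology is the lifting property for a cycle whose image bounds; surjectivity is
the case e = 0. Since ℚ-modules are projective, elementwise lifts assemble to linear maps, and the
test object needs no refinement. -/
theorem PairLift.quasiIso (h : PairLift φ) : QuasiIso φ := by
  rw [quasiIso_iff]
  intro j
  rw [quasiIsoAt_iff_isIso_homologyMap]
  have hm : Mono (HomologicalComplex.homologyMap φ j) := by
    rw [HomologicalComplex.mono_homologyMap_iff_up_to_refinements φ (j + 1) j (j - 1) (by simp)
      (by simp)]
    intro A x hx y hy
    obtain ⟨z, hz⟩ := exists_linear_lift (K.d (j + 1) j).hom x.hom (fun q => by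
      obtain ⟨e', h1, -⟩ := h (j + 1) j rfl (y q) (x q)
        (d_zero_of K _ (congrArg (fun f => f.hom q) hx)) (congrArg (fun f => f.hom q) hy).symm
      exact ⟨e', h1⟩)
    refine ⟨A, 𝟙 A, inferInstance, ModuleCat.ofHom z, ?_⟩
    ext q
    exact (hz q).symm
  have he : Epi (HomologicalComplex.homologyMap φ j) := by
    rw [HomologicalComplex.epi_homologyMap_iff_up_to_refinements φ (j + 1) j (j - 1) (by simp)
      (by simp)]
    intro A y hy
    obtain ⟨z, hz⟩ := exists_linear_lift ((K.d j (j - 1)).hom.prod (φ.f j).hom)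
      ((0 : A →ₗ[ℚ] K.X (j - 1)).prod y.hom) (fun q => by
      obtain ⟨e', h1, h2⟩ := h j (j - 1) (by omega) (y q) 0 (fun _ => map_zero (K.d _ _).hom)
        ((congrArg (fun f => f.hom q) hy).trans (map_zero (φ.f _).hom).symm)
      exact ⟨e', Prod.ext h1 h2⟩)
    refine ⟨A, 𝟙 A, inferInstance, ModuleCat.ofHom z, ?_, 0, ?_⟩
    · ext q
      exact congrArg Prod.fst (hz q)
    · rw [zero_comp, add_zero]
      ext q
      exact (congrArg Prod.snd (hz q)).symm
  exact isIso_of_mono_of_epi _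

/-- The map `ℚ → M` with value `m` at `1`. -/
def elt (M : ModuleCat.{0} ℚ) (m : M) : ModuleCat.of ℚ ℚ ⟶ M :=
  ModuleCat.ofHom (LinearMap.toSpanSingleton ℚ M m)

theorem elt_one (M : ModuleCat.{0} ℚ) (m : M) : elt M m (1 : ℚ) = m := one_smul ℚ m

theorem elt_comp {M N : ModuleCat.{0} ℚ} (m : M) (f : M ⟶ N) : elt M m ≫ f = elt N (f m) := by
  ext
  change f (elt M m (1 : ℚ)) = elt N (f m) (1 : ℚ)
  rw [elt_one, elt_one]

/-- Injectivity in homology gives x with d x = e. Then b - φ x is a cycle, so it equals φ y + d w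
with y a cycle, and w = φ v by surjectivity. The lift is x + y + d v. -/
theorem PairLift.of_quasiIso (hφ : QuasiIso φ) (hs : ∀ n, Function.Surjective (φ.f n)) :
    PairLift φ := by
  intro n n' hn b e he hb
  obtain rfl : n' = n - 1 := by omega
  have h1 := (quasiIso_iff φ).1 hφ (n - 1)
  have h2 := (quasiIso_iff φ).1 hφ n
  rw [quasiIsoAt_iff_isIso_homologyMap] at h1 h2
  have hm : Mono (HomologicalComplex.homologyMap φ (n - 1)) := inferInstance
  have hp : Epi (HomologicalComplex.homologyMap φ n) := inferInstance
  rw [HomologicalComplex.mono_homologyMap_iff_up_to_refinements φ n (n - 1) (n - 2) (by simp)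
    (by simp; omega)] at hm
  rw [HomologicalComplex.epi_homologyMap_iff_up_to_refinements φ (n + 1) n (n - 1) (by simp)
    (by simp)] at hp
  obtain ⟨A, π, hπ, x, hx⟩ := hm (elt _ e) (by
    rw [elt_comp, he]
    ext
    exact elt_one _ _) (elt _ b) (by rw [elt_comp, elt_comp, hb])
  -- The refinement π is onto ℚ. Evaluation at a preimage of 1 turns the statement about maps into
  -- one about e.
  obtain ⟨a, ha⟩ := (ModuleCat.epi_iff_surjective π).1 hπ (1 : ℚ)
  have hx' : K.d n (n - 1) (x a) = e := by
    have := congrArg (fun f => f.hom a) hx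
    refine Eq.trans this.symm ?_
    change elt _ e (π a) = e
    rw [ha, elt_one]
  have hc : L.d n (n - 1) (b - φ.f n (x a)) = 0 := by
    rw [map_sub, f_d_apply, hx', hb, sub_self]
  obtain ⟨A', π', hπ', y, hy, w, hw⟩ := hp (elt _ (b - φ.f n (x a))) (by
    rw [elt_comp, hc]
    ext
    exact elt_one _ _)
  obtain ⟨a', ha'⟩ := (ModuleCat.epi_iff_surjective π').1 hπ' (1 : ℚ)
  have hw' : b - φ.f n (x a) = φ.f n (y a') + L.d (n + 1) n (w a') := by
    have := congrArg (fun f => f.hom a') hw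
    refine Eq.trans ?_ this
    change _ = elt _ (b - φ.f n (x a)) (π' a')
    rw [ha', elt_one]
  have hy' : K.d n (n - 1) (y a') = 0 := congrArg (fun f => f.hom a') hy
  obtain ⟨v, hv⟩ := hs (n + 1) (w a')
  refine ⟨x a + y a' + K.d (n + 1) n v, ?_, ?_⟩
  · rw [map_add, map_add, hx', hy', d_d_apply, add_zero, add_zero]
  · rw [map_add, map_add, ← f_d_apply, hv, add_assoc, ← hw', add_sub_cancel]

end Homology

variable (p : ℕ) [Fact p.Prime]

theorem dgWeakEquivalences_iff {K L : DG p} (f : K ⟶ L) : dgWeakEquivalences p f ↔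
    (∀ k, (HomologicalComplex.quasiIso (ModuleCat.{0} ℚ) (.down ℤ)).inverseImage
        ((evalAt p k).mapHomologicalComplex (.down ℤ)) f) ∧
      (HomologicalComplex.quasiIso (ModuleCat.{0} ℚ) (.down ℤ)).inverseImage
        ((evalInfty p).mapHomologicalComplex (.down ℤ)) f := Iff.rfl

instance : (dgWeakEquivalences p).HasTwoOutOfThreeProperty where
  comp_mem f g hf hg := by
    rw [dgWeakEquivalences_iff] at hf hg ⊢
    exact ⟨fun k => MorphismProperty.comp_mem _ _ _ (hf.1 k) (hg.1 k),
      MorphismProperty.comp_mem _ _ _ hf.2 hg.2⟩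
  of_postcomp f g hf hg := by
    rw [dgWeakEquivalences_iff] at hf hg ⊢
    exact ⟨fun k => MorphismProperty.of_postcomp _ _ _ (hf.1 k) (hg.1 k),
      MorphismProperty.of_postcomp _ _ _ hf.2 hg.2⟩
  of_precomp f g hf hg := by
    rw [dgWeakEquivalences_iff] at hf hg ⊢
    exact ⟨fun k => MorphismProperty.of_precomp _ _ _ (hf.1 k) (hg.1 k),
      MorphismProperty.of_precomp _ _ _ hf.2 hg.2⟩

theorem dgWeakEquivalences_homotopyEquiv {K L : DG p} (e : HomotopyEquiv K L) :
    dgWeakEquivalences p e.hom :=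
  ⟨fun k => inferInstanceAs (QuasiIso ((evalAt p k).mapHomotopyEquiv e).hom),
    inferInstanceAs (QuasiIso ((evalInfty p).mapHomotopyEquiv e).hom)⟩

end ZpModel


/-! ### The generators, built from regular representations -/

namespace ZpModel

section Regular

/-- The group `Γ` acts on `ℚ[H]` through a homomorphism `Γ → H`. -/
def reg {Γ H : Type} [Group Γ] [Group H] (c : Γ →* H) : Representation ℚ Γ (H →₀ ℚ) where
  toFun g := Finsupp.lmapDomain ℚ ℚ (c g * ·)
  map_one' := by
    ext
    simp
  map_mul' a b := by
    ext
    simp [mul_assoc]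

variable {Γ H : Type} [Group Γ] [Group H] (c : Γ →* H)

theorem reg_single (g : Γ) (h : H) (a : ℚ) :
    reg c g (Finsupp.single h a) = Finsupp.single (c g * h) a := Finsupp.mapDomain_single

/-- Through the surjection c, the module ℚ[H] is the universal Γ-module on one element fixed by the
kernel of c. -/
theorem exists_reg_hom (hc : Function.Surjective c) {M : Type} [AddCommGroup M] [Module ℚ M]
    (τ : Representation ℚ Γ M) (m : M) (hm : ∀ g, c g = 1 → τ g m = m) :
    ∃ f : (H →₀ ℚ) →ₗ[ℚ] M, (∀ g q, f (reg c g q) = τ g (f q)) ∧ f (Finsupp.single 1 1) = m := by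
  choose l hl using hc
  have key : ∀ g g', c g = c g' → τ g m = τ g' m := by
    intro g g' h
    have := hm (g'⁻¹ * g) (by rw [map_mul, map_inv, h, inv_mul_cancel])
    rw [map_mul, Module.End.mul_apply] at this
    conv_rhs => rw [← this]
    rw [rep_inv_self]
  refine ⟨Finsupp.linearCombination ℚ fun h => τ (l h) m, fun g q => ?_, ?_⟩
  · induction q using Finsupp.induction_linear with
    | zero => simp
    | add a b ha hb => simp only [map_add, ha, hb]
    | single h a =>
      rw [reg_single, Finsupp.linearCombination_single, Finsupp.linearCombination_single, map_smul,
        ← rep_mul_apply]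
      congr 1
      exact key _ _ (by rw [hl, map_mul, hl])
  · rw [Finsupp.linearCombination_single, one_smul, key (l 1) 1 (by rw [hl, map_one]), map_one]
    rfl

end Regular

variable {p : ℕ} [Fact p.Prime]

/-- The projection `ℤ/p^n → ℤ/p^m`. -/
def red {m n : ℕ} (h : m ≤ n) : Gk p n →* Gk p m :=
  AddMonoidHom.toMultiplicative (ZMod.castHom (pow_dvd_pow p h) (ZMod (p ^ m))).toAddMonoidHom

theorem red_proj {m n : ℕ} (h : m ≤ n) (g : Gp p) : red h (proj p n g) = proj p m g :=
  congrArg (fun f => f (Multiplicative.toAdd g)) (PadicInt.zmod_cast_comp_toZModPow (p := p) m n h)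

theorem proj_surjective (k : ℕ) : Function.Surjective (proj p k) := fun a => ⟨_, proj_liftGk k a⟩

theorem red_surjective {m n : ℕ} (h : m ≤ n) : Function.Surjective (red (p := p) h) := fun a => by
  obtain ⟨g, rfl⟩ := proj_surjective m a
  exact ⟨proj p n g, red_proj h g⟩

theorem red_bijective {m n : ℕ} (h : m ≤ n) (e : m = n) : Function.Bijective (red (p := p) h) := by
  subst e
  have : ∀ a, red (p := p) h a = a := fun a => by
    obtain ⟨g, rfl⟩ := proj_surjective m a
    exact red_proj h g
  exact ⟨fun a b hab => by rwa [this, this] at hab, fun a => ⟨a, this a⟩⟩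

/-- The map `ℚ[ℤ/p^N] → ℚ[ℤ/p^min(k, N)]`. -/
def regMap (p N : ℕ) [Fact p.Prime] (k : ℕ) : (Gk p N →₀ ℚ) →ₗ[ℚ] (Gk p (min k N) →₀ ℚ) :=
  Finsupp.lmapDomain ℚ ℚ (red (min_le_right k N))

theorem regMap_act (N k : ℕ) (g : Gp p) (v : Gk p N →₀ ℚ) :
    regMap p N k (reg (proj p N) g v) =
      reg (red (min_le_left k N)) (proj p k g) (regMap p N k v) := by
  induction v using Finsupp.induction_linear with
  | zero => simp only [map_zero]
  | add a b ha hb => simp only [map_add, ha, hb]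
  | single h a =>
    have e : ∀ h : Gk p N, regMap p N k (Finsupp.single h a) =
      Finsupp.single (red (min_le_right k N) h) a := fun h => Finsupp.mapDomain_single
    rw [reg_single, e, e, reg_single, map_mul, red_proj, red_proj]

/-- The object with value `ℚ[ℤ/p^N]` at `∞` and at `k ≥ N`, and with value `ℚ[ℤ/p^k]` at
`k ≤ N`. -/
def regObj (p : ℕ) [Fact p.Prime] (N : ℕ) : AlgModel p where
  left :=
    { obj := Rep.of (reg (proj p N))
      property := fun m => ⟨N, fun g hg => by
        have e : reg (proj p N) g = LinearMap.id := by
          ext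
          simp [reg, show proj p N g = 1 from hg]
        exact congrArg (fun f => f m) e⟩ }
  right k := Rep.of (reg (red (p := p) (min_le_left k N)))
  hom := Rep.ofHom ⟨tailsMk (fun k => (Gk p (min k N) →₀ ℚ)) ∘ₗ LinearMap.pi (regMap p N),
    fun g => LinearMap.ext fun v => by
      change tailsMk _ _ = tailsMk _ _
      congr 1
      funext k
      exact regMap_act N k g v⟩

/-- `regObj p N` is constant near infinity. -/
def goodRegObj (N : ℕ) : Good (regObj p N) where
  s := regMap p N
  s_act k g v := regMap_act N k g v
  str_eq v := rfl
  N := N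
  bij k hk := by
    obtain ⟨h1, h2⟩ := red_bijective (p := p) (min_le_right k N) (min_eq_right hk)
    exact ⟨Finsupp.mapDomain_injective h1, Finsupp.mapDomain_surjective h2⟩
  fin_left := inferInstanceAs (Module.Finite ℚ (Gk p N →₀ ℚ))
  fin_right k := inferInstanceAs (Module.Finite ℚ (Gk p (min k N) →₀ ℚ))

/-- The tensor product of objects which are constant near infinity. -/
def Good.tensor {Q Q' : AlgModel p} (hQ : Good Q) (hQ' : Good Q') : Good (Q ⊗ Q') where
  s k := TensorProduct.map (hQ.s k) (hQ'.s k)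
  s_act k g v := by
    refine LinearMap.congr_fun (f := TensorProduct.map (hQ.s k) (hQ'.s k) ∘ₗ
      TensorProduct.map (Q.left.obj.ρ g) (Q'.left.obj.ρ g)) (g := TensorProduct.map
      ((Q.right k).ρ (proj p k g)) ((Q'.right k).ρ (proj p k g)) ∘ₗ
        TensorProduct.map (hQ.s k) (hQ'.s k)) ?_ v
    apply TensorProduct.ext'
    intro x y
    simp only [LinearMap.comp_apply, TensorProduct.map_tmul, hQ.s_act, hQ'.s_act]
  str_eq v := by
    refine LinearMap.congr_fun (f := str (Q ⊗ Q')) (g := tailsMk _ ∘ₗ LinearMap.pi fun k =>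
      TensorProduct.map (hQ.s k) (hQ'.s k)) ?_ v
    apply TensorProduct.ext'
    intro x y
    change tailsTensor (str Q x ⊗ₜ str Q' y) = _
    rw [hQ.str_eq, hQ'.str_eq]
    rfl
  N := max hQ.N hQ'.N
  bij k hk := (TensorProduct.congr
    (LinearEquiv.ofBijective (hQ.s k) (hQ.bij k ((le_max_left _ _).trans hk)))
    (LinearEquiv.ofBijective (hQ'.s k) (hQ'.bij k ((le_max_right _ _).trans hk)))).bijective
  fin_left := by
    have := hQ.fin_left
    have := hQ'.fin_left
    exact inferInstanceAs (Module.Finite ℚ (TensorProduct ℚ Q.left.obj.V Q'.left.obj.V))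
  fin_right k := by
    have := hQ.fin_right k
    have := hQ'.fin_right k
    exact inferInstanceAs (Module.Finite ℚ (TensorProduct ℚ (Q.right k).V (Q'.right k).V))

/-- The unit is constant. -/
def goodUnit : Good (𝟙_ (AlgModel p)) where
  s _ := (LinearMap.id : ℚ →ₗ[ℚ] ℚ)
  s_act _ _ _ := rfl
  str_eq _ := rfl
  N := 0
  bij _ _ := Function.bijective_id
  fin_left := inferInstanceAs (Module.Finite ℚ ℚ)
  fin_right _ := inferInstanceAs (Module.Finite ℚ ℚ)

/-- The component at ∞ comes from the universal property of ℚ[ℤ/p^N], and goodness extends it to the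
points k. -/
theorem exists_hom_infty (N : ℕ) (M : AlgModel p) (m : M.left.obj.V)
    (hm : ∀ g : Gp p, InLevel N g → M.left.obj.ρ g m = m) :
    ∃ x : regObj p N ⟶ M, lin x.left (Finsupp.single 1 1 : Gk p N →₀ ℚ) = m := by
  obtain ⟨f, hf, hf'⟩ := exists_reg_hom (proj p N) (proj_surjective N) M.left.obj.ρ m hm
  let y : (regObj p N).left ⟶ M.left := mkHom (X := (regObj p N).left) f hf
  obtain ⟨z, hz⟩ := (goodRegObj N).exists_compat y
  exact ⟨mkAlg y z hz, hf'⟩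

/-- For N = k the value at k is ℚ[ℤ/p^k], which is free on one element. A change at a single point
is invisible in the tails, so all the other components can be zero. -/
theorem exists_hom_at (k : ℕ) (M : AlgModel p) (m : (M.right k).V) :
    ∃ x : regObj p k ⟶ M, rlin (x.right k) (Finsupp.single 1 1 : Gk p (min k k) →₀ ℚ) = m ∧
      x.left = 0 ∧ ∀ j, j ≠ k → x.right j = 0 := by
  obtain ⟨f, hf, hf'⟩ := exists_reg_hom (red (p := p) (min_le_left k k)) (red_surjective _)
    (M.right k).ρ m (fun g hg => by
      have : g = 1 := (red_bijective (p := p) (min_le_left k k) (min_self k)).1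
        (hg.trans (map_one _).symm)
      rw [this, map_one]
      rfl)
  let z₀ : (regObj p k).right k ⟶ M.right k := mkRep (M := (regObj p k).right k) f hf
  let z : (regObj p k).right ⟶ M.right :=
    Function.update (β := fun j => ((regObj p k).right j ⟶ M.right j)) (fun _ => 0) k z₀
  have hz : ∀ j, j ≠ k → z j = 0 := fun j hj => Function.update_of_ne hj _ _
  have hk : z k = z₀ := Function.update_self _ _ _
  have hc : Compat (0 : (regObj p k).left ⟶ M.left) z :=
    (compat_hom (0 : regObj p k ⟶ M)).congr (K := k + 1) fun j hj => hz j (by omega)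
  refine ⟨mkAlg 0 z hc, ?_, rfl, hz⟩
  change rlin (z k) _ = m
  rw [hk]
  exact hf'

end ZpModel


/-! ### Fibrations and trivial fibrations as lifting classes -/

namespace ZpModel
variable {p : ℕ} [Fact p.Prime]
open DGModel

instance : HasBinaryBiproducts (AlgModel p) := HasBinaryBiproducts.of_hasBinaryCoproducts

theorem dgFibrations_le {Q : AlgModel p} (hQ : Good Q) :
    dgFibrations p ≤ fibs (fun _ : Unit => Q) := fun _ _ f hf n _ x =>
  hQ.exists_lift (f.f n) x (fun _ => (hf n).2 _) (fun k _ => (hf n).1 k _)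

theorem fibs_of_unit {ι : Type} {P : ι → AlgModel p} {E B : DG p} {f : E ⟶ B}
    (h : ∀ i, fibs (fun _ : Unit => P i) f) : fibs P f := fun n i x => h i n () x

theorem trivFibs_of_unit {ι : Type} {P : ι → AlgModel p} {E B : DG p} {f : E ⟶ B}
    (h : ∀ i, trivFibs (fun _ : Unit => P i) f) : trivFibs P f :=
  fun n n' hn i x y => h i n n' hn () x y

/-- Every element at k or at ∞ is the value at 1 of a map out of some generator, so lifting such
maps gives surjectivity. Conversely the generators are projective for pointwise surjections. -/
theorem fibs_regObj : fibs (regObj p) = dgFibrations p := by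
  apply le_antisymm
  · intro E B f hf n
    constructor
    · intro k b
      obtain ⟨x, hx, -⟩ := exists_hom_at k (B.X n) b
      obtain ⟨z, hz⟩ := hf n k x
      refine ⟨rlin (z.right k) (Finsupp.single 1 1 : Gk p (min k k) →₀ ℚ), ?_⟩
      refine Eq.trans ?_ hx
      exact congrArg (fun u => rlin (u.right k) (Finsupp.single 1 1 : Gk p (min k k) →₀ ℚ)) hz
    · intro b
      obtain ⟨N, hN⟩ := (B.X n).left.property b
      obtain ⟨x, hx⟩ := exists_hom_infty N (B.X n) b hN
      obtain ⟨z, hz⟩ := hf n N x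
      refine ⟨lin z.left (Finsupp.single 1 1 : Gk p N →₀ ℚ), ?_⟩
      refine Eq.trans ?_ hx
      exact congrArg (fun u => lin u.left (Finsupp.single 1 1 : Gk p N →₀ ℚ)) hz
  · intro E B f hf
    exact fibs_of_unit fun N => dgFibrations_le (goodRegObj N) _ hf

theorem biprod_left_ext {X Y : AlgModel p} {a b : (X ⊞ Y).left.obj.V}
    (h1 : lin (biprod.fst : X ⊞ Y ⟶ X).left a = lin (biprod.fst : X ⊞ Y ⟶ X).left b)
    (h2 : lin (biprod.snd : X ⊞ Y ⟶ Y).left a = lin (biprod.snd : X ⊞ Y ⟶ Y).left b) : a = b := by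
  have key : ∀ c : (X ⊞ Y).left.obj.V, c =
      lin (biprod.inl : X ⟶ X ⊞ Y).left (lin (biprod.fst : X ⊞ Y ⟶ X).left c) +
        lin (biprod.inr : Y ⟶ X ⊞ Y).left (lin (biprod.snd : X ⊞ Y ⟶ Y).left c) := fun c =>
    (congrArg (fun f => lin f.left c) (biprod.total (X := X) (Y := Y))).symm
  rw [key a, key b, h1, h2]

theorem biprod_right_ext {X Y : AlgModel p} {k : ℕ} {a b : ((X ⊞ Y).right k).V}
    (h1 : rlin ((biprod.fst : X ⊞ Y ⟶ X).right k) a = rlin ((biprod.fst : X ⊞ Y ⟶ X).right k) b)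
    (h2 : rlin ((biprod.snd : X ⊞ Y ⟶ Y).right k) a =
      rlin ((biprod.snd : X ⊞ Y ⟶ Y).right k) b) : a = b := by
  have key : ∀ c : ((X ⊞ Y).right k).V, c =
      rlin ((biprod.inl : X ⟶ X ⊞ Y).right k) (rlin ((biprod.fst : X ⊞ Y ⟶ X).right k) c) +
        rlin ((biprod.inr : Y ⟶ X ⊞ Y).right k) (rlin ((biprod.snd : X ⊞ Y ⟶ Y).right k) c) :=
    fun c => (congrArg (fun f => rlin (f.right k) c) (biprod.total (X := X) (Y := Y))).symm
  rw [key a, key b, h1, h2]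

/-- Compatible pairs lift at each `k` and at `∞`. -/
def dgPairLift (p : ℕ) [Fact p.Prime] : MorphismProperty (DG p) := fun _ _ f =>
  (∀ k, PairLift (((evalAt p k).mapHomologicalComplex (ComplexShape.down ℤ)).map f)) ∧
    PairLift (((evalInfty p).mapHomologicalComplex (ComplexShape.down ℤ)).map f)

theorem dgPairLift_eq : dgPairLift p = dgWeakEquivalences p ⊓ dgFibrations p := by
  ext E B f
  constructor
  · rintro ⟨h1, h2⟩
    exact ⟨⟨fun k => (h1 k).quasiIso, h2.quasiIso⟩,
      fun n => ⟨fun k => (h1 k).surjective n, h2.surjective n⟩⟩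
  · rintro ⟨⟨h1, h2⟩, h3⟩
    exact ⟨fun k => .of_quasiIso (h1 k) fun n => (h3 n).1 k, .of_quasiIso h2 fun n => (h3 n).2⟩

/-- Both conditions on z say that z lifts (x, y) along (f, d) : E_n → B_n ⊞ E_{n'}. The pair lifting
property says exactly that each value of (x, y) is in the image at every point, which is all that
`Good.exists_lift` asks for. -/
theorem dgPairLift_le {Q : AlgModel p} (hQ : Good Q) :
    dgPairLift p ≤ trivFibs (fun _ : Unit => Q) := by
  rintro E B f ⟨h1, h2⟩ n n' hn _ x y hy hxy
  have l1 : biprod.lift x y ≫ biprod.fst = x := biprod.lift_fst _ _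
  have l2 : biprod.lift x y ≫ biprod.snd = y := biprod.lift_snd _ _
  have l3 : biprod.lift (f.f n) (E.d n n') ≫ biprod.fst = f.f n := biprod.lift_fst _ _
  have l4 : biprod.lift (f.f n) (E.d n n') ≫ biprod.snd = E.d n n' := biprod.lift_snd _ _
  obtain ⟨z, hz⟩ := hQ.exists_lift (biprod.lift (f.f n) (E.d n n')) (biprod.lift x y)
    (fun q => by
      obtain ⟨e, he, he'⟩ := h2 n n' hn (lin x.left q) (lin y.left q)
        (fun n'' => congrArg (fun u => lin u.left q) (hy n''))
        (congrArg (fun u => lin u.left q) hxy)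
      refine ⟨e, biprod_left_ext ?_ ?_⟩
      · refine (congrArg (fun u => lin u.left e) l3).trans (Eq.trans ?_
          (congrArg (fun u => lin u.left q) l1).symm)
        exact he'
      · refine (congrArg (fun u => lin u.left e) l4).trans (Eq.trans ?_
          (congrArg (fun u => lin u.left q) l2).symm)
        exact he)
    (fun k q => by
      obtain ⟨e, he, he'⟩ := h1 k n n' hn (rlin (x.right k) q) (rlin (y.right k) q)
        (fun n'' => congrArg (fun u => rlin (u.right k) q) (hy n''))
        (congrArg (fun u => rlin (u.right k) q) hxy)
      refine ⟨e, biprod_right_ext ?_ ?_⟩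
      · refine (congrArg (fun u => rlin (u.right k) e) l3).trans (Eq.trans ?_
          (congrArg (fun u => rlin (u.right k) q) l1).symm)
        exact he'
      · refine (congrArg (fun u => rlin (u.right k) e) l4).trans (Eq.trans ?_
          (congrArg (fun u => rlin (u.right k) q) l2).symm)
        exact he)
  refine ⟨z, ?_, ?_⟩
  · rw [← l2, ← hz, Category.assoc, l4]
  · rw [← l1, ← hz, Category.assoc, l3]

/-- Replace the components at `k < K` by zero. -/
def cutBelow {Q M : AlgModel p} (K : ℕ) (x : Q ⟶ M) : Q ⟶ M :=
  open scoped Classical in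
  mkAlg x.left (fun k => if K ≤ k then x.right k else 0)
    ((compat_hom x).congr (K := K) fun _ hk => if_pos hk)

theorem cutBelow_of_le {Q M : AlgModel p} {K : ℕ} (x : Q ⟶ M) {k : ℕ} (hk : K ≤ k) :
    (cutBelow K x).right k = x.right k := if_pos hk

theorem cutBelow_of_lt {Q M : AlgModel p} {K : ℕ} (x : Q ⟶ M) {k : ℕ} (hk : k < K) :
    (cutBelow K x).right k = 0 := if_neg (not_le.2 hk)

theorem cutBelow_comp_eq {Q M M' N : AlgModel p} {K : ℕ} {x : Q ⟶ M} {y : Q ⟶ M'} {f : M ⟶ N}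
    {g : M' ⟶ N} (hl : (x ≫ f).left = (y ≫ g).left)
    (h : ∀ k, K ≤ k → (x ≫ f).right k = (y ≫ g).right k) :
    cutBelow K x ≫ f = cutBelow K y ≫ g := by
  apply CommaMorphism.ext
  · exact hl
  · funext k
    change (cutBelow K x).right k ≫ f.right k = (cutBelow K y).right k ≫ g.right k
    rcases lt_or_ge k K with hk | hk
    · rw [cutBelow_of_lt _ hk, cutBelow_of_lt _ hk, zero_comp, zero_comp]
    · rw [cutBelow_of_le _ hk, cutBelow_of_le _ hk]
      exact h k hk

theorem cutBelow_zero {Q M : AlgModel p} (K : ℕ) : cutBelow K (0 : Q ⟶ M) = 0 := by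
  apply CommaMorphism.ext
  · rfl
  · funext k
    rcases lt_or_ge k K with hk | hk
    · rw [cutBelow_of_lt _ hk]
      rfl
    · rw [cutBelow_of_le _ hk]

theorem reg_hom_ext {Γ H : Type} [Group Γ] [Group H] {c : Γ →* H} (hc : Function.Surjective c)
    {M : Type} [AddCommGroup M] [Module ℚ M] {τ : Representation ℚ Γ M} {f f' : (H →₀ ℚ) →ₗ[ℚ] M}
    (hf : ∀ g q, f (reg c g q) = τ g (f q)) (hf' : ∀ g q, f' (reg c g q) = τ g (f' q))
    (h : f (Finsupp.single 1 1) = f' (Finsupp.single 1 1)) : f = f' := by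
  apply Finsupp.lhom_ext
  intro a r
  obtain ⟨g, rfl⟩ := hc a
  have e : Finsupp.single (c g) r = r • reg c g (Finsupp.single 1 1) := by
    rw [reg_single, mul_one, Finsupp.smul_single, smul_eq_mul, mul_one]
  rw [e, map_smul, map_smul, hf, hf', h]

theorem regObj_left_ext {N : ℕ} {M : AlgModel p} {u v : regObj p N ⟶ M}
    (h : lin u.left (Finsupp.single 1 1 : Gk p N →₀ ℚ) =
      lin v.left (Finsupp.single 1 1 : Gk p N →₀ ℚ)) : u.left = v.left :=
  lin_ext (LinearMap.congr_fun (reg_hom_ext (proj_surjective N) (lin_comm u.left)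
    (lin_comm v.left) h))

theorem regObj_right_ext {N k : ℕ} {M : AlgModel p} {u v : regObj p N ⟶ M}
    (h : rlin (u.right k) (Finsupp.single 1 1 : Gk p (min k N) →₀ ℚ) =
      rlin (v.right k) (Finsupp.single 1 1 : Gk p (min k N) →₀ ℚ)) : u.right k = v.right k :=
  rlin_ext (LinearMap.congr_fun (reg_hom_ext (red_surjective (p := p) (min_le_left k N))
    (rlin_comm (u.right k)) (rlin_comm (v.right k)) h))

/-- A pair of elements is encoded by maps x, y out of one generator. At a point k all other
components vanish, so the relations between the elements carry over. At ∞ they carry over to the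
components at ∞, hence to those at all large k; the finitely many others, where they may fail, are
removed by `cutBelow`, which does not change the values at ∞. -/
theorem trivFibs_le_dgPairLift : trivFibs (regObj p) ≤ dgPairLift p := by
  intro E B f hf
  constructor
  · intro k n n' hn b e he hb
    obtain ⟨x, hx, hx0, hx1⟩ := exists_hom_at k (B.X n) b
    obtain ⟨y, hy, hy0, hy1⟩ := exists_hom_at k (E.X n') e
    obtain ⟨z, hz, hz'⟩ := hf n n' hn k x y (fun n'' => by
      apply CommaMorphism.ext
      · change y.left ≫ _ = 0
        rw [hy0, zero_comp]
      · funext j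
        by_cases hj : j = k
        · subst hj
          refine regObj_right_ext (u := y ≫ E.d n' n'') (v := 0) ?_
          exact (congrArg (rlin ((E.d n' n'').right j)) hy).trans (he n'')
        · change y.right j ≫ _ = 0
          rw [hy1 j hj, zero_comp]) (by
      apply CommaMorphism.ext
      · change x.left ≫ _ = y.left ≫ _
        rw [hx0, hy0, zero_comp, zero_comp]
      · funext j
        by_cases hj : j = k
        · subst hj
          refine regObj_right_ext (u := x ≫ B.d n n') (v := y ≫ f.f n') ?_
          exact (congrArg (rlin ((B.d n n').right j)) hx).trans
            (hb.trans (congrArg (rlin ((f.f n').right j)) hy).symm)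
        · change x.right j ≫ _ = y.right j ≫ _
          rw [hx1 j hj, hy1 j hj, zero_comp, zero_comp])
    exact ⟨rlin (z.right k) (Finsupp.single 1 1 : Gk p (min k k) →₀ ℚ),
      (congrArg (fun u => rlin (u.right k) (Finsupp.single 1 1 : Gk p (min k k) →₀ ℚ)) hz).trans hy,
      (congrArg (fun u => rlin (u.right k) (Finsupp.single 1 1 : Gk p (min k k) →₀ ℚ)) hz').trans
        hx⟩
  · intro n n' hn b e he hb
    obtain ⟨N₁, h₁⟩ := (B.X n).left.property b
    obtain ⟨N₂, h₂⟩ := (E.X n').left.property e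
    let N := max N₁ N₂
    obtain ⟨x, hx⟩ := exists_hom_infty N (B.X n) b fun g hg => h₁ g (hg.mono (le_max_left _ _))
    obtain ⟨y, hy⟩ := exists_hom_infty N (E.X n') e fun g hg => h₂ g (hg.mono (le_max_right _ _))
    have d0 : (y ≫ E.d n' (n' - 1)).left = (0 : regObj p N ⟶ E.X (n' - 1)).left :=
      regObj_left_ext ((congrArg (lin (E.d n' (n' - 1)).left) hy).trans (he (n' - 1)))
    have d1 : (x ≫ B.d n n').left = (y ≫ f.f n').left :=
      regObj_left_ext ((congrArg (lin (B.d n n').left) hx).trans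
        (hb.trans (congrArg (lin (f.f n').left) hy).symm))
    have c0 := compat_hom (y ≫ E.d n' (n' - 1))
    have c1 := compat_hom (x ≫ B.d n n')
    rw [d0] at c0
    rw [d1] at c1
    obtain ⟨K₀, h0⟩ := (goodRegObj N).eventually_eq c0 (compat_hom 0)
    obtain ⟨K₁, h1⟩ := (goodRegObj N).eventually_eq c1 (compat_hom (y ≫ f.f n'))
    let K := max K₀ K₁
    have e0 : cutBelow K y ≫ E.d n' (n' - 1) = 0 := by
      have := cutBelow_comp_eq (K := K) (x := y) (f := E.d n' (n' - 1))
        (y := (0 : regObj p N ⟶ E.X (n' - 1))) (g := 𝟙 _)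
        (by rw [Category.comp_id]; exact d0) (fun k hk => by
          rw [Category.comp_id]; exact h0 k ((le_max_left _ _).trans hk))
      rw [this, cutBelow_zero, zero_comp]
    have e1 : cutBelow K x ≫ B.d n n' = cutBelow K y ≫ f.f n' :=
      cutBelow_comp_eq d1 fun k hk => h1 k ((le_max_right _ _).trans hk)
    obtain ⟨z, hz, hz'⟩ := hf n n' hn N (cutBelow K x) (cutBelow K y) (fun n'' => by
      by_cases hn'' : n'' = n' - 1
      · rw [hn'', e0]
      · rw [E.shape _ _ (by change ¬ (n'' + 1 = n'); omega), comp_zero]) e1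
    exact ⟨lin z.left (Finsupp.single 1 1 : Gk p N →₀ ℚ),
      (congrArg (fun u => lin u.left (Finsupp.single 1 1 : Gk p N →₀ ℚ)) hz).trans hy,
      (congrArg (fun u => lin u.left (Finsupp.single 1 1 : Gk p N →₀ ℚ)) hz').trans hx⟩

theorem trivFibs_regObj : trivFibs (regObj p) = dgPairLift p :=
  le_antisymm trivFibs_le_dgPairLift fun _ _ _ hf =>
    trivFibs_of_unit fun N => dgPairLift_le (goodRegObj N) _ hf

theorem weakEquivalences_inf_fibs : dgWeakEquivalences p ⊓ fibs (regObj p) = trivFibs (regObj p) := by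
  rw [fibs_regObj, trivFibs_regObj, dgPairLift_eq]

end ZpModel


/-! ### Sections of UA and its stalk at ∞ -/

namespace ZpModel

section Stalks
open Opposite TopologicalSpace
variable {p : ℕ} [Fact p.Prime]

theorem infty_notMem_openPt (k : ℕ) : (OnePoint.infty : OnePoint ℕ) ∉ openPt k := fun h =>
  OnePoint.infty_ne_coe k h

theorem coe_mem_openPt {j k : ℕ} : (j : OnePoint ℕ) ∈ openPt k ↔ j = k :=
  ⟨fun h => OnePoint.coe_injective h, fun h => by rw [h]; rfl⟩

/-- A section of `UA`, from a pair. -/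
def mkSec (A : AlgModel p) (V : Opens Sp) (y : USeq A) (hy : y ∈ USub A V)
    (hd : ∃ n : ℕ, ∀ g : Gp p, InLevel n g → URep A g y = y) : Sec (UPre A) V :=
  (⟨y, hy, hd⟩ : ↥(USub A V ⊓ discretePart (URep A)))

theorem pair_act {A : AlgModel p} {V : Opens Sp} (g : Gp p) (x : Sec (UPre A) V) :
    pair (act (UPre A) V g x) = URep A g (pair x) := rfl

theorem pair_add {A : AlgModel p} {V : Opens Sp} (x y : Sec (UPre A) V) :
    pair (x + y) = pair x + pair y := rfl

theorem pair_smul {A : AlgModel p} {V : Opens Sp} (c : ℚ) (x : Sec (UPre A) V) :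
    pair (c • x) = c • pair x := rfl

theorem pair_res_fst {A : AlgModel p} {V W : Opens Sp} (h : W ≤ V) (x : Sec (UPre A) V) {k : ℕ}
    (hk : (k : OnePoint ℕ) ∈ W) : (pair (res (UPre A) h x)).1 k = (pair x).1 k := by
  rw [pair_res, trunc_fst, if_pos hk]

theorem pair_res_snd {A : AlgModel p} {V W : Opens Sp} (h : W ≤ V) (x : Sec (UPre A) V)
    (hW : (OnePoint.infty : OnePoint ℕ) ∈ W) : (pair (res (UPre A) h x)).2 = (pair x).2 := by
  rw [pair_res, trunc_snd, if_pos hW]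

theorem sec_ext {A : AlgModel p} {V : Opens Sp} {x y : Sec (UPre A) V}
    (h : ∀ k : ℕ, (k : OnePoint ℕ) ∈ V → (pair x).1 k = (pair y).1 k)
    (h' : (OnePoint.infty : OnePoint ℕ) ∈ V → (pair x).2 = (pair y).2) : x = y := by
  apply pair_ext
  apply Prod.ext
  · funext k
    by_cases hk : (k : OnePoint ℕ) ∈ V
    · exact h k hk
    · exact ((pair_mem x).1 k hk).trans ((pair_mem y).1 k hk).symm
  · by_cases hV : (OnePoint.infty : OnePoint ℕ) ∈ V
    · exact h' hV
    · exact ((pair_mem x).2.1 hV).trans ((pair_mem y).2.1 hV).symm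

theorem rep_inLevel {k : ℕ} (W : Rep.{0} ℚ (Gk p k)) {g : Gp p} (hg : InLevel k g) (v : W.V) :
    W.ρ (proj p k g) v = v := by
  rw [show proj p k g = 1 from hg, map_one, Module.End.one_apply]

/-- The section of `UA` over `{k}` given by an element of `A_k`. -/
def ptSec (A : AlgModel p) (k : ℕ) : (A.right k).V →ₗ[ℚ] Sec (UPre A) (openPt k) where
  toFun a := mkSec A (openPt k) (Pi.single k a, 0)
    ⟨fun j hj => Pi.single_eq_of_ne (M := fun k => (A.right k).V)
        (fun h => hj (coe_mem_openPt.2 h)) a, fun _ => rfl,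
      fun h => absurd h (infty_notMem_openPt k)⟩
    ⟨k, fun g hg => by
      apply Prod.ext
      · funext j
        rw [URep_fst]
        by_cases hj : j = k
        · subst hj
          exact rep_inLevel _ hg _
        · have e : Pi.single (M := fun k => (A.right k).V) k a j = 0 :=
            Pi.single_eq_of_ne (M := fun k => (A.right k).V) hj a
          change (A.right j).ρ _ (Pi.single (M := fun k => (A.right k).V) k a j) = _
          rw [e, map_zero]
          exact e.symm
      · exact map_zero (A.left.obj.ρ g)⟩
  map_add' a b := by
    apply pair_ext
    exact Prod.ext (Pi.single_add (f := fun k => (A.right k).V) k a b) (add_zero _).symm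
  map_smul' c a := by
    apply pair_ext
    exact Prod.ext (Pi.single_smul (f := fun k => (A.right k).V) k c a) (smul_zero _).symm

theorem pair_ptSec (A : AlgModel p) (k : ℕ) (a : (A.right k).V) :
    (pair (ptSec A k a)).1 k = a :=
  Pi.single_eq_same (M := fun k => (A.right k).V) k a

theorem ptSec_pair {A : AlgModel p} {k : ℕ} (x : Sec (UPre A) (openPt k)) :
    ptSec A k ((pair x).1 k) = x := by
  apply sec_ext
  · intro j hj
    obtain rfl := coe_mem_openPt.1 hj
    exact pair_ptSec A _ _
  · intro h
    exact absurd h (infty_notMem_openPt k)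

theorem act_ptSec (A : AlgModel p) (k : ℕ) (g : Gp p) (a : (A.right k).V) :
    act (UPre A) (openPt k) g (ptSec A k a) = ptSec A k ((A.right k).ρ (proj p k g) a) := by
  rw [← ptSec_pair (act (UPre A) (openPt k) g (ptSec A k a)), pair_act, URep_fst, pair_ptSec]

/-- An element of p^n ℤ_p is p^n times an element c, and the image of c in ℤ/p^k is a multiple of
that of the generator. -/
theorem proj_mem_of_inLevel {n k : ℕ} {g : Gp p} (hg : InLevel n g) :
    ∃ m : ℕ, proj p k g = (proj p k (gen p) ^ p ^ n) ^ m := by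
  have h : (p ^ n : ℤ_[p]) ∣ Multiplicative.toAdd g := by
    rw [← Ideal.mem_span_singleton, ← PadicInt.ker_toZModPow]
    exact hg
  obtain ⟨c, hc⟩ := h
  obtain ⟨m, hm⟩ := proj_gen_pow k (proj p k (Multiplicative.ofAdd c))
  refine ⟨m, ?_⟩
  rw [← pow_mul, mul_comm, pow_mul, ← hm, ← map_pow]
  congr 1
  change g = Multiplicative.ofAdd (p ^ n • c)
  rw [nsmul_eq_mul, Nat.cast_pow, ← hc]
  rfl

/-- A sequence (x_k) representing the tail of a need not be discrete. But if p^d ℤ_p fixes a, then a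
topological generator of p^d ℤ_p fixes x_k for all large k, and hence so does all of p^d ℤ_p.
Truncating the sequence there gives a section. -/
theorem exists_section (A : AlgModel p) (a : A.left.obj.V) (n : ℕ) :
    ∃ m, n ≤ m ∧ ∃ x : Sec (UPre A) (openS m), (pair x).2 = a := by
  classical
  obtain ⟨x, hx⟩ := tailsMk_surjective (str A a)
  obtain ⟨d, hd⟩ := A.left.property a
  have h0 : InLevel d (gen p ^ p ^ d) := by
    change PadicInt.toZModPow d ((p ^ d) • (1 : ℤ_[p])) = 0
    rw [nsmul_one, map_natCast]
    exact ZMod.natCast_self _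
  have h1 : tailsMk (fun k => (A.right k).V) (fun k => (A.right k).ρ (proj p k (gen p ^ p ^ d)) (x k)) =
      tailsMk _ x := by
    have := str_act A (gen p ^ p ^ d) a
    rw [hd _ h0, ← hx] at this
    exact this.symm
  obtain ⟨m, hm⟩ := tailsMk_eq_iff.1 h1
  have h2 : ∀ k, m ≤ k → ∀ g : Gp p, InLevel d g → (A.right k).ρ (proj p k g) (x k) = x k := by
    intro k hk g hg
    obtain ⟨r, hr⟩ := proj_mem_of_inLevel (k := k) hg
    rw [hr, ← map_pow]
    clear hr
    induction r with
    | zero => simp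
    | succ r ih => rw [pow_succ, rep_mul_apply, hm k hk, ih]
  refine ⟨max m n, le_max_right _ _, mkSec A _ (fun k => if max m n ≤ k then x k else 0, a)
    ⟨fun k hk => if_neg fun h => hk (coe_mem_openS.2 h),
      fun h => absurd (infty_mem_openS _) h, fun _ => ?_⟩ ⟨d, fun g hg => ?_⟩, rfl⟩
  · rw [← hx, tailsMk_eq_iff]
    exact ⟨max m n, fun k hk => (if_pos hk).symm⟩
  · apply Prod.ext
    · funext k
      change (A.right k).ρ _ (if _ then _ else _) = if _ then _ else _
      split_ifs with h
      · exact h2 k ((le_max_left _ _).trans h) g hg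
      · exact map_zero _
    · exact hd g hg

/-- Both sequences represent the tail of the same element of A_∞, so they agree for large k. With
`exists_section` this shows that the stalk at ∞ is A_∞. -/
theorem section_eventually_eq {A : AlgModel p} {m m' : ℕ} (x : Sec (UPre A) (openS m))
    (x' : Sec (UPre A) (openS m')) (h : (pair x).2 = (pair x').2) (l : ℕ) :
    ∃ n, l ≤ n ∧ ∃ (h1 : m ≤ n) (h2 : m' ≤ n), res (UPre A) (openS_anti h1) x =
      res (UPre A) (openS_anti h2) x' := by
  have e := (pair_mem x).2.2 (infty_mem_openS m)
  rw [h, (pair_mem x').2.2 (infty_mem_openS m'), tailsMk_eq_iff] at e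
  obtain ⟨n, hn⟩ := e
  refine ⟨max (max l n) (max m m'), by omega, by omega, by omega, ?_⟩
  apply sec_ext
  · intro k hk
    rw [pair_res_fst _ _ hk, pair_res_fst _ _ hk]
    exact (hn k (by have := coe_mem_openS.1 hk; omega)).symm
  · intro hk
    rw [pair_res_snd _ _ hk, pair_res_snd _ _ hk, h]

/-- The class of a section over `S_n` in the stalk. -/
abbrev germ (M : TopCat.Presheaf (DiscMod p) Sp) (n : ℕ) : Sec M (openS n) →ₗ[ℚ] Stalk M :=
  Module.DirectLimit.of ℚ ℕ (fun n : ℕ => Sec M (openS n)) (fun _ _ h => res M (openS_anti h)) n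

section germ
variable (M : TopCat.Presheaf (DiscMod p) Sp)

theorem germ_res {m n : ℕ} (h : m ≤ n) (x : Sec M (openS m)) :
    germ M n (res M (openS_anti h) x) = germ M m x :=
  Module.DirectLimit.of_f (f := fun _ _ h => res M (openS_anti h)) (hij := h)

theorem exists_germ (s : Stalk M) : ∃ n x, germ M n x = s := Module.DirectLimit.exists_of s

instance : DirectedSystem (fun n : ℕ => Sec M (openS n)) fun _ _ h => res M (openS_anti h) where
  map_self _ _ := res_refl M _ _
  map_map _ _ _ _ _ x := res_res M _ _ x

theorem germ_eq {m n : ℕ} {x : Sec M (openS m)} {y : Sec M (openS n)}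
    (h : germ M m x = germ M n y) : ∃ (k : ℕ) (h1 : m ≤ k) (h2 : n ≤ k),
      res M (openS_anti h1) x = res M (openS_anti h2) y := by
  have e : germ M (max m n) (res M (openS_anti (le_max_left m n)) x -
      res M (openS_anti (le_max_right m n)) y) = 0 := by
    rw [map_sub, germ_res M (le_max_left m n), germ_res M (le_max_right m n), h, sub_self]
  obtain ⟨k, hk, e⟩ := Module.DirectLimit.of.zero_exact e
  refine ⟨k, (le_max_left _ _).trans hk, (le_max_right _ _).trans hk, ?_⟩
  rw [map_sub, res_res, res_res, sub_eq_zero] at e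
  exact e

theorem stalkToTails_germ (n : ℕ) (x : Sec M (openS n)) :
    stalkToTails M (germ M n x) = tailsMk (fun k => Sec M (openPt k)) (seqOf M n x) :=
  Module.DirectLimit.lift_of _ _ _

theorem stalkRep_germ (g : Gp p) (n : ℕ) (x : Sec M (openS n)) :
    stalkRep M g (germ M n x) = germ M n (act M (openS n) g x) :=
  Module.DirectLimit.map_apply_of _ (fun _ _ h => LinearMap.ext fun x =>
    (res_act M (openS_anti h) g x).symm) _

theorem stalkMap_germ {M N : TopCat.Presheaf (DiscMod p) Sp} (f : M ⟶ N) (n : ℕ)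
    (x : Sec M (openS n)) :
    stalkMap f (germ M n x) = germ N n (lin (f.app (op (openS n))) x) :=
  Module.DirectLimit.map_apply_of _ (fun _ _ h => LinearMap.ext fun x =>
    congrArg (fun a => lin a x) (f.naturality (homOfLE (openS_anti h)).op)) _

end germ

/-- The map from the stalk of `UA` at the trivial subgroup to `A_∞`. -/
def stalkSnd (A : AlgModel p) : Stalk (UPre A) →ₗ[ℚ] A.left.obj.V :=
  Module.DirectLimit.lift ℚ ℕ (fun n : ℕ => Sec (UPre A) (openS n))
    (fun _ _ h => res (UPre A) (openS_anti h))
    (fun n => LinearMap.snd ℚ _ _ ∘ₗ Submodule.subtype (USub A (openS n) ⊓ discretePart (URep A)))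
    (fun _ j h x => pair_res_snd (openS_anti h) x (infty_mem_openS j))

theorem stalkSnd_germ (A : AlgModel p) (n : ℕ) (x : Sec (UPre A) (openS n)) :
    stalkSnd A (germ (UPre A) n x) = (pair x).2 :=
  Module.DirectLimit.lift_of (f := fun _ _ h => res (UPre A) (openS_anti h)) _ _ x

theorem stalkSnd_bijective (A : AlgModel p) : Function.Bijective (stalkSnd A) := by
  constructor
  · rw [injective_iff_map_eq_zero]
    intro s hs
    obtain ⟨n, x, rfl⟩ := exists_germ _ s
    rw [stalkSnd_germ] at hs
    obtain ⟨m, -, h1, h2, e⟩ := section_eventually_eq x (0 : Sec (UPre A) (openS n)) hs 0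
    rw [← germ_res _ h1, e, map_zero, map_zero]
  · intro a
    obtain ⟨m, -, x, hx⟩ := exists_section A a 0
    exact ⟨germ _ m x, (stalkSnd_germ A m x).trans hx⟩

/-- The stalk of `UA` at the trivial subgroup is `A_∞`. -/
def stalkEquiv (A : AlgModel p) : Stalk (UPre A) ≃ₗ[ℚ] A.left.obj.V :=
  LinearEquiv.ofBijective _ (stalkSnd_bijective A)

theorem stalkEquiv_germ (A : AlgModel p) (n : ℕ) (x : Sec (UPre A) (openS n)) :
    stalkEquiv A (germ (UPre A) n x) = (pair x).2 := stalkSnd_germ A n x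

theorem stalkEquiv_act (A : AlgModel p) (g : Gp p) (s : Stalk (UPre A)) :
    stalkEquiv A (stalkRep (UPre A) g s) = A.left.obj.ρ g (stalkEquiv A s) := by
  obtain ⟨n, x, rfl⟩ := exists_germ _ s
  rw [stalkRep_germ, stalkEquiv_germ, stalkEquiv_germ]
  rfl

theorem stalkEquiv_symm_act (A : AlgModel p) (g : Gp p) (a : A.left.obj.V) :
    (stalkEquiv A).symm (A.left.obj.ρ g a) = stalkRep (UPre A) g ((stalkEquiv A).symm a) := by
  rw [LinearEquiv.symm_apply_eq, stalkEquiv_act, LinearEquiv.apply_symm_apply]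

/-- The map `A_k → UA({k})^{p^k ℤ_p}`. -/
def ptFix (A : AlgModel p) (k : ℕ) : A.right k ⟶ RFam (UPre A) k :=
  mkRep ((ptSec A k).codRestrict (fixedSub (act (UPre A) (openPt k)) k) (fun a g hg => by
    rw [act_ptSec, rep_inLevel _ hg])) (fun g a => by
      apply Subtype.ext
      change ptSec A k _ = act (UPre A) (openPt k) (liftGk k g) (ptSec A k a)
      rw [act_ptSec, proj_liftGk])

/-- This is the condition for the map from A_∞ to land in the pullback which defines (RUA)_∞. -/
theorem stalkToTails_symm (A : AlgModel p) (a : A.left.obj.V) :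
    stalkToTails (UPre A) ((stalkEquiv A).symm a) =
      inclTails (UPre A) (tailsMap (fun k => rlin (ptFix A k)) (str A a)) := by
  obtain ⟨m, -, x, rfl⟩ := exists_section A a 0
  rw [show (stalkEquiv A).symm (pair x).2 = germ _ m x by
    rw [LinearEquiv.symm_apply_eq, stalkEquiv_germ], stalkToTails_germ,
    (pair_mem x).2.2 (infty_mem_openS m)]
  change _ = tailsMk _ _
  rw [tailsMk_eq_iff]
  refine ⟨m, fun k hk => ?_⟩
  rw [seqOf_apply _ hk, ← ptSec_pair (res (UPre A) _ x), pair_res_fst _ _ (coe_mem_openPt.2 rfl)]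
  rfl

/-- The map `A → RUA` at infinity, on pairs. -/
def unitPair (A : AlgModel p) :
    A.left.obj.V →ₗ[ℚ] Stalk (UPre A) × TailsMod fun k => (RFam (UPre A) k).V :=
  (stalkEquiv A).symm.toLinearMap.prod (tailsMap (fun k => rlin (ptFix A k)) ∘ₗ str A)

theorem unitPair_act (A : AlgModel p) (g : Gp p) (a : A.left.obj.V) :
    unitPair A (A.left.obj.ρ g a) = RRep (UPre A) g (unitPair A a) := by
  apply Prod.ext
  · exact stalkEquiv_symm_act A g a
  · change tailsMap _ (str A _) = tailsRep p _ g (tailsMap _ (str A a))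
    rw [str_act]
    obtain ⟨x, hx⟩ := tailsMk_surjective (str A a)
    rw [← hx]
    change tailsMk _ _ = tailsMk _ _
    congr 1
    funext k
    exact rlin_comm (ptFix A k) _ _

/-- The map `A → RUA`. -/
def unitRU (A : AlgModel p) : A ⟶ RObj (UPre A) :=
  mkAlg (mkHom (X := A.left) (Y := (RObj (UPre A)).left)
    ((unitPair A).codRestrict (RSub (UPre A) ⊓ discretePart (RRep (UPre A))) (fun a => by
      refine ⟨stalkToTails_symm A a, ?_⟩
      obtain ⟨n, hn⟩ := A.left.property a
      exact ⟨n, fun g hg => by rw [← unitPair_act, hn g hg]⟩))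
    (fun g a => Subtype.ext (unitPair_act A g a))) (ptFix A) (fun _ => rfl)

end Stalks
end ZpModel


/-! ### Evaluation of sections of hom(UA, UC) -/

namespace ZpModel

section Evaluation
open Opposite TopologicalSpace
variable {p : ℕ} [Fact p.Prime]

/-- The sheaf `hom(UA, UC)`. -/
abbrev homU (A C : AlgModel p) : TopCat.Presheaf (DiscMod p) Sp := homPre (UPre A) (UPre C)

variable {A C : AlgModel p}

theorem fam_act {V W : Opens Sp} (h : W ≤ V) (g : Gp p) (φ : Sec (homU A C) V)
    (x : Sec (UPre A) W) :
    fam (act (homU A C) V g φ) ⟨W, h⟩ x =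
      act (UPre C) W g (fam φ ⟨W, h⟩ (act (UPre A) W g⁻¹ x)) := rfl

theorem fam_act_act {V W : Opens Sp} (h : W ≤ V) (g : Gp p) (φ : Sec (homU A C) V)
    (x : Sec (UPre A) W) :
    fam (act (homU A C) V g φ) ⟨W, h⟩ (act (UPre A) W g x) =
      act (UPre C) W g (fam φ ⟨W, h⟩ x) := by
  rw [fam_act, ← rep_mul_apply, inv_mul_cancel, map_one, Module.End.one_apply]

theorem fam_res {V V' W : Opens Sp} (h : V' ≤ V) (h' : W ≤ V') (φ : Sec (homU A C) V)
    (x : Sec (UPre A) W) :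
    fam (res (homU A C) h φ) ⟨W, h'⟩ x = fam φ ⟨W, h'.trans h⟩ x := rfl

theorem fam_add {V W : Opens Sp} (h : W ≤ V) (φ ψ : Sec (homU A C) V) (x : Sec (UPre A) W) :
    fam (φ + ψ) ⟨W, h⟩ x = fam φ ⟨W, h⟩ x + fam ψ ⟨W, h⟩ x := rfl

theorem fam_smul {V W : Opens Sp} (h : W ≤ V) (c : ℚ) (φ : Sec (homU A C) V)
    (x : Sec (UPre A) W) :
    fam (c • φ) ⟨W, h⟩ x = c • fam φ ⟨W, h⟩ x := rfl

/-- Evaluation at `k`. -/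
def ptEval (A C : AlgModel p) (k : ℕ) :
    (A.right k).V →ₗ[ℚ] Sec (homU A C) (openPt k) →ₗ[ℚ] (C.right k).V :=
  LinearMap.mk₂ ℚ (fun a φ => (pair (fam φ ⟨openPt k, le_rfl⟩ (ptSec A k a))).1 k)
    (fun a a' φ => by rw [map_add, map_add, pair_add]; rfl)
    (fun c a φ => by rw [map_smul, map_smul, pair_smul]; rfl)
    (fun a φ ψ => by rw [fam_add, pair_add]; rfl)
    (fun c a φ => by rw [fam_smul, pair_smul]; rfl)

theorem ptEval_apply (k : ℕ) (a : (A.right k).V) (φ : Sec (homU A C) (openPt k)) :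
    ptEval A C k a φ = (pair (fam φ ⟨openPt k, le_rfl⟩ (ptSec A k a))).1 k := rfl

theorem ptEval_act (k : ℕ) (g : Gp p) (a : (A.right k).V) (φ : Sec (homU A C) (openPt k)) :
    ptEval A C k ((A.right k).ρ (proj p k g) a) (act (homU A C) (openPt k) g φ) =
      (C.right k).ρ (proj p k g) (ptEval A C k a φ) := by
  rw [ptEval_apply, ← act_ptSec, fam_act_act]
  rfl

/-- The components at `k` of the values of a section of `hom(UA, UC)`. -/
theorem fam_fst {V : Opens Sp} (φ : Sec (homU A C) V) {W : Opens Sp} (h : W ≤ V)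
    (x : Sec (UPre A) W) {k : ℕ} (hk : (k : OnePoint ℕ) ∈ W) :
    (pair (fam φ ⟨W, h⟩ x)).1 k =
      ptEval A C k ((pair x).1 k) (res (homU A C) ((openPt_le.2 hk).trans h) φ) := by
  have e := fam_nat φ W (openPt k) h (openPt_le.2 hk) x
  rw [ptEval_apply, fam_res]
  rw [← ptSec_pair (res (UPre A) _ x), pair_res_fst _ _ (coe_mem_openPt.2 rfl)] at e
  rw [← e, pair_res_fst _ _ (coe_mem_openPt.2 rfl)]

theorem ptEval_ext {k : ℕ} {φ ψ : Sec (homU A C) (openPt k)}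
    (h : ∀ a, ptEval A C k a φ = ptEval A C k a ψ) : φ = ψ := by
  apply fam_ext
  funext W
  apply LinearMap.ext
  intro x
  obtain ⟨W, hW⟩ := W
  apply sec_ext
  · intro j hj
    obtain rfl := coe_mem_openPt.1 (hW hj)
    rw [fam_fst φ hW x hj, fam_fst ψ hW x hj]
    exact h _
  · intro hk
    exact absurd (hW hk) (infty_notMem_openPt k)

/-- Over a small enough S_l the two sections of UA coincide and so do the two sections of hom(UA,
UC), while restriction leaves the component at ∞ unchanged. So the value depends only on the germ
and on the element of A_∞. -/
theorem fam_snd_eq {n m : ℕ} {φ : Sec (homU A C) (openS n)} {ψ : Sec (homU A C) (openS m)}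
    (h : germ _ n φ = germ _ m ψ) {i j : ℕ} (hi : n ≤ i) (hj : m ≤ j)
    (x : Sec (UPre A) (openS i)) (y : Sec (UPre A) (openS j)) (hxy : (pair x).2 = (pair y).2) :
    (pair (fam φ ⟨openS i, openS_anti hi⟩ x)).2 = (pair (fam ψ ⟨openS j, openS_anti hj⟩ y)).2 := by
  obtain ⟨k, h1, h2, e⟩ := germ_eq _ h
  obtain ⟨l, hl, h3, h4, e'⟩ := section_eventually_eq x y hxy k
  rw [← pair_res_snd (openS_anti h3) (fam φ ⟨openS i, openS_anti hi⟩ x) (infty_mem_openS l),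
    ← pair_res_snd (openS_anti h4) (fam ψ ⟨openS j, openS_anti hj⟩ y) (infty_mem_openS l),
    fam_nat φ _ _ (openS_anti hi) (openS_anti h3), fam_nat ψ _ _ (openS_anti hj) (openS_anti h4), e']
  have := congrArg (fun χ => fam χ ⟨openS l, openS_anti hl⟩ (res (UPre A) (openS_anti h4) y)) e
  exact congrArg (fun z => (pair z).2) this

theorem exists_value (s : Stalk (homU A C)) (a : A.left.obj.V) : ∃ c : C.left.obj.V,
    ∀ (n : ℕ) (φ : Sec (homU A C) (openS n)) (x : Sec (UPre A) (openS n)), germ _ n φ = s →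
      (pair x).2 = a → (pair (fam φ ⟨openS n, le_rfl⟩ x)).2 = c := by
  obtain ⟨n, φ, rfl⟩ := exists_germ _ s
  obtain ⟨m, hm, x, rfl⟩ := exists_section A a n
  exact ⟨_, fun n' φ' x' h h' => fam_snd_eq h le_rfl hm x' x h'⟩

/-- The value of a germ of a section of `hom(UA, UC)` at an element of `A_∞`. -/
def value (s : Stalk (homU A C)) (a : A.left.obj.V) : C.left.obj.V := (exists_value s a).choose

theorem value_germ (n : ℕ) (φ : Sec (homU A C) (openS n)) (x : Sec (UPre A) (openS n)) :
    value (germ _ n φ) (pair x).2 = (pair (fam φ ⟨openS n, le_rfl⟩ x)).2 :=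
  ((exists_value (germ _ n φ) (pair x).2).choose_spec n φ x rfl rfl).symm

theorem exists_representatives (s : Stalk (homU A C)) (a : A.left.obj.V) (l : ℕ) :
    ∃ (n : ℕ) (φ : Sec (homU A C) (openS n)) (x : Sec (UPre A) (openS n)), l ≤ n ∧ germ _ n φ = s ∧
      (pair x).2 = a := by
  obtain ⟨n, φ, rfl⟩ := exists_germ _ s
  obtain ⟨m, hm, x, rfl⟩ := exists_section A a (max n l)
  exact ⟨m, res _ (openS_anti (by omega)) φ, x, by omega, germ_res _ (by omega) φ, rfl⟩

/-- Evaluation at infinity. -/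
def valueBilin (A C : AlgModel p) :
    A.left.obj.V →ₗ[ℚ] Stalk (homU A C) →ₗ[ℚ] C.left.obj.V :=
  LinearMap.mk₂ ℚ (fun a s => value s a)
    (fun a a' s => by
      obtain ⟨n, φ, x, -, rfl, rfl⟩ := exists_representatives s a 0
      obtain ⟨m, hm, x', rfl⟩ := exists_section A a' n
      rw [← germ_res _ hm, ← pair_res_snd (openS_anti hm) x (infty_mem_openS m), ← Prod.snd_add,
        ← pair_add, value_germ, value_germ, value_germ, map_add, pair_add]
      rfl)
    (fun c a s => by
      obtain ⟨n, φ, x, -, rfl, rfl⟩ := exists_representatives s a 0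
      rw [← Prod.smul_snd, ← pair_smul, value_germ, value_germ, map_smul, pair_smul]
      rfl)
    (fun a s s' => by
      obtain ⟨n, φ, rfl⟩ := exists_germ _ s
      obtain ⟨m, ψ, x, hm, rfl, rfl⟩ := exists_representatives s' a n
      rw [← germ_res _ hm, ← map_add, value_germ, value_germ, value_germ, fam_add, pair_add]
      rfl)
    (fun c a s => by
      obtain ⟨n, φ, x, -, rfl, rfl⟩ := exists_representatives s a 0
      rw [← map_smul, value_germ, value_germ, fam_smul, pair_smul]
      rfl)

theorem valueBilin_germ (n : ℕ) (φ : Sec (homU A C) (openS n)) (x : Sec (UPre A) (openS n)) :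
    valueBilin A C (pair x).2 (germ _ n φ) = (pair (fam φ ⟨openS n, le_rfl⟩ x)).2 :=
  value_germ n φ x

theorem valueBilin_act (g : Gp p) (a : A.left.obj.V) (s : Stalk (homU A C)) :
    valueBilin A C (A.left.obj.ρ g a) (stalkRep _ g s) = C.left.obj.ρ g (valueBilin A C a s) := by
  obtain ⟨n, φ, x, -, rfl, rfl⟩ := exists_representatives s a 0
  rw [stalkRep_germ, ← URep_snd, ← pair_act, valueBilin_germ, valueBilin_germ, fam_act_act]
  rfl

/-- Over S_n the components at k of the value of φ on a section y are the values at y_k of the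
restrictions of φ to {k}. This makes the evaluations at ∞ and at the points k compatible with the
structure maps. -/
theorem str_valueBilin (x : ∀ k, (A.right k).V) (a : A.left.obj.V)
    (hx : str A a = tailsMk (fun k => (A.right k).V) x) (s : Stalk (homU A C))
    (t : ∀ k, Sec (homU A C) (openPt k))
    (ht : stalkToTails _ s = tailsMk (fun k => Sec (homU A C) (openPt k)) t) :
    str C (valueBilin A C a s) =
      tailsMk (fun k => (C.right k).V) fun k => ptEval A C k (x k) (t k) := by
  obtain ⟨n, φ, y, -, rfl, rfl⟩ := exists_representatives s a 0
  rw [valueBilin_germ, (pair_mem _).2.2 (infty_mem_openS n), tailsMk_eq_iff]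
  rw [(pair_mem y).2.2 (infty_mem_openS n), tailsMk_eq_iff] at hx
  rw [stalkToTails_germ, tailsMk_eq_iff] at ht
  obtain ⟨i, hi⟩ := hx
  obtain ⟨j, hj⟩ := ht
  refine ⟨max n (max i j), fun k hk => ?_⟩
  rw [fam_fst φ le_rfl y (coe_mem_openS.2 (show n ≤ k by omega)), hi k (by omega),
    ← hj k (by omega), seqOf_apply _ (show n ≤ k by omega)]

/-- A section of UC is determined by its components. Those at k vanish for large k by the first
hypothesis. If W contains ∞, then it contains some S_l; restricting to it, the component at ∞
becomes the value of the germ at an element of A_∞, which is zero by the second hypothesis. -/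
theorem germ_eq_zero (s : Stalk (homU A C)) (h : stalkToTails _ s = 0)
    (h' : ∀ a, valueBilin A C a s = 0) : s = 0 := by
  obtain ⟨n, φ, rfl⟩ := exists_germ _ s
  rw [stalkToTails_germ, ← map_zero (tailsMk _), tailsMk_eq_iff] at h
  obtain ⟨m, hm⟩ := h
  rw [← germ_res _ (le_max_left n m)]
  convert map_zero (germ (homU A C) (max n m))
  apply fam_ext
  funext W
  apply LinearMap.ext
  intro x
  obtain ⟨W, hW⟩ := W
  apply sec_ext
  · intro k hk
    have hk' := coe_mem_openS.1 (hW hk)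
    have e := hm k (by omega)
    rw [seqOf_apply _ (show n ≤ k by omega)] at e
    rw [fam_fst _ hW x hk, res_res, e, Pi.zero_apply, map_zero]
    rfl
  · intro hk
    obtain ⟨l, hl⟩ := mem_of_infty_mem W hk
    have hle : openS (max l (max n m)) ≤ W := by
      intro y hy
      induction y using OnePoint.rec with
      | infty => exact hk
      | coe k => exact hl k ((le_max_left _ _).trans (coe_mem_openS.1 hy))
    refine (pair_res_snd hle _ (infty_mem_openS _)).symm.trans ?_
    rw [fam_nat _ W _ hW hle x]
    refine (valueBilin_germ _ (res (homU A C) (openS_anti (by omega)) φ) _).symm.trans ?_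
    rw [germ_res _ (show n ≤ max l (max n m) by omega)]
    exact h' _

/-- The evaluation `A_∞ ⊗ hom(A, C)_∞ → C_∞`. -/
def evLeft (A C : AlgModel p) : (A ⊗ RObj (homU A C)).left ⟶ C.left :=
  mkHom (X := (A ⊗ RObj (homU A C)).left) (Y := C.left)
    (TensorProduct.lift ((valueBilin A C).compl₂ (LinearMap.fst ℚ _ _ ∘ₗ
      Submodule.subtype (RSub (homU A C) ⊓ discretePart (RRep (homU A C)))))) (fun g v => by
    refine LinearMap.congr_fun (f := TensorProduct.lift _ ∘ₗ
      TensorProduct.map (A.left.obj.ρ g) ((RObj (homU A C)).left.obj.ρ g))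
      (g := C.left.obj.ρ g ∘ₗ TensorProduct.lift _) ?_ v
    apply TensorProduct.ext'
    intro a r
    exact valueBilin_act g a _)

/-- The evaluation `A_k ⊗ hom(A, C)_k → C_k`. -/
def evRight (A C : AlgModel p) : (A ⊗ RObj (homU A C)).right ⟶ C.right := fun k =>
  mkRep (M := (A ⊗ RObj (homU A C)).right k) (N := C.right k)
    (TensorProduct.lift ((ptEval A C k).compl₂
      (fixedSub (act (homU A C) (openPt k)) k).subtype)) (fun g v => by
    refine LinearMap.congr_fun (f := TensorProduct.lift _ ∘ₗ
      TensorProduct.map ((A.right k).ρ g) ((RFam (homU A C) k).ρ g))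
      (g := (C.right k).ρ g ∘ₗ TensorProduct.lift _) ?_ v
    apply TensorProduct.ext'
    intro a r
    have e := ptEval_act k (liftGk k g) a r.1
    rw [proj_liftGk] at e
    exact e)

/-- The evaluation `A ⊗ hom(A, C) → C`. -/
def evA (A C : AlgModel p) : A ⊗ RObj (homU A C) ⟶ C :=
  mkAlg (evLeft A C) (evRight A C) (fun q => by
    refine LinearMap.congr_fun (f := str C ∘ₗ lin (evLeft A C)) (g := tailsMap (fun k =>
      rlin (evRight A C k)) ∘ₗ str (A ⊗ RObj (homU A C))) ?_ q
    apply TensorProduct.ext'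
    intro a r
    obtain ⟨⟨s, t⟩, hr, hd⟩ := r
    obtain ⟨x, hx⟩ := tailsMk_surjective (str A a)
    obtain ⟨t, rfl⟩ := tailsMk_surjective t
    refine (str_valueBilin x a hx.symm s (fun k => (t k).1) hr).trans ?_
    change _ = tailsMap _ (tailsTensor (str A a ⊗ₜ tailsMk _ t))
    rw [← hx]
    rfl)

end Evaluation
end ZpModel


/-! ### The adjunction between A ⊗ - and R hom(UA, U-) -/

namespace ZpModel

section Adjunction
open Opposite TopologicalSpace
variable {p : ℕ} [Fact p.Prime] {A B C : AlgModel p}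

open TensorProduct in
/-- The componentwise action of a map `A ⊗ B → C`. -/
def pairing (h : A ⊗ B ⟶ C) : USeq A →ₗ[ℚ] USeq B →ₗ[ℚ] USeq C :=
  LinearMap.mk₂ ℚ (fun x y => (fun k => rlin (h.right k) (x.1 k ⊗ₜ y.1 k),
      lin h.left (x.2 ⊗ₜ y.2)))
    (fun _ _ _ => Prod.ext (funext fun k =>
      (congrArg (rlin (h.right k)) (TensorProduct.add_tmul _ _ _)).trans (map_add _ _ _))
      ((congrArg (lin h.left) (TensorProduct.add_tmul _ _ _)).trans (map_add _ _ _)))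
    (fun c x y => Prod.ext (funext fun k => (map_smul (rlin (h.right k)) c (x.1 k ⊗ₜ y.1 k)))
      (map_smul (lin h.left) c (x.2 ⊗ₜ y.2)))
    (fun _ _ _ => Prod.ext (funext fun k =>
      (congrArg (rlin (h.right k)) (TensorProduct.tmul_add _ _ _)).trans (map_add _ _ _))
      ((congrArg (lin h.left) (TensorProduct.tmul_add _ _ _)).trans (map_add _ _ _)))
    (fun _ _ _ => Prod.ext (funext fun k =>
      (congrArg (rlin (h.right k)) (TensorProduct.tmul_smul _ _ _)).trans (map_smul _ _ _))
      ((congrArg (lin h.left) (TensorProduct.tmul_smul _ _ _)).trans (map_smul _ _ _)))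

open TensorProduct in
theorem pairing_fst (h : A ⊗ B ⟶ C) (x : USeq A) (y : USeq B) (k : ℕ) :
    (pairing h x y).1 k = rlin (h.right k) (x.1 k ⊗ₜ y.1 k) := rfl

open TensorProduct in
theorem pairing_snd (h : A ⊗ B ⟶ C) (x : USeq A) (y : USeq B) :
    (pairing h x y).2 = lin h.left (x.2 ⊗ₜ y.2) := rfl

theorem pairing_act (h : A ⊗ B ⟶ C) (g : Gp p) (x : USeq A) (y : USeq B) :
    pairing h (URep A g x) (URep B g y) = URep C g (pairing h x y) :=
  Prod.ext (funext fun k => rlin_comm (h.right k) (proj p k g) (x.1 k ⊗ₜ[ℚ] y.1 k))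
    (lin_comm h.left g (x.2 ⊗ₜ[ℚ] y.2))

theorem pairing_mem (h : A ⊗ B ⟶ C) {V W : Opens Sp} (hW : W ≤ V) {x : USeq A} {y : USeq B}
    (hx : x ∈ USub A W) (hy : y ∈ USub B V) : pairing h x y ∈ USub C W := by
  refine ⟨fun k hk => ?_, fun hk => ?_, fun hk => ?_⟩
  · rw [pairing_fst, hx.1 k hk, TensorProduct.zero_tmul]
    exact map_zero _
  · rw [pairing_snd, hx.2.1 hk, TensorProduct.zero_tmul]
    exact map_zero _
  · refine (compat_hom h (x.2 ⊗ₜ[ℚ] y.2)).trans ?_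
    change tailsMap _ (tailsTensor (str A x.2 ⊗ₜ str B y.2)) = _
    rw [hx.2.2 hk, hy.2.2 (hW hk)]
    rfl

theorem pairing_trunc (h : A ⊗ B ⟶ C) (W : Opens Sp) (x : USeq A) (y : USeq B) :
    trunc C W (pairing h x y) = pairing h (trunc A W x) y := by
  apply Prod.ext
  · funext k
    rw [trunc_fst, pairing_fst, pairing_fst, trunc_fst]
    split_ifs
    · rfl
    · rw [TensorProduct.zero_tmul]
      exact (map_zero _).symm
  · rw [trunc_snd, pairing_snd, pairing_snd, trunc_snd]
    split_ifs
    · rfl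
    · rw [TensorProduct.zero_tmul]
      exact (map_zero _).symm

theorem pairing_trunc_right (h : A ⊗ B ⟶ C) {W W' : Opens Sp} (hW : W' ≤ W) {x : USeq A}
    (hx : x ∈ USub A W') (y : USeq B) : pairing h x (trunc B W y) = pairing h x y := by
  apply Prod.ext
  · funext k
    rw [pairing_fst, pairing_fst, trunc_fst]
    split_ifs with hk
    · rfl
    · rw [hx.1 k fun h => hk (hW h), TensorProduct.zero_tmul, TensorProduct.zero_tmul]
  · rw [pairing_snd, pairing_snd, trunc_snd]
    split_ifs with hk
    · rfl
    · rw [hx.2.1 fun h => hk (hW h), TensorProduct.zero_tmul, TensorProduct.zero_tmul]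

/-- The map `UA(W) → UC(W)` given by a section of `UB` over `V ⊇ W`. -/
def curryLin (h : A ⊗ B ⟶ C) {V W : Opens Sp} (hW : W ≤ V) (y : Sec (UPre B) V) :
    Sec (UPre A) W →ₗ[ℚ] Sec (UPre C) W where
  toFun x := mkSec C W (pairing h (pair x) (pair y)) (pairing_mem h hW (pair_mem x) (pair_mem y)) (by
    obtain ⟨n, hn⟩ := sec_discrete (UPre A) x
    obtain ⟨m, hm⟩ := sec_discrete (UPre B) y
    refine ⟨max n m, fun g hg => ?_⟩
    rw [← pairing_act, ← pair_act, ← pair_act, hn g (hg.mono (le_max_left _ _)),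
      hm g (hg.mono (le_max_right _ _))])
  map_add' x x' := pair_ext (LinearMap.map_add₂ (pairing h) (pair x) (pair x') (pair y))
  map_smul' c x := pair_ext (LinearMap.map_smul₂ (pairing h) c (pair x) (pair y))

/-- The family of maps given by a section of `UB`. -/
def curryFam (h : A ⊗ B ⟶ C) (V : Opens Sp) :
    Sec (UPre B) V →ₗ[ℚ] HomFam (UPre A) (UPre C) V where
  toFun y W := curryLin h W.2 y
  map_add' y y' := funext fun _ => LinearMap.ext fun x =>
    pair_ext ((pairing h (pair x)).map_add (pair y) (pair y'))
  map_smul' c y := funext fun _ => LinearMap.ext fun x =>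
    pair_ext ((pairing h (pair x)).map_smul c (pair y))

theorem curryFam_act (h : A ⊗ B ⟶ C) (V : Opens Sp) (g : Gp p) (y : Sec (UPre B) V) :
    curryFam h V (act (UPre B) V g y) = homRep (UPre A) (UPre C) V g (curryFam h V y) := by
  funext W
  apply LinearMap.ext
  intro x
  apply pair_ext
  change pairing h (pair x) (URep B g (pair y)) =
    URep C g (pairing h (URep A g⁻¹ (pair x)) (pair y))
  rw [← pairing_act, rep_inv_self]

theorem curryFam_mem (h : A ⊗ B ⟶ C) (V : Opens Sp) (y : Sec (UPre B) V) :
    curryFam h V y ∈ homNat (UPre A) (UPre C) V ⊓ discretePart (homRep (UPre A) (UPre C) V) := by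
  constructor
  · intro W W' hW hW' x
    apply pair_ext
    exact pairing_trunc h W' (pair x) (pair y)
  · obtain ⟨n, hn⟩ := sec_discrete (UPre B) y
    exact ⟨n, fun g hg => by rw [← curryFam_act, hn g hg]⟩

/-- The map `UB → hom(UA, UC)` given by a map `A ⊗ B → C`. -/
def curryU (h : A ⊗ B ⟶ C) : UPre B ⟶ homU A C where
  app V := mkHom (X := (UPre B).obj V) (Y := (homU A C).obj V)
    ((curryFam h V.unop).codRestrict (homNat (UPre A) (UPre C) V.unop ⊓
      discretePart (homRep (UPre A) (UPre C) V.unop)) (curryFam_mem h V.unop))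
    (fun g y => Subtype.ext (curryFam_act h V.unop g y))
  naturality V V' i := by
    apply lin_ext
    intro y
    apply fam_ext
    funext W
    apply LinearMap.ext
    intro x
    apply pair_ext
    exact pairing_trunc_right h W.2 (pair_mem x) (pair y)

/-- The map `RM → RN` induced by a map of presheaves. -/
def mapR {M N : TopCat.Presheaf (DiscMod p) Sp} (f : M ⟶ N) : RObj M ⟶ RObj N where
  left := discreteSubMap (RPairMap f) (RPairMap_act f) (RPairMap_mem f)
  right k := fixedMap f k
  w := rfl

/-- The map `hom(UA, UC) → hom(UA, UC')` induced by a map `C → C'`. -/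
def homUMap (A : AlgModel p) {C C' : AlgModel p} (f : C ⟶ C') : homU A C ⟶ homU A C' :=
  ((sheafHom ((U p).obj A)).map ((U p).map f)).hom

theorem R_map {M N : SheafModel p} (f : M ⟶ N) : (R p).map f = mapR f.hom := rfl

/-- The transpose of a map `A ⊗ B → C`. -/
def curryA (h : A ⊗ B ⟶ C) : B ⟶ RObj (homU A C) := unitRU B ≫ mapR (curryU h)

/-- The map `A ⊗ B → C` with a given transpose. -/
def uncurryA (g : B ⟶ RObj (homU A C)) : A ⊗ B ⟶ C := A ◁ g ≫ evA A C

open TensorProduct in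
theorem tensor_hom_ext {f g : A ⊗ B ⟶ C}
    (h : ∀ a b, lin f.left (a ⊗ₜ b) = lin g.left (a ⊗ₜ b))
    (h' : ∀ k a b, rlin (f.right k) (a ⊗ₜ b) = rlin (g.right k) (a ⊗ₜ b)) : f = g := by
  apply CommaMorphism.ext
  · apply lin_ext
    exact LinearMap.congr_fun (f := lin f.left) (g := lin g.left) (TensorProduct.ext' h)
  · funext k
    apply rlin_ext
    exact LinearMap.congr_fun (f := rlin (f.right k)) (g := rlin (g.right k))
      (TensorProduct.ext' (h' k))

/-- The germ of the value at `b ∈ B_∞` of a map `B → hom(A, C)`. -/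
abbrev germAt (g : B ⟶ RObj (homU A C)) (b : B.left.obj.V) : Stalk (homU A C) :=
  (show ↥(RSub (homU A C) ⊓ discretePart (RRep (homU A C))) from lin g.left b).1.1

/-- The tail of the value at `b ∈ B_∞` of a map `B → hom(A, C)`. -/
abbrev tailsAt (g : B ⟶ RObj (homU A C)) (b : B.left.obj.V) :
    TailsMod fun k => (RFam (homU A C) k).V :=
  (show ↥(RSub (homU A C) ⊓ discretePart (RRep (homU A C))) from lin g.left b).1.2

theorem stalkToTails_germAt (g : B ⟶ RObj (homU A C)) (b : B.left.obj.V) :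
    stalkToTails (homU A C) (germAt g b) = inclTails (homU A C) (tailsAt g b) :=
  (show ↥(RSub (homU A C) ⊓ discretePart (RRep (homU A C))) from lin g.left b).2.1

theorem tailsAt_eq (g : B ⟶ RObj (homU A C)) (b : B.left.obj.V) :
    tailsAt g b = tailsMap (fun k => rlin (g.right k)) (str B b) := compat_hom g b

/-- The value at `b ∈ B_k` of a map `B → hom(A, C)`. -/
abbrev secAt (g : B ⟶ RObj (homU A C)) (k : ℕ) (b : (B.right k).V) :
    Sec (homU A C) (openPt k) :=
  (show ↥(fixedSub (act (homU A C) (openPt k)) k) from rlin (g.right k) b).1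

open TensorProduct in
theorem uncurryA_left (g : B ⟶ RObj (homU A C)) (a : A.left.obj.V) (b : B.left.obj.V) :
    lin (uncurryA g).left (a ⊗ₜ b) = valueBilin A C a (germAt g b) := rfl

open TensorProduct in
theorem uncurryA_right (g : B ⟶ RObj (homU A C)) (k : ℕ) (a : (A.right k).V)
    (b : (B.right k).V) :
    rlin ((uncurryA g).right k) (a ⊗ₜ b) = ptEval A C k a (secAt g k b) := rfl

/-- At ∞, elements of A_∞ and B_∞ are represented by sections over a common S_m. There the transpose
acts by `pairing`, whose component at ∞ is the given map. -/
theorem uncurryA_curryA (h : A ⊗ B ⟶ C) : uncurryA (curryA h) = h := by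
  apply tensor_hom_ext
  · intro a b
    refine (uncurryA_left _ _ _).trans ?_
    obtain ⟨n, -, y, rfl⟩ := exists_section B b 0
    obtain ⟨m, hm, x, rfl⟩ := exists_section A a n
    have e : germAt (curryA h) (pair y).2 =
        germ (homU A C) m (lin ((curryU h).app (op (openS m))) (res _ (openS_anti hm) y)) := by
      rw [← stalkMap_germ, germ_res _ hm]
      change stalkMap (curryU h) ((stalkEquiv B).symm _) = _
      congr 1
      rw [LinearEquiv.symm_apply_eq, stalkEquiv_germ]
    rw [e, valueBilin_germ]
    refine (pairing_snd h _ _).trans ?_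
    rw [pair_res_snd _ _ (infty_mem_openS m)]
  · intro k a b
    refine (uncurryA_right _ _ _ _).trans ?_
    refine (pairing_fst h (pair (ptSec A k a)) (pair (ptSec B k b)) k).trans ?_
    rw [pair_ptSec, pair_ptSec]

/-- A section over {k} is determined by its values on A_k, so the components at k are recovered. At
∞, the tail is determined by these through the structure map of B, and the germ by its tail and its
values on A_∞. As `curryA` is a right inverse of `uncurryA`, injectivity is all that remains for
bijectivity. -/
theorem uncurryA_injective : Function.Injective (uncurryA (A := A) (B := B) (C := C)) := by
  intro g g' h
  have hr : g.right = g'.right := by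
    funext k
    apply rlin_ext
    intro b
    apply Subtype.ext
    refine ptEval_ext (φ := secAt g k b) (ψ := secAt g' k b) fun a => ?_
    exact congrArg (fun f : A ⊗ B ⟶ C => rlin (f.right k) (a ⊗ₜ[ℚ] b)) h
  apply CommaMorphism.ext
  · apply lin_ext
    intro b
    apply Subtype.ext
    have e2 : tailsAt g b = tailsAt g' b := by
      rw [tailsAt_eq, tailsAt_eq, hr]
    refine Prod.ext ?_ e2
    refine sub_eq_zero.1 (germ_eq_zero (germAt g b - germAt g' b) ?_ fun a => ?_)
    · rw [map_sub, sub_eq_zero]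
      rw [stalkToTails_germAt, stalkToTails_germAt, e2]
    · rw [map_sub, sub_eq_zero]
      exact congrArg (fun f : A ⊗ B ⟶ C => lin f.left (a ⊗ₜ[ℚ] b)) h
  · exact hr

theorem uncurryA_comp_left {B' : AlgModel p} (f : B ⟶ B') (g : B' ⟶ RObj (homU A C)) :
    uncurryA (f ≫ g) = A ◁ f ≫ uncurryA g := by
  rw [uncurryA, uncurryA, MonoidalCategory.whiskerLeft_comp, Category.assoc]

theorem uncurryA_comp_right {C' : AlgModel p} (g : B ⟶ RObj (homU A C)) (f : C ⟶ C') :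
    uncurryA (g ≫ mapR (homUMap A f)) = uncurryA g ≫ f := by
  apply tensor_hom_ext
  · intro a b
    refine (uncurryA_left _ _ _).trans ?_
    change _ = lin f.left (lin (uncurryA g).left _)
    rw [uncurryA_left]
    change valueBilin A C' a (stalkMap (homUMap A f)
      (germAt g b)) = _
    obtain ⟨n, φ, x, -, hs, rfl⟩ := exists_representatives (germAt g b) a 0
    rw [← hs, stalkMap_germ, valueBilin_germ, valueBilin_germ]
    rfl
  · intro k a b
    rfl

variable (A B C) in
/-- Maps `A ⊗ B → C` correspond to maps `B → hom(A, C)`. -/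
def homEquivA : (A ⊗ B ⟶ C) ≃ (B ⟶ RObj (homU A C)) :=
  (Equiv.ofBijective uncurryA ⟨uncurryA_injective, fun h => ⟨curryA h, uncurryA_curryA h⟩⟩).symm

theorem homEquivA_comp {C' : AlgModel p} (h : A ⊗ B ⟶ C) (f : C ⟶ C') :
    homEquivA A B C' (h ≫ f) = homEquivA A B C h ≫ mapR (homUMap A f) := by
  apply uncurryA_injective
  rw [uncurryA_comp_right]
  exact (Equiv.symm_apply_apply (homEquivA A B C') (h ≫ f)).trans
    (congrArg (· ≫ f) (Equiv.symm_apply_apply (homEquivA A B C) h).symm)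

theorem homEquivA_symm_comp {B' : AlgModel p} (f : B ⟶ B') (g : B' ⟶ RObj (homU A C)) :
    (homEquivA A B C).symm (f ≫ g) = A ◁ f ≫ (homEquivA A B' C).symm g :=
  uncurryA_comp_left f g

attribute [local irreducible] RObj mapR

theorem ihomA_map (A : AlgModel p) {C C' : AlgModel p} (f : C ⟶ C') :
    (ihomA A).map f = mapR (homUMap A f) :=
  R_map ((sheafHom ((U p).obj A)).map ((U p).map f))

theorem homEquivA_comp_ihomA {C' : AlgModel p} (h : A ⊗ B ⟶ C) (f : C ⟶ C') :
    homEquivA A B C' (h ≫ f) =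
      CategoryStruct.comp (Z := RObj (homU A C')) (homEquivA A B C h) ((ihomA A).map f) :=
  (homEquivA_comp h f).trans (congrArg (fun z : RObj (homU A C) ⟶ RObj (homU A C') =>
    homEquivA A B C h ≫ z) (ihomA_map A f).symm)

variable (A) in
/-- The functor `A ⊗ -` is left adjoint to `hom(A, -)`. -/
def adjA : tensorLeft A ⊣ ihomA A :=
  Adjunction.mkOfHomEquiv
    { homEquiv := fun B C => homEquivA A B C
      homEquiv_naturality_left_symm := fun f g => homEquivA_symm_comp f g
      homEquiv_naturality_right := fun h f => homEquivA_comp_ihomA h f }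

end Adjunction
end ZpModel


/-! ### The model structure and its axioms for the algebraic model -/

namespace ZpModel

section ModelStructure
variable (p : ℕ) [Fact p.Prime]

instance (X : AlgModel p) :
    PreservesColimitsOfSize.{0, 0} ((curriedTensor (AlgModel p)).obj X) := ⟨inferInstance⟩

instance (X : AlgModel p) :
    PreservesColimitsOfSize.{0, 0} ((curriedTensor (AlgModel p)).flip.obj X) := ⟨inferInstance⟩

theorem isCompactObj_regObj (N : ℕ) : DGModel.IsCompactObj (regObj p N) :=
  (goodRegObj N).isCompactObj

/-- The model structure on complexes in the algebraic model. -/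
abbrev dgModelCategory : ModelCategory (DG p) :=
  DGModel.modelCategory (regObj p) (isCompactObj_regObj p) (dgWeakEquivalences p)
    (fun e => dgWeakEquivalences_homotopyEquiv p e) weakEquivalences_inf_fibs

section
attribute [local irreducible] ihomA

variable {p} in
theorem isLimit_ihomComponent (adj : ∀ X : AlgModel p, tensorLeft X ⊣ ihomA X) (K L : DG p)
    (n : ℤ) : letI := DGTensor.monoidalClosed adj
    Nonempty (IsLimit (Fan.mk (((ihom K).obj L).X n) (ihomComponent adj K L n))) := by
  let _ := DGTensor.monoidalClosed adj
  exact DGTensor.isLimit_homComponent adj K L n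

end

theorem dg_pushoutProductAxiom :
    letI := dgModelCategory p
    MonoidalModel.PushoutProductAxiom (DG p) := by
  refine DGModel.pushoutProductAxiom (regObj p) (isCompactObj_regObj p) (dgWeakEquivalences p)
    (fun e => dgWeakEquivalences_homotopyEquiv p e) weakEquivalences_inf_fibs adjA
    (fun i j _ _ f hf => ?_) (fun i j _ _ f hf => ?_)
  · rw [fibs_regObj] at hf
    exact dgFibrations_le ((goodRegObj i).tensor (goodRegObj j)) _ hf
  · rw [trivFibs_regObj] at hf
    exact dgPairLift_le ((goodRegObj i).tensor (goodRegObj j)) _ hf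

theorem dg_unitAxiom :
    letI := dgModelCategory p
    MonoidalModel.UnitAxiom (DG p) := by
  refine DGModel.unitAxiom (regObj p) (isCompactObj_regObj p) (dgWeakEquivalences p)
    (fun e => dgWeakEquivalences_homotopyEquiv p e) weakEquivalences_inf_fibs (fun f hf => ?_)
  rw [trivFibs_regObj] at hf
  exact dgPairLift_le goodUnit _ hf

theorem dg_monoidAxiom :
    letI := dgModelCategory p
    MonoidalModel.MonoidAxiom (DG p) :=
  DGModel.monoidAxiom (regObj p) (isCompactObj_regObj p) (dgWeakEquivalences p)
    (fun e => dgWeakEquivalences_homotopyEquiv p e) weakEquivalences_inf_fibs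

end ModelStructure
end ZpModel

end

theorem mainTheorem10 (p : ℕ) [Fact p.Prime] :
    ∃ (_ : ModelCategory (ZpModel.DG p)) (_ : SymmetricCategory (ZpModel.DG p))
      (_ : MonoidalClosed (ZpModel.DG p))
      (adj : ∀ X : ZpModel.AlgModel p, tensorLeft X ⊣ ZpModel.ihomA X),
      HasLimits (ZpModel.DG p) ∧ HasColimits (ZpModel.DG p) ∧
      fibrations (ZpModel.DG p) = ZpModel.dgFibrations p ∧
      weakEquivalences (ZpModel.DG p) = ZpModel.dgWeakEquivalences p ∧
      (∀ (K L : ZpModel.DG p) (i j n : ℤ) (h : i + j = n),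
        HomologicalComplex.ιTensorObj K L i j n h ≫ (β_ K L).hom.f n =
          (i * j).negOnePow • ((β_ (K.X i) (L.X j)).hom ≫
            HomologicalComplex.ιTensorObj L K j i n (by rw [add_comm, h]))) ∧
      (∀ (K L : ZpModel.DG p) (n : ℤ),
        Nonempty (IsLimit (Fan.mk (((ihom K).obj L).X n)
          (ZpModel.ihomComponent adj K L n)))) ∧
      MonoidalModel.PushoutProductAxiom (ZpModel.DG p) ∧
      MonoidalModel.UnitAxiom (ZpModel.DG p) ∧
      MonoidalModel.MonoidAxiom (ZpModel.DG p) := by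
  exact ⟨ZpModel.dgModelCategory p, inferInstance, DGTensor.monoidalClosed ZpModel.adjA,
    ZpModel.adjA, inferInstance, inferInstance, ZpModel.fibs_regObj, rfl,
    fun K L i j n h => DGTensor.tι_braiding K L i j n h,
    fun K L n => ZpModel.isLimit_ihomComponent ZpModel.adjA K L n,
    ZpModel.dg_pushoutProductAxiom p, ZpModel.dg_unitAxiom p, ZpModel.dg_monoidAxiom p⟩
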